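/- Let $k$ be an algebraically closed field of characteristic $0$. A variety over $k$ is an integral separated scheme of finite type over $k$; it is quasi-projective if it admits a locally closed immersion over $k$ into some $\mathbb{P}^n_k$. For a quasi-projective variety $X$ over $k$ and an integer $m\ge 1$, let $\operatorname{Sym}^m(X)=X^m/S_m$ be the quotient of the $m$-fold fibre product $X^m=X\times_k\cdots\times_k X$ by the symmetric group $S_m$ permuting the factors. For an integral domain $A$ with fraction field $K$ and an $A$-scheme $\mathcal{X}$, let $\mathcal{X}(A)^{(1)}$ be the set of near-integral $A$-points of $\mathcal{X}$: those $P\in\mathcal{X}(K)$ which, for every prime ideal $\mathfrak{p}\subset A$ of height one, lie in the image of $\mathcal{X}(A_{\mathfrak{p}})\to\mathcal{X}(K)$. A variety $Y$ over $k$ is arithmetically-special over $k$ if there are a subring $A\subset k$ that is finitely generated over $\mathbb{Z}$ and a separated $A$-scheme $\mathcal{Y}$ of finite type with an isomorphism $\mathcal{Y}\times_A k\cong Y$ over $k$ such that $\mathcal{Y}(A)^{(1)}$, viewed as a set of points of $Y$ through $\mathcal{Y}(K)\subset\mathcal{Y}(k)=Y(k)$, is Zariski dense in $Y$. **Theorem.**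 Let $X$ be a quasi-projective variety over $k$ and let $m\ge 1$. If $\operatorname{Sym}^m(X)$ is arithmetically-special over $k$, then $\operatorname{Sym}^m(X\times_k\mathbb{P}^1_k)$ is arithmetically-special over $k$. -/

import Mathlib

open CategoryTheory CategoryTheory.Limits AlgebraicGeometry

noncomputable section

namespace SymArith

universe u

attribute [local instance] MvPolynomial.gradedAlgebra

/-! ### Projective space and quasi-projective varieties -/

/-- Projective `n`-space over a ring `R`, the homogeneous spectrum of `R[x₀, …, xₙ]`. -/
def projectiveSpace (n : ℕ) (R : Type u) [CommRing R] : Scheme.{u} :=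
  Proj (MvPolynomial.homogeneousSubmodule (Fin (n + 1)) R)

/-- The structure morphism `ℙⁿ_R ⟶ Spec R`. -/
def projectiveSpace.toSpec (n : ℕ) (R : Type u) [CommRing R] :
    projectiveSpace n R ⟶ Spec (.of R) :=
  Proj.toSpecZero (MvPolynomial.homogeneousSubmodule (Fin (n + 1)) R) ≫
    Spec.map (CommRingCat.ofHom
      (algebraMap R (MvPolynomial.homogeneousSubmodule (Fin (n + 1)) R 0)))

/-- A variety over the field `k`: an integral scheme, separated and of finite type over `k`. -/
structure IsVariety {k : Type u} [Field k] {X : Scheme.{u}} (f : X ⟶ Spec (.of k)) : Prop where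
  integral : IsIntegral X
  separated : IsSeparated f
  locallyOfFiniteType : LocallyOfFiniteType f
  quasiCompact : QuasiCompact f

/-- `X` is quasi-projective over `k`: it admits a (locally closed) immersion over `k` into some
projective space over `k`. -/
def IsQuasiProjective {k : Type u} [Field k] {X : Scheme.{u}} (f : X ⟶ Spec (.of k)) : Prop :=
  ∃ (n : ℕ) (i : X ⟶ projectiveSpace n k), IsImmersion i ∧ i ≫ projectiveSpace.toSpec n k = f

/-! ### Symmetric powers -/

section SymPower

variable {X S : Scheme.{u}} (m : ℕ) (f : X ⟶ S)

/-- The `m`-fold fibre power `X ×_S ⋯ ×_S X`. -/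
def power : Scheme.{u} :=
  widePullback S (fun _ : Fin m => X) (fun _ => f)

/-- The structure morphism of the fibre power. -/
def power.toBase : power m f ⟶ S :=
  WidePullback.base (fun _ : Fin m => f)

/-- The permutation of the factors `(x₁, …, xₘ) ↦ (x_{σ(1)}, …, x_{σ(m)})` of the fibre power. -/
def power.perm (σ : Equiv.Perm (Fin m)) : power m f ⟶ power m f :=
  WidePullback.lift (power.toBase m f) (fun i => WidePullback.π (fun _ : Fin m => f) (σ i))
    (fun i => WidePullback.π_arrow (fun _ : Fin m => f) (σ i))

lemma power.perm_toBase (σ : Equiv.Perm (Fin m)) :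
    power.perm m f σ ≫ power.toBase m f = power.toBase m f :=
  WidePullback.lift_base _ _ _ _

/-- The `m`-th symmetric power `Symᵐ_S(X) = (X ×_S ⋯ ×_S X) / S_m`: the quotient, in locally ringed
spaces, of the fibre power by the permutations of its factors, that is, the common coequalizer of
all these permutations (the identity is one of them). Its underlying space is the orbit space, and
its structure sheaf is the sheaf of invariant functions. For `X` quasi-projective over a field it is
a scheme, and it is then the usual quotient of the scheme `Xᵐ` by the finite group `S_m`. -/
def symPower : LocallyRingedSpace.{u} :=
  wideCoequalizer (fun σ : Equiv.Perm (Fin m) => (power.perm m f σ).toLRSHom)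

/-- The structure morphism `Symᵐ_S(X) ⟶ S`, induced by that of the fibre power. -/
def symPower.toBase : symPower m f ⟶ S.toLocallyRingedSpace :=
  wideCoequalizer.desc (power.toBase m f).toLRSHom
    (fun σ τ => by
      rw [← Scheme.Hom.comp_toLRSHom, ← Scheme.Hom.comp_toLRSHom, power.perm_toBase,
        power.perm_toBase])

end SymPower

/-! ### Near-integral points and arithmetic specialness -/

section NearIntegral

variable (A : Type u) [CommRing A] [IsDomain A]

/-- For a prime `p` of a domain `A`, the morphism `Spec (Frac A) ⟶ Spec A_p` given by the inclusion
of the local ring `A_p` into the fraction field. -/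
def specFractionToLocal (p : Ideal A) [p.IsPrime] :
    Spec (.of (FractionRing A)) ⟶ Spec (.of (Localization.AtPrime p)) :=
  Spec.map (CommRingCat.ofHom (IsLocalization.lift (M := p.primeCompl)
    (S := Localization.AtPrime p) (g := algebraMap A (FractionRing A))
    (fun y => IsLocalization.map_units (FractionRing A)
      (⟨y, p.primeCompl_le_nonZeroDivisors y.2⟩ : nonZeroDivisors A))))

/-- The set `X(A)⁽¹⁾` of near-integral `A`-points of `f : X ⟶ Spec A`: the `A`-morphisms
`P : Spec K ⟶ X`, where `K = Frac A`, which for every prime `p` of height one lie in the image of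
`X(A_p) → X(K)`. -/
def nearIntegralPoints {X : Scheme.{u}} (f : X ⟶ Spec (.of A)) :
    Set (Spec (.of (FractionRing A)) ⟶ X) :=
  {P | P ≫ f = Spec.map (CommRingCat.ofHom (algebraMap A (FractionRing A))) ∧
    ∀ (p : Ideal A) [p.IsPrime], p.height = 1 →
      ∃ Q : Spec (.of (Localization.AtPrime p)) ⟶ X,
        Q ≫ f = Spec.map (CommRingCat.ofHom (algebraMap A (Localization.AtPrime p))) ∧
        specFractionToLocal A p ≫ Q = P}

end NearIntegral

section Special

variable (k : Type u) [Field k]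

/-- The morphism `Spec k ⟶ Spec A` for a subring `A` of the field `k`. -/
def specToSubring (A : Subalgebra ℤ k) : Spec (.of k) ⟶ Spec (.of A) :=
  Spec.map (CommRingCat.ofHom (algebraMap A k))

/-- The morphism `Spec k ⟶ Spec K` for a subring `A` of `k` with fraction field `K`. -/
def specToFraction (A : Subalgebra ℤ k) : Spec (.of k) ⟶ Spec (.of (FractionRing A)) :=
  Spec.map (CommRingCat.ofHom (IsFractionRing.lift (A := A) (K := FractionRing A) (L := k)
    (g := algebraMap A k) Subtype.val_injective))

/-- `Y` over `k` is arithmetically-special: there are a finitely generated subring `A` of `k` and a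
separated `A`-scheme `𝒴` of finite type with an isomorphism `e : 𝒴 ×_A k ≅ Y` over `k` such that
the (closed) points of `Y` given by the near-integral `A`-points of `𝒴` are dense in `Y`.
The definition is phrased for locally ringed spaces over `k` so that it applies to
quotients; as `e` identifies `Y` with the scheme `𝒴 ×_A k`, such a `Y` is a scheme. -/
def IsArithmeticallySpecial (Y : LocallyRingedSpace.{u})
    (h : Y ⟶ (Spec (.of k)).toLocallyRingedSpace) : Prop :=
  ∃ A : Subalgebra ℤ k, A.FG ∧
  ∃ (𝒴 : Scheme.{u}) (g : 𝒴 ⟶ Spec (.of A)),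
    LocallyOfFiniteType g ∧ QuasiCompact g ∧ IsSeparated g ∧
    ∃ e : (pullback g (specToSubring k A)).toLocallyRingedSpace ≅ Y,
      e.hom ≫ h = (pullback.snd g (specToSubring k A)).toLRSHom ∧
      Dense {y : Y | ∃ P ∈ nearIntegralPoints A g,
        ∃ r : Spec (.of k) ⟶ pullback g (specToSubring k A),
          r ≫ pullback.fst g (specToSubring k A) = specToFraction k A ≫ P ∧
          r ≫ pullback.snd g (specToSubring k A) = 𝟙 (Spec (.of k)) ∧
          ∃ t : Spec (.of k), y = e.hom.base (r t)}

end Special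

end SymArith

end

noncomputable section

open CategoryTheory CategoryTheory.Limits AlgebraicGeometry TopologicalSpace Opposite

namespace SymArith

universe u

attribute [local instance] MvPolynomial.gradedAlgebra

/-! The projection Sym^m(X × ℙ¹) → Sym^m(X) is proper. So a near-integral point of Sym^m(X) that is
lifted over the fraction field K to Sym^m(X × ℙ¹) gives a near-integral point there, provided the
localizations at primes of height one are valuation rings: the valuative criterion extends the lift
over each of them (`NearIntegral.of_isProper`).

Lifts come from functions. Let h be a function on an affine open U of a model 𝒳 of X. The graph of t
= ∑ n_j h^j, with n_j integers, is a section of 𝒳 × ℙ¹ → 𝒳 over U and induces a morphism Sym^m(U) →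
Sym^m(𝒳 × ℙ¹). As near-integral points are dense downstairs, the closure Z of those upstairs
contains the whole image of this morphism over k (`map_mem_of_nearIntegralSet_subset`). If h takes
distinct values at x_1, …, x_m, the Vandermonde matrix of these values is invertible, so the tuples
(t(x_i)) for n in ℤ^m are Zariski dense in k^m and Z contains the class of (x_i, t_i) for arbitrary
t_i. For nonconstant h these classes are dense (`dense_nearIntegralSet_of_not_isIso`). A nonconstant
h exists unless X is Spec k; in that case tuples of integers give dense integral points of Sym^m(ℙ¹)
over the image of ℤ.

Two preparations are needed. The given model 𝒴 of Sym^m(X) is arbitrary, while the argument takes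
place on N = Sym^m(𝒳). A quasi-projective 𝒳 descends to a finitely generated ring
(`exists_model_of_isQuasiProjective`), symmetric powers commute with the flat base change to k
(`IsSymPower.isSymPower_baseChange`), and the identification over k spreads out to a morphism from 𝒴
to N over a larger ring (`exists_spread_out`). Enlarging the ring must also preserve
near-integrality: primes of height one should lie over primes of height at most one. Normalizing and
then inverting an element that makes the extension smooth, hence flat, achieves this together with
the valuation ring condition (`exists_subalgebra_height_comap_le`).

The symmetric power is a coequalizer in locally ringed spaces. It is handled through
`IsOrbitQuotient`: orbit space with sheaf of invariants, which near an invariant affine open is the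
spectrum of the invariant ring. -/

/-! ### Sections of a colimit of presheafed spaces. -/

/-- Pullback of sections along a morphism of presheafed spaces, restricted to a smaller open. -/
def secMap {X Y : PresheafedSpace.{_, _, u} CommRingCat.{u}} (f : X ⟶ Y) (V : Opens Y)
    (U : Opens X) (h : U ≤ (Opens.map f.base).obj V) :
    Y.presheaf.obj (op V) ⟶ X.presheaf.obj (op U) :=
  f.c.app (op V) ≫ X.presheaf.map (homOfLE h).op

section
variable {X Y Z : PresheafedSpace.{_, _, u} CommRingCat.{u}}

lemma secMap_comp (f : X ⟶ Y) (g : Y ⟶ Z)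
    (W : Opens Z) (V : Opens Y) (U : Opens X) (hV : V ≤ (Opens.map g.base).obj W)
    (hU : U ≤ (Opens.map f.base).obj V) (h : U ≤ (Opens.map (f ≫ g).base).obj W) :
    secMap (f ≫ g) W U h = secMap g W V hV ≫ secMap f V U hU := by
  have := f.c.naturality (homOfLE hV).op
  simp only [secMap, Category.assoc, PresheafedSpace.comp_c_app] at this ⊢
  rw [reassoc_of% this]
  dsimp
  rw [← X.presheaf.map_comp]
  rfl

lemma secMap_congr {f g : X ⟶ Y} (e : f = g) (V : Opens Y)
    (U : Opens X) (h : U ≤ (Opens.map f.base).obj V) :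
    secMap f V U h = secMap g V U (e ▸ h) := by
  subst e; rfl

lemma secMap_id (V : Opens X) (h : V ≤ (Opens.map (𝟙 X : X ⟶ X).base).obj V) :
    secMap (𝟙 X) V V h = 𝟙 _ := by
  simp only [secMap, PresheafedSpace.id_c_app]
  erw [X.presheaf.map_id]
  exact Category.comp_id _

lemma secMap_map (f : X ⟶ Y) (V : Opens Y) (U U' : Opens X)
    (h : U ≤ (Opens.map f.base).obj V) (h' : U' ≤ U) :
    secMap f V U h ≫ X.presheaf.map (homOfLE h').op = secMap f V U' (h'.trans h) := by
  simp only [secMap, Category.assoc]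
  rw [← X.presheaf.map_comp]; rfl

lemma map_map_self {U W : Opens X} (h : U ≤ W) (h' : W ≤ U) (s : X.presheaf.obj (op W)) :
    X.presheaf.map (homOfLE h').op (X.presheaf.map (homOfLE h).op s) = s := by
  rw [← CommRingCat.comp_apply, ← X.presheaf.map_comp]
  exact congr($(X.presheaf.map_id (op W)) s)

lemma secMap_self (f : X ⟶ Y) (V : Opens Y) : secMap f V _ le_rfl = f.c.app (op V) := by
  simp only [secMap]
  erw [X.presheaf.map_id]
  exact Category.comp_id _

lemma secMap_isIso (f : X ⟶ Y) [IsIso f] (V : Opens Y) :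
    IsIso (secMap f V _ le_rfl) := by
  have : IsIso f.c := PresheafedSpace.c_isIso_of_iso f
  have : IsIso (f.c.app (op V)) := inferInstance
  delta secMap
  have : IsIso (X.presheaf.map (homOfLE (le_refl ((Opens.map f.base).obj V))).op) := by
    erw [X.presheaf.map_id]; infer_instance
  infer_instance
end

section
variable {J : Type} [SmallCategory J] (F : J ⥤ PresheafedSpace.{_, _, u} CommRingCat.{u})

/-- The sections of a colimit over an open set form the limit of the sections over its preimages.
This identifies the projections of that limit with pullback along the legs of an arbitrary colimit
cocone. -/
lemma secMap_comp_colimitIso_hom_π {c : Cocone F} (e : colimit F ≅ c.pt)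
    (he : ∀ j, colimit.ι F j ≫ e.hom = c.ι.app j) (V : Opens c.pt) (j : J)
    (hW : (Opens.map (colimit.ι F j).base).obj ((Opens.map e.hom.base).obj V) ≤
      (Opens.map (c.ι.app j).base).obj V) :
    secMap e.hom V _ le_rfl ≫ (PresheafedSpace.colimitPresheafObjIsoComponentwiseLimit F
      ((Opens.map e.hom.base).obj V)).hom ≫ limit.π _ (op j) = secMap (c.ι.app j) V _ hW := by
  rw [PresheafedSpace.colimitPresheafObjIsoComponentwiseLimit_hom_π,
    secMap_congr (he j).symm, secMap_comp _ _ V _ _ le_rfl le_rfl]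
  congr 1
  simp only [secMap]
  erw [(F.obj j).presheaf.map_id]
  exact (Category.comp_id _).symm

lemma colimit_section_ext {c : Cocone F} (hc : IsColimit c)
    (V : Opens c.pt) (s t : c.pt.presheaf.obj (op V))
    (h : ∀ j, secMap (c.ι.app j) V _ le_rfl s = secMap (c.ι.app j) V _ le_rfl t) : s = t := by
  let e : colimit F ≅ c.pt := (colimit.isColimit F).coconePointUniqueUpToIso hc
  have he : ∀ j, colimit.ι F j ≫ e.hom = c.ι.app j := fun j =>
    (colimit.isColimit F).comp_coconePointUniqueUpToIso_hom hc j
  have := secMap_isIso e.hom V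
  apply ((ConcreteCategory.isIso_iff_bijective (secMap e.hom V _ le_rfl ≫
    (PresheafedSpace.colimitPresheafObjIsoComponentwiseLimit F
      ((Opens.map e.hom.base).obj V)).hom)).mp inferInstance).1
  refine Concrete.limit_ext _ _ _ fun ⟨j⟩ => ?_
  have hW : (Opens.map (colimit.ι F j).base).obj ((Opens.map e.hom.base).obj V) ≤
      (Opens.map (c.ι.app j).base).obj V := by rw [← he]; exact le_rfl
  have key := secMap_comp_colimitIso_hom_π F e he V j hW
  rw [← secMap_map _ _ _ _ le_rfl hW] at key
  have key' := fun x => congr($key x)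
  simp only [CommRingCat.comp_apply] at key' ⊢
  erw [key' s, key' t, h j]

lemma colimit_section_exists {c : Cocone F} (hc : IsColimit c)
    (V : Opens c.pt) (s : ∀ j, (F.obj j).presheaf.obj (op ((Opens.map (c.ι.app j).base).obj V)))
    (h : ∀ i j (f : i ⟶ j) h, secMap (F.map f) _ _ h (s j) = s i) :
    ∃ t : c.pt.presheaf.obj (op V), ∀ j, secMap (c.ι.app j) V _ le_rfl t = s j := by
  let e : colimit F ≅ c.pt := (colimit.isColimit F).coconePointUniqueUpToIso hc
  have he : ∀ j, colimit.ι F j ≫ e.hom = c.ι.app j := fun j =>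
    (colimit.isColimit F).comp_coconePointUniqueUpToIso_hom hc j
  have := secMap_isIso e.hom V
  let V' := (Opens.map e.hom.base).obj V
  let W j := (Opens.map (colimit.ι F j).base).obj V'
  have hW j : W j ≤ (Opens.map (c.ι.app j).base).obj V := by rw [← he]; exact le_rfl
  have hW' j : (Opens.map (c.ι.app j).base).obj V ≤ W j := by rw [← he]; exact le_rfl
  let σ : (PresheafedSpace.componentwiseDiagram F V' ⋙ forget CommRingCat).sections :=
    ⟨fun j => (F.obj j.unop).presheaf.map (homOfLE (hW j.unop)).op (s j.unop), by
      rintro ⟨j⟩ ⟨i⟩ f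
      dsimp
      have hle : (Opens.map (c.ι.app i).base).obj V ≤
          (Opens.map (F.map f.unop).base).obj ((Opens.map (c.ι.app j).base).obj V) := by
        rw [← c.w f.unop]; exact le_rfl
      rw [← h i j f.unop hle]
      have key : (F.obj j).presheaf.map (homOfLE (hW j)).op ≫
          (PresheafedSpace.componentwiseDiagram F V').map f =
          secMap (F.map f.unop) _ _ hle ≫ (F.obj i).presheaf.map (homOfLE (hW i)).op := by
        have := (F.map f.unop).c.naturality (homOfLE (hW j)).op
        simp only [secMap, PresheafedSpace.componentwiseDiagram_map, Category.assoc] at this ⊢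
        refine (reassoc_of% this) _ |>.trans ?_
        congr 1
        refine ((F.obj i).presheaf.map_comp _ _).symm.trans ?_
        rw [← (F.obj i).presheaf.map_comp]
        rfl
      exact congr($key (s j))⟩
  let x := (Types.isLimitEquivSections (isLimitOfPreserves (forget CommRingCat)
    (limit.isLimit (PresheafedSpace.componentwiseDiagram F V')))).symm σ
  have hx j : limit.π (PresheafedSpace.componentwiseDiagram F V') j x = σ.1 j :=
    Types.isLimitEquivSections_symm_apply (isLimitOfPreserves (forget CommRingCat)
      (limit.isLimit (PresheafedSpace.componentwiseDiagram F V'))) σ j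
  obtain ⟨t, ht⟩ := ((ConcreteCategory.isIso_iff_bijective (secMap e.hom V _ le_rfl ≫
    (PresheafedSpace.colimitPresheafObjIsoComponentwiseLimit F
      ((Opens.map e.hom.base).obj V)).hom)).mp inferInstance).2 x
  refine ⟨t, fun j => ?_⟩
  have key := congr($(secMap_comp_colimitIso_hom_π F e he V j (hW j)) t)
  rw [← Category.assoc, CommRingCat.comp_apply] at key
  erw [ht, hx (op j), ← secMap_map _ _ _ _ le_rfl (hW j)] at key
  have := congr((F.obj j).presheaf.map (homOfLE (hW' j)).op $key)
  simp only [CommRingCat.comp_apply, σ] at this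
  erw [map_map_self, map_map_self] at this
  exact this.symm

lemma secMap_cocone_w (c : Cocone F) {i j : J} (f : i ⟶ j) (V : Opens c.pt) (h) :
    secMap (c.ι.app i) V _ le_rfl =
      secMap (c.ι.app j) V ((Opens.map (c.ι.app j).base).obj V) le_rfl ≫
        secMap (F.map f) _ ((Opens.map (c.ι.app i).base).obj V) h := by
  rw [← secMap_comp _ _ _ _ _ _ _ (by rw [c.w f])]
  exact secMap_congr (c.w f).symm _ _ _

lemma secMap_cocone_le (c : Cocone F) {i j : J} (f : i ⟶ j) (V : Opens c.pt) :
    (Opens.map (c.ι.app i).base).obj V ≤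
      (Opens.map (F.map f).base).obj ((Opens.map (c.ι.app j).base).obj V) := by
  rw [← c.w f]; exact le_rfl

/-- Every leg factors through the one at `j₀`, so that one suffices. For a coequalizer diagram `j₀`
is the target object. -/
lemma colimit_section_ext_of_hom {c : Cocone F} (hc : IsColimit c) (j₀ : J)
    (hj₀ : ∀ i, Nonempty (i ⟶ j₀)) (V : Opens c.pt) (s t : c.pt.presheaf.obj (op V))
    (h : secMap (c.ι.app j₀) V _ le_rfl s = secMap (c.ι.app j₀) V _ le_rfl t) : s = t := by
  refine colimit_section_ext F hc V s t fun i => ?_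
  obtain ⟨f⟩ := hj₀ i
  rw [secMap_cocone_w F c f V (secMap_cocone_le F c f V), CommRingCat.comp_apply, h]
  rfl

/-- Since all arrows into `j₀` pull `s` back to the same section, an arbitrary choice of arrows
extends it to a compatible family. -/
lemma colimit_section_exists_of_hom {c : Cocone F} (hc : IsColimit c) (j₀ : J)
    (hj₀ : ∀ i, Nonempty (i ⟶ j₀)) (V : Opens c.pt)
    (s : (F.obj j₀).presheaf.obj (op ((Opens.map (c.ι.app j₀).base).obj V)))
    (h : ∀ i (f g : i ⟶ j₀), secMap (F.map f) _ _ (secMap_cocone_le F c f V) s =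
      secMap (F.map g) _ _ (secMap_cocone_le F c g V) s) :
    ∃ t : c.pt.presheaf.obj (op V), secMap (c.ι.app j₀) V _ le_rfl t = s := by
  have f i := (hj₀ i).some
  obtain ⟨t, ht⟩ := colimit_section_exists F hc V
    (fun i => secMap (F.map (f i)) _ _ (secMap_cocone_le F c (f i) V) s) (fun i j g hg => by
      rw [← CommRingCat.comp_apply, ← secMap_comp (F.map g) (F.map (f j)) _ _ _ _ _
        (by rw [← F.map_comp]; exact secMap_cocone_le F c _ V),
        secMap_congr (F.map_comp g (f j)).symm]
      exact h i _ _)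
  refine ⟨t, (ht j₀).trans ?_⟩
  rw [h j₀ (f j₀) (𝟙 _), secMap_congr (F.map_id j₀), secMap_id]
  rfl
end

/-! ### Orbit quotients of locally ringed spaces. -/

/-- The index category lives in `Type`, the spaces in universe `u`; preservation is moved across the
equivalence with the lifted index category. -/
lemma preservesColimit_lrs {J : Type} [SmallCategory J] :
    PreservesColimitsOfShape J (LocallyRingedSpace.forgetToSheafedSpace.{u} ⋙
      SheafedSpace.forgetToPresheafedSpace) := by
  have : PreservesColimitsOfShape J (LocallyRingedSpace.forgetToSheafedSpace.{u}) :=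
    preservesColimitsOfShape_of_equiv (ULiftHomULiftCategory.equiv.{u, u} J).symm _
  infer_instance

lemma preservesColimit_top {J : Type} [SmallCategory J] :
    PreservesColimitsOfShape J LocallyRingedSpace.forgetToTop.{u} := by
  have : PreservesColimitsOfShape J (LocallyRingedSpace.forgetToSheafedSpace.{u}) :=
    preservesColimitsOfShape_of_equiv (ULiftHomULiftCategory.equiv.{u, u} J).symm _
  have : PreservesColimitsOfShape J (SheafedSpace.forget CommRingCat.{u}) :=
    inferInstance
  delta LocallyRingedSpace.forgetToTop
  infer_instance

/-- `π` is the quotient of `M` by the operators `ρ`, in the strong sense: topologically the orbit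
space, with structure sheaf the invariant sections. -/
structure IsOrbitQuotient {G : Type} {M N : LocallyRingedSpace.{u}} (ρ : G → (M ⟶ M))
    (π : M ⟶ N) : Prop where
  condition (g : G) : ρ g ≫ π = π
  isQuotientMap : Topology.IsQuotientMap π.base
  orbit (x y : M) : π.base x = π.base y → ∃ g, (ρ g).base x = y
  injective (V : Opens N) : Function.Injective (secMap π.toHom V _ le_rfl)
  surjective (V : Opens N) (s : M.presheaf.obj (op ((Opens.map π.base).obj V))) :
    (∀ g h, secMap (ρ g).toHom _ ((Opens.map π.base).obj V) h s = s) →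
      ∃ t, secMap π.toHom V _ le_rfl t = s

/-- The forgetful functors to topological spaces and to presheafed spaces preserve the coequalizer,
so points, topology and sections are computed separately. Because the operators form a group, the
relation they generate is the orbit relation itself. -/
lemma isOrbitQuotient_wideCoequalizer {G : Type} [Group G] {M : LocallyRingedSpace.{u}}
    (ρ : G → (M ⟶ M)) (h1 : ρ 1 = 𝟙 M) (hmul : ∀ g h, ρ (g * h) = ρ g ≫ ρ h) :
    IsOrbitQuotient ρ (wideCoequalizer.π ρ) := by
  have hc : ∀ g, ρ g ≫ wideCoequalizer.π ρ = wideCoequalizer.π ρ := fun g => by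
    rw [wideCoequalizer.condition ρ g 1, h1, Category.id_comp]
  let c := Cotrident.ofπ (wideCoequalizer.π ρ) (wideCoequalizer.condition ρ)
  have hcol : IsColimit c := wideCoequalizerIsWideCoequalizer ρ
  have hzero : c.ι.app .zero = wideCoequalizer.π ρ := by
    have := c.w (WalkingParallelFamily.Hom.line (1 : G))
    rw [← this]
    change ρ 1 ≫ _ = _
    exact hc 1
  have hone : c.ι.app .one = wideCoequalizer.π ρ := rfl
  have := preservesColimit_lrs.{u} (J := WalkingParallelFamily G)
  have := preservesColimit_top.{u} (J := WalkingParallelFamily G)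
  have htop := isColimitOfPreserves LocallyRingedSpace.forgetToTop.{u} hcol
  have hpre := isColimitOfPreserves (LocallyRingedSpace.forgetToSheafedSpace.{u} ⋙
      SheafedSpace.forgetToPresheafedSpace) hcol
  have hmem : ∀ i : WalkingParallelFamily G, Nonempty (i ⟶ WalkingParallelFamily.one)
    | .zero => ⟨WalkingParallelFamily.Hom.line 1⟩
    | .one => ⟨𝟙 _⟩
  have hforget := isColimitOfPreserves (forget TopCat.{u}) htop
  refine ⟨hc, ⟨⟨TopologicalSpace.ext_iff.mpr fun X => ?_⟩, ?_⟩, ?_, ?_, ?_⟩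
  · refine (TopCat.isOpen_iff_of_isColimit _ htop X).trans ?_
    refine ⟨fun h => h .one, fun h j => ?_⟩
    rcases j with _ | _
    · have : (LocallyRingedSpace.forgetToTop.map (c.ι.app .zero)) = (wideCoequalizer.π ρ).base :=
        congr($(hzero).base)
      change IsOpen ((LocallyRingedSpace.forgetToTop.map (c.ι.app .zero)) ⁻¹' X)
      rw [this]; exact h
    · exact h
  · intro y
    obtain ⟨j, x, rfl⟩ := Concrete.isColimit_exists_rep _ htop y
    rcases j with _ | _
    · refine ⟨(ρ 1).base x, ?_⟩
      change ((ρ 1).base ≫ (wideCoequalizer.π ρ).base) x = _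
      rw [← LocallyRingedSpace.comp_base, hc 1]
      exact congr($(hzero.symm).base x)
    · exact ⟨x, rfl⟩
  · intro x y hxy
    let r : Setoid M := ⟨fun x y => ∃ g, (ρ g).base x = y, fun x => ⟨1, by rw [h1]; rfl⟩,
      fun {x y} ⟨g, hg⟩ => ⟨g⁻¹, by
        rw [← hg, ← TopCat.comp_app, ← LocallyRingedSpace.comp_base, ← hmul]; simp [h1]⟩,
      fun {x y z} ⟨g, hg⟩ ⟨g', hg'⟩ => ⟨g * g', by rw [hmul, ← hg', ← hg]; rfl⟩⟩
    -- The map to the set of orbits is a cocone, hence factors through the coequalizer: points with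
    -- the same image lie in one orbit.
    let t : Cocone ((parallelFamily ρ ⋙ LocallyRingedSpace.forgetToTop) ⋙ forget TopCat.{u}) :=
      { pt := Quotient r
        ι := { app := fun j => match j with
                | .zero => ↾(fun x => Quotient.mk r x)
                | .one => ↾(fun x => Quotient.mk r x)
               naturality := by
                rintro _ _ (⟨i⟩ | g)
                · erw [CategoryTheory.Functor.map_id, CategoryTheory.Functor.map_id]
                  rfl
                · ext x
                  exact Quotient.sound (s := r) (r.symm ⟨g, rfl⟩) } }
    have := hforget.fac t .one
    have h3 z : hforget.desc t ((wideCoequalizer.π ρ).base z) = Quotient.mk r z := congr($this z)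
    have h4 := h3 x
    rw [hxy, h3 y] at h4
    exact Quotient.exact h4.symm
  · intro V s t hst
    exact colimit_section_ext_of_hom _ hpre .one hmem V s t hst
  · intro V s hs
    obtain ⟨t, ht⟩ := colimit_section_exists_of_hom _ hpre .one hmem V s (by
        let W : Opens M := (Opens.map (c.ι.app .zero).base).obj V
        have hle : W ≤ (Opens.map (wideCoequalizer.π ρ).base).obj V := by
          rw [← hzero]; exact le_rfl
        have hle' g : (Opens.map (wideCoequalizer.π ρ).base).obj V ≤
          (Opens.map (ρ g).base).obj ((Opens.map (wideCoequalizer.π ρ).base).obj V) := by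
          conv_lhs => rw [← hc g]
          exact le_rfl
        have key g : secMap (ρ g).toHom _ W (hle.trans (hle' g)) s =
            M.presheaf.map (homOfLE hle).op s := by
          rw [← secMap_map _ _ _ _ (hle' g), CommRingCat.comp_apply, hs]
        rintro (_ | _) g g'
        · match g, g' with
          | .line g, .line g' => exact (key g).trans (key g').symm
        · match g, g' with
          | .id _, .id _ => rfl)
    exact ⟨t, ht⟩

/-! ### Equivariant open immersions and their quotients. -/

section OpenImmersion
variable {G : Type} {M₁ M₂ N₁ N₂ : LocallyRingedSpace.{u}} {ρ₁ : G → (M₁ ⟶ M₁)}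
  {ρ₂ : G → (M₂ ⟶ M₂)} {π₁ : M₁ ⟶ N₁} {π₂ : M₂ ⟶ N₂}

/-- Equivariance makes the image of `j` stable under the operators, so the preimage in `M₂` of
`d(O)` is `j(π₁⁻¹ O)`. This gives injectivity and openness, and over such open sets invariant
sections on `M₁` and `M₂` correspond through `j`. -/
lemma IsOrbitQuotient.isOpenImmersion (h₁ : IsOrbitQuotient ρ₁ π₁) (h₂ : IsOrbitQuotient ρ₂ π₂)
    (j : M₁ ⟶ M₂) [LocallyRingedSpace.IsOpenImmersion j] (hj : ∀ g, ρ₁ g ≫ j = j ≫ ρ₂ g)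
    (d : N₁ ⟶ N₂) (hd : π₁ ≫ d = j ≫ π₂) : LocallyRingedSpace.IsOpenImmersion d := by
  have hjo : Topology.IsOpenEmbedding j.base := PresheafedSpace.IsOpenImmersion.base_open
  have hd' x : d.base (π₁.base x) = π₂.base (j.base x) := congr(($hd).base x)
  have hj' g x : j.base ((ρ₁ g).base x) = (ρ₂ g).base (j.base x) := congr(($(hj g)).base x)
  have hinj : Function.Injective d.base := by
    intro a b hab
    obtain ⟨x, rfl⟩ := h₁.isQuotientMap.surjective a
    obtain ⟨y, rfl⟩ := h₁.isQuotientMap.surjective b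
    rw [hd', hd'] at hab
    obtain ⟨g, hg⟩ := h₂.orbit _ _ hab
    rw [← hj'] at hg
    rw [← hjo.injective hg, ← TopCat.comp_app, ← LocallyRingedSpace.comp_base, h₁.condition]
  have himg (O : Set N₁) : π₂.base ⁻¹' (d.base '' O) = j.base '' (π₁.base ⁻¹' O) := by
    ext z
    constructor
    · rintro ⟨a, ha, haz⟩
      obtain ⟨x, rfl⟩ := h₁.isQuotientMap.surjective a
      rw [hd'] at haz
      obtain ⟨g, hg⟩ := h₂.orbit _ _ haz
      refine ⟨(ρ₁ g).base x, ?_, (hj' g x).trans hg⟩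
      change π₁.base ((ρ₁ g).base x) ∈ O
      rwa [← TopCat.comp_app, ← LocallyRingedSpace.comp_base, h₁.condition]
    · rintro ⟨x, hx, rfl⟩
      exact ⟨_, hx, hd' x⟩
  have hopen : IsOpenMap d.base := fun O hO => by
    rw [← h₂.isQuotientMap.isOpen_preimage, himg]
    exact hjo.isOpenMap _ (hO.preimage π₁.base.hom.continuous)
  have hemb : Topology.IsOpenEmbedding d.base :=
    .of_continuous_injective_isOpenMap d.base.hom.continuous hinj hopen
  refine ⟨hemb, fun O => ?_⟩
  let V : Opens N₂ := hemb.isOpenMap.functor.obj O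
  have hV : (Opens.map j.base).obj ((Opens.map π₂.base).obj V) =
      (Opens.map π₁.base).obj ((Opens.map d.base).obj V) := by
    ext x
    change π₂.base (j.base x) ∈ V ↔ d.base (π₁.base x) ∈ V
    rw [hd']
  have hj2 : IsIso (secMap j.toHom ((Opens.map π₂.base).obj V) _ le_rfl) := by
    rw [secMap_self]
    refine PresheafedSpace.IsOpenImmersion.isIso_of_subset j.toHom _ ?_
    change π₂.base ⁻¹' (d.base '' O) ⊆ _
    rw [himg]
    exact Set.image_subset_range _ _
  have key : secMap π₂.toHom V _ le_rfl ≫ secMap j.toHom ((Opens.map π₂.base).obj V) _ le_rfl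
      = secMap d.toHom V _ le_rfl ≫ secMap π₁.toHom ((Opens.map d.base).obj V)
        ((Opens.map j.base).obj ((Opens.map π₂.base).obj V)) hV.le := by
    refine (secMap_comp j.toHom π₂.toHom V _ _ le_rfl le_rfl le_rfl).symm.trans
      (Eq.trans ?_ (secMap_comp π₁.toHom d.toHom V _ _ le_rfl hV.le hV.le))
    exact secMap_congr congr(($hd.symm).toHom) _ _ _
  suffices IsIso (secMap d.toHom V _ le_rfl) by
    rwa [secMap_self] at this
  rw [ConcreteCategory.isIso_iff_bijective] at hj2 ⊢
  constructor
  · intro s t hst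
    apply h₂.injective
    apply hj2.1
    rw [← CommRingCat.comp_apply, ← CommRingCat.comp_apply, key, CommRingCat.comp_apply, hst]
    rfl
  · intro t
    obtain ⟨s, hs⟩ := hj2.2 (secMap π₁.toHom ((Opens.map d.base).obj V)
        ((Opens.map j.base).obj ((Opens.map π₂.base).obj V)) hV.le t)
    obtain ⟨r, rfl⟩ := h₂.surjective V s (fun g h => by
      apply hj2.1
      have hle : (Opens.map j.base).obj ((Opens.map π₂.base).obj V) ≤ (Opens.map (ρ₁ g).base).obj
          ((Opens.map j.base).obj ((Opens.map π₂.base).obj V)) := by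
        intro x hx
        change π₂.base (j.base ((ρ₁ g).base x)) ∈ V
        rw [hj', ← TopCat.comp_app, ← LocallyRingedSpace.comp_base, h₂.condition]
        exact hx
      have h1 : secMap (ρ₂ g).toHom _ _ h ≫ secMap j.toHom ((Opens.map π₂.base).obj V) _ le_rfl =
          secMap j.toHom ((Opens.map π₂.base).obj V) _ le_rfl ≫ secMap (ρ₁ g).toHom _ _ hle := by
        have e := congr(($(hj g)).toHom)
        rw [LocallyRingedSpace.comp_toHom, LocallyRingedSpace.comp_toHom] at e
        rw [← secMap_comp j.toHom (ρ₂ g).toHom _ _ _ _ _ (fun x hx => h hx),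
          ← secMap_comp (ρ₁ g).toHom j.toHom _ _ _ _ _ hle]
        exact secMap_congr e.symm _ _ _
      have hle2 : (Opens.map j.base).obj ((Opens.map π₂.base).obj V) ≤
          (Opens.map (ρ₁ g ≫ π₁).base).obj ((Opens.map d.base).obj V) := by
        rw [h₁.condition]; exact hV.le
      have h2 : secMap π₁.toHom ((Opens.map d.base).obj V)
          ((Opens.map j.base).obj ((Opens.map π₂.base).obj V)) hV.le ≫ secMap (ρ₁ g).toHom _ _ hle =
          secMap π₁.toHom ((Opens.map d.base).obj V) _ hV.le := by
        rw [← secMap_comp (ρ₁ g).toHom π₁.toHom _ _ _ _ _ hle2]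
        exact secMap_congr congr(($(h₁.condition g)).toHom) _ _ _
      have h1' := congr($h1 s)
      have h2' := congr($h2 t)
      rw [CommRingCat.comp_apply, CommRingCat.comp_apply] at h1'
      rw [CommRingCat.comp_apply] at h2'
      rw [h1', hs, h2'])
    refine ⟨r, h₁.injective _ ?_⟩
    rw [← CommRingCat.comp_apply, key] at hs
    have := congr(M₁.presheaf.map (homOfLE hV.ge).op $hs)
    have e := secMap_map π₁.toHom ((Opens.map d.base).obj V) _ _ hV.le hV.ge
    rw [CommRingCat.comp_apply, ← CommRingCat.comp_apply, ← CommRingCat.comp_apply, e] at this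
    exact this.trans congr($e t)

lemma IsOrbitQuotient.isIso (h₁ : IsOrbitQuotient ρ₁ π₁) (h₂ : IsOrbitQuotient ρ₂ π₂)
    (j : M₁ ⟶ M₂) [IsIso j] (hj : ∀ g, ρ₁ g ≫ j = j ≫ ρ₂ g)
    (d : N₁ ⟶ N₂) (hd : π₁ ≫ d = j ≫ π₂) : IsIso d := by
  have := h₁.isOpenImmersion h₂ j hj d hd
  have : Epi d.base := by
    rw [TopCat.epi_iff_surjective]
    intro y
    obtain ⟨z, rfl⟩ := h₂.isQuotientMap.surjective y
    refine ⟨π₁.base ((inv j).base z), ?_⟩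
    rw [← TopCat.comp_app, ← TopCat.comp_app, ← LocallyRingedSpace.comp_base,
      ← LocallyRingedSpace.comp_base, hd]
    simp
  exact LocallyRingedSpace.IsOpenImmersion.to_iso d
end OpenImmersion

/-! ### Quotients of schemes by finite groups through rings of invariants. -/

section Charts
variable {G : Type} {M N : Scheme.{u}} (ρ : G → (M ⟶ M)) (π : M ⟶ N)

/-- An affine open of `N` over which `N` is the spectrum of the ring of invariants. -/
structure IsInvariantChart (V : N.Opens) : Prop where
  isAffineOpen : IsAffineOpen V
  injective : Function.Injective (π.app V)
  surjective (s : Γ(M, π ⁻¹ᵁ V)) :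
    (∀ g h, (ρ g).appLE (π ⁻¹ᵁ V) (π ⁻¹ᵁ V) h s = s) → ∃ t, π.app V t = s

variable {ρ π} (hπ : ∀ g, ρ g ≫ π = π)
include hπ

lemma preimage_le_of_condition (V : N.Opens) (g : G) :
    π ⁻¹ᵁ V ≤ ρ g ⁻¹ᵁ (π ⁻¹ᵁ V) := by
  rw [← Scheme.Hom.comp_preimage, hπ]

lemma appLE_app_of_condition (V : N.Opens) (g : G) (h) :
    π.app V ≫ (ρ g).appLE (π ⁻¹ᵁ V) (π ⁻¹ᵁ V) h = π.app V := by
  rw [Scheme.Hom.app_eq_appLE, Scheme.Hom.appLE_comp_appLE]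
  simp only [hπ]

/-- Invariants commute with localization at an invariant element. If c/bⁿ is invariant then each gc
− c is killed by a power of b; a common power makes the numerator invariant. -/
lemma IsInvariantChart.basicOpen [Finite G] [IsAffineHom π] {V : N.Opens}
    (hV : IsInvariantChart ρ π V) (a : Γ(N, V)) : IsInvariantChart ρ π (N.basicOpen a) := by
  have hVa := hV.isAffineOpen
  have hle : N.basicOpen a ≤ V := N.basicOpen_le a
  have hW := hVa.preimage π
  have hle' : π ⁻¹ᵁ N.basicOpen a ≤ π ⁻¹ᵁ V := fun x hx => hle hx
  let A' := Γ(N, N.basicOpen a)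
  let B' := Γ(M, π ⁻¹ᵁ N.basicOpen a)
  let resA : Γ(N, V) ⟶ A' := N.presheaf.map (homOfLE hle).op
  let resB : Γ(M, π ⁻¹ᵁ V) ⟶ B' := M.presheaf.map (homOfLE hle').op
  let b := π.app V a
  algebraize [resA.hom, resB.hom]
  have hlocA : IsLocalization.Away a A' := hVa.isLocalization_of_eq_basicOpen a (homOfLE hle) rfl
  have hlocB : IsLocalization.Away b B' :=
    hW.isLocalization_of_eq_basicOpen b (homOfLE hle') (Scheme.preimage_basicOpen π a)
  have hnat : resA ≫ π.app (N.basicOpen a) = π.app V ≫ resB := (π.naturality _)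
  have hnat' (x : Γ(N, V)) : π.app (N.basicOpen a) (resA x) = resB (π.app V x) := congr($hnat x)
  have hρ g (h h') : (ρ g).appLE (π ⁻¹ᵁ V) (π ⁻¹ᵁ V) h ≫ resB =
      resB ≫ (ρ g).appLE (π ⁻¹ᵁ N.basicOpen a) (π ⁻¹ᵁ N.basicOpen a) h' := by
    rw [Scheme.Hom.appLE_map, Scheme.Hom.map_appLE]
  have hunit : IsUnit (resA a) := IsLocalization.Away.algebraMap_isUnit (S := A') a
  refine ⟨hVa.basicOpen a, ?_, ?_⟩
  · rw [injective_iff_map_eq_zero]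
    intro x hx
    obtain ⟨n, c, hc⟩ := IsLocalization.Away.surj a x
    change x * resA a ^ n = resA c at hc
    have h0 : resB (π.app V c) = 0 := by
      rw [← hnat', ← hc, map_mul, hx, zero_mul]
    obtain ⟨⟨_, m, rfl⟩, hm⟩ := (IsLocalization.map_eq_zero_iff (.powers b) B' (π.app V c)).mp h0
    have : π.app V (a ^ m * c) = 0 := by rw [map_mul, map_pow]; exact hm
    have h1 := hV.injective (this.trans (map_zero (π.app V).hom).symm)
    have h2 : resA a ^ m * resA c = 0 := by rw [← map_pow, ← map_mul, h1, map_zero]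
    rw [← hc] at h2
    have h3 : x * resA a ^ (n + m) = 0 := by rw [← h2]; ring
    exact ((hunit.pow (n+m)).mul_left_eq_zero).mp h3
  · intro s hs
    obtain ⟨n, c, hc⟩ := IsLocalization.Away.surj b s
    change s * resB b ^ n = resB c at hc
    have hgb g h : (ρ g).appLE (π ⁻¹ᵁ V) (π ⁻¹ᵁ V) h b = b := 
      congr($(appLE_app_of_condition hπ V g h) a)
    have h1 : ∀ g, ∃ m, ∀ h, b ^ m * (ρ g).appLE (π ⁻¹ᵁ V) (π ⁻¹ᵁ V) h c = b ^ m * c := by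
      intro g
      have hh := preimage_le_of_condition hπ V g
      have hh' := preimage_le_of_condition hπ (N.basicOpen a) g
      have : resB ((ρ g).appLE (π ⁻¹ᵁ V) (π ⁻¹ᵁ V) hh c) = resB c := by
        have e x := congr($(hρ g hh hh') x)
        simp only [CommRingCat.comp_apply] at e
        rw [e, ← hc, map_mul, hs, map_pow, ← e, hgb]
      obtain ⟨⟨_, m, rfl⟩, hm⟩ := IsLocalization.exists_of_eq (M := .powers b) (S := B') this
      exact ⟨m, fun _ => hm⟩
    choose m hm using h1
    -- Finiteness of the group provides one exponent for all its elements.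
    obtain ⟨L, hL⟩ : ∃ L, ∀ g, m g ≤ L := by
      obtain ⟨L, hL⟩ := (Set.finite_range m).bddAbove
      exact ⟨L, fun g => hL ⟨g, rfl⟩⟩
    obtain ⟨t, ht⟩ := hV.surjective (b ^ L * c) (fun g h => by
      rw [map_mul, map_pow, hgb]
      obtain ⟨d, hd⟩ := Nat.exists_eq_add_of_le (hL g)
      rw [hd, pow_add, mul_comm (b ^ m g), mul_assoc, hm, mul_assoc])
    obtain ⟨v, hv⟩ := hunit
    refine ⟨resA t * ((v⁻¹ ^ (L + n) : A'ˣ) : A'), ?_⟩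
    have hu : IsUnit (resB b ^ (L + n)) := 
      (IsLocalization.Away.algebraMap_isUnit (S := B') b).pow _
    apply hu.mul_right_cancel
    have : resB b ^ (L + n) = π.app (N.basicOpen a) ((v ^ (L + n) : A'ˣ) : A') := by
      rw [← hnat', ← map_pow, ← hv]; rfl
    rw [map_mul, mul_assoc]
    nth_rw 1 [this]
    rw [← map_mul, ← Units.val_mul, ← mul_pow, inv_mul_cancel, one_pow, Units.val_one, map_one,
      mul_one, hnat', ht, map_mul, ← hc, map_pow]
    ring

lemma IsInvariantChart.exists_basis [Finite G] [IsAffineHom π]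
    (hcov : ∀ y : N, ∃ V : N.Opens, y ∈ V ∧ IsInvariantChart ρ π V) (V : N.Opens) (y : N)
    (hy : y ∈ V) : ∃ W : N.Opens, y ∈ W ∧ W ≤ V ∧ IsInvariantChart ρ π W := by
  obtain ⟨U, hyU, hU⟩ := hcov y
  obtain ⟨f, hf, hyf⟩ := hU.isAffineOpen.exists_basicOpen_le ⟨y, hy⟩ hyU
  exact ⟨_, hyf, hf, hU.basicOpen hπ f⟩

end Charts

/-- The action of `G` on the sections over the preimage of `V`. -/
@[reducible]
def sectionAction {G : Type} [Group G] {M N : Scheme.{u}} {ρ : G → (M ⟶ M)} {π : M ⟶ N}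
    (h1 : ρ 1 = 𝟙 M) (hmul : ∀ g h, ρ (g * h) = ρ g ≫ ρ h)
    (hπ : ∀ g, ρ g ≫ π = π) (V : N.Opens) : MulSemiringAction G Γ(M, π ⁻¹ᵁ V) where
  smul g s := (ρ g).appLE _ _ (preimage_le_of_condition hπ V g) s
  one_smul s := by
    change (ρ 1).appLE _ _ (preimage_le_of_condition hπ V 1) s = s
    have := Scheme.Hom.app_eq_appLE (f := 𝟙 M) (U := π ⁻¹ᵁ V)
    simp only [h1]
    erw [← this]
    simp
  mul_smul g h s := by
    change (ρ (g * h)).appLE _ _ (preimage_le_of_condition hπ V _) s =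
      (ρ g).appLE _ _ (preimage_le_of_condition hπ V g)
        ((ρ h).appLE _ _ (preimage_le_of_condition hπ V h) s)
    rw [← CommRingCat.comp_apply, Scheme.Hom.appLE_comp_appLE]
    simp [hmul]
  smul_zero _ := map_zero _
  smul_add _ := map_add _
  smul_one _ := map_one _
  smul_mul _ := map_mul _

section
variable {G : Type} [Group G] [Finite G] {M N : Scheme.{u}} {ρ : G → (M ⟶ M)} {π : M ⟶ N}
  (h1 : ρ 1 = 𝟙 M) (hmul : ∀ g h, ρ (g * h) = ρ g ≫ ρ h) (hπ : ∀ g, ρ g ≫ π = π)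
include h1 hmul hπ

lemma IsInvariantChart.isIntegral {V : N.Opens} (hV : IsInvariantChart ρ π V) :
    (π.app V).hom.IsIntegral := by
  let _ := sectionAction h1 hmul hπ V
  algebraize [(π.app V).hom]
  have : Algebra.IsInvariant Γ(N, V) Γ(M, π ⁻¹ᵁ V) G :=
    ⟨fun s hs => hV.surjective s (fun g _ => hs g)⟩
  exact algebraMap_isIntegral_iff.mpr (Algebra.IsInvariant.isIntegral _ _ G)

lemma IsInvariantChart.isIntegralHom [IsAffineHom π]
    (hcov : ∀ y : N, ∃ V : N.Opens, y ∈ V ∧ IsInvariantChart ρ π V) : IsIntegralHom π := by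
  choose V hyV hV using hcov
  have hp := IsIntegralHom.hasAffineProperty
  refine (@HasAffineProperty.iff_of_iSup_eq_top _ _ hp _ _ π _
    (fun y => (⟨V y, (hV y).isAffineOpen⟩ : N.affineOpens))
    (top_le_iff.mp fun y _ => Opens.mem_iSup.mpr ⟨y, hyV y⟩)).mpr fun y => ?_
  refine ⟨(hV y).isAffineOpen.preimage π, ?_⟩
  have h0 := (hV y).isIntegral h1 hmul hπ
  have h2 : ∀ U : N.Opens, U = V y → (π.app U).hom.IsIntegral := by
    rintro _ rfl; exact h0
  change ((π ∣_ V y).app ⊤).hom.IsIntegral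
  rw [morphismRestrict_app]
  refine RingHom.IsIntegral.trans (π.app _).hom (M.presheaf.map _).hom (h2 _ (by simp)) ?_
  exact RingHom.isIntegral_of_surjective _ (ConcreteCategory.bijective_of_isIso
    (M.presheaf.map (eqToHom (image_morphismRestrict_preimage π (V y) ⊤)).op)).2

/-- Lying over for the integral extension of the invariants. -/
lemma IsInvariantChart.surjective_of_cover [IsAffineHom π]
    (hcov : ∀ y : N, ∃ V : N.Opens, y ∈ V ∧ IsInvariantChart ρ π V) : Function.Surjective π := by
  intro y
  obtain ⟨V, hyV, hV⟩ := hcov y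
  have hW := hV.isAffineOpen.preimage π
  have hint := hV.isIntegral h1 hmul hπ
  obtain ⟨q, hq⟩ := hint.comap_surjective hV.injective (hV.isAffineOpen.primeIdealOf ⟨y, hyV⟩)
  refine ⟨hW.fromSpec q, ?_⟩
  have e := hV.isAffineOpen.SpecMap_appLE_fromSpec π hW le_rfl
  have e' : hV.isAffineOpen.fromSpec ((Spec.map (π.appLE V (π ⁻¹ᵁ V) le_rfl)) q) =
    π (hW.fromSpec q) := congr($e q)
  refine e'.symm.trans ?_
  have : (Spec.map (π.appLE V (π ⁻¹ᵁ V) le_rfl)) q = hV.isAffineOpen.primeIdealOf ⟨y, hyV⟩ := by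
    rw [← hq, ← Scheme.Hom.app_eq_appLE]; rfl
  rw [this, IsAffineOpen.fromSpec_primeIdealOf]

/-- A finite group acts transitively on the primes over a given prime of its ring of invariants. -/
lemma IsInvariantChart.orbit [IsAffineHom π] {V : N.Opens} (hV : IsInvariantChart ρ π V)
    (x y : M) (hx : π x ∈ V) (hxy : π x = π y) : ∃ g, ρ g x = y := by
  let _ := sectionAction h1 hmul hπ V
  algebraize [(π.app V).hom]
  have : Algebra.IsInvariant Γ(N, V) Γ(M, π ⁻¹ᵁ V) G :=
    ⟨fun s hs => hV.surjective s (fun g _ => hs g)⟩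
  have : SMulCommClass G Γ(N, V) Γ(M, π ⁻¹ᵁ V) := ⟨fun g a s => by
    rw [Algebra.smul_def, Algebra.smul_def, smul_mul']
    congr 1
    exact congr($(appLE_app_of_condition hπ V g (preimage_le_of_condition hπ V g)) a)⟩
  have hW := hV.isAffineOpen.preimage π
  have hy : π y ∈ V := hxy ▸ hx
  let x' : (π ⁻¹ᵁ V : M.Opens) := ⟨x, hx⟩
  let y' : (π ⁻¹ᵁ V : M.Opens) := ⟨y, hy⟩
  have e := hV.isAffineOpen.SpecMap_appLE_fromSpec π hW le_rfl
  have he (q) : hV.isAffineOpen.fromSpec ((Spec.map (π.app V)) q) = π (hW.fromSpec q) := by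
    rw [Scheme.Hom.app_eq_appLE]
    exact congr($e q)
  have hx1 : hW.fromSpec (hW.primeIdealOf x') = x := hW.fromSpec_primeIdealOf x'
  have hy1 : hW.fromSpec (hW.primeIdealOf y') = y := hW.fromSpec_primeIdealOf y'
  have hu : (Spec.map (π.app V)) (hW.primeIdealOf x') = (Spec.map (π.app V)) (hW.primeIdealOf y') := by
    apply hV.isAffineOpen.fromSpec.isOpenEmbedding.injective
    exact (he _).trans (congr(π $hx1).trans (hxy.trans (congr(π $hy1).symm.trans (he _).symm)))
  obtain ⟨g, hg⟩ := Algebra.IsInvariant.exists_smul_of_under_eq Γ(N, V) Γ(M, π ⁻¹ᵁ V) G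
    (hW.primeIdealOf y').asIdeal (hW.primeIdealOf x').asIdeal congr(($hu.symm).asIdeal)
  refine ⟨g, ?_⟩
  have hle := preimage_le_of_condition hπ V g
  have e2 := hW.SpecMap_appLE_fromSpec (ρ g) hW hle
  have he2 (q : Spec Γ(M, π ⁻¹ᵁ V)) :
    hW.fromSpec ((Spec.map ((ρ g).appLE _ _ hle)) q) = ρ g (hW.fromSpec q) := congr($e2 q)
  refine (congr(ρ g $hx1)).symm.trans ((he2 _).symm.trans (Eq.trans ?_ hy1))
  congr 1
  apply PrimeSpectrum.ext
  ext s
  change g • s ∈ (hW.primeIdealOf x').asIdeal ↔ _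
  rw [hg, Ideal.smul_mem_pointwise_smul_iff]

/-- Charts form a basis of `N`, so the statement on invariants passes to all open sets by the sheaf
property. The topology is the quotient topology because an integral surjective morphism is closed.
-/
theorem isOrbitQuotient_of_chart [IsAffineHom π]
    (hcov : ∀ y : N, ∃ V : N.Opens, y ∈ V ∧ IsInvariantChart ρ π V) :
    IsOrbitQuotient (fun g => (ρ g).toLRSHom) π.toLRSHom := by
  have := IsInvariantChart.isIntegralHom h1 hmul hπ hcov
  have hbas (V : N.Opens) := IsInvariantChart.exists_basis hπ hcov V
  have hnat {U U' : N.Opens} (h : U ≤ U') (h' : π ⁻¹ᵁ U ≤ π ⁻¹ᵁ U') (z) :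
      π.app U (N.presheaf.map (homOfLE h).op z) = M.presheaf.map (homOfLE h').op (π.app U' z) :=
    congr($(π.naturality (homOfLE h).op) z)
  have hinj (U : N.Opens) (a b) (hab : π.app U a = π.app U b) : a = b := by
    choose W hyW hWV hW using fun y : U => hbas U y.1 y.2
    refine N.sheaf.eq_of_locally_eq' W U (fun y => homOfLE (hWV y))
      (fun y hy => Opens.mem_iSup.mpr ⟨⟨y, hy⟩, hyW ⟨y, hy⟩⟩) a b (fun y => ?_)
    apply (hW y).injective
    refine (hnat (hWV y) (fun x hx => hWV y hx) a).trans
      (Eq.trans ?_ (hnat (hWV y) (fun x hx => hWV y hx) b).symm)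
    rw [hab]
  refine ⟨fun g => congr(($(hπ g)).toLRSHom), ?_, ?_, ?_, ?_⟩
  · have : IsClosedMap π := π.isClosedMap
    exact this.isQuotientMap π.continuous
      (IsInvariantChart.surjective_of_cover h1 hmul hπ hcov)
  · intro x y hxy
    obtain ⟨V, hxV, hV⟩ := hcov (π x)
    exact hV.orbit h1 hmul hπ x y hxV hxy
  · intro V s t hst
    rw [secMap_self] at hst
    change π.app V s = π.app V t at hst
    exact hinj V s t hst
  · intro V s hs
    rw [secMap_self]
    change ∃ t, π.app V t = s
    have hs' g h : (ρ g).appLE (π ⁻¹ᵁ V) (π ⁻¹ᵁ V) h s = s := hs g h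
    choose W hyW hWV hW using fun y : V => hbas V y.1 y.2
    have hWV' y : π ⁻¹ᵁ W y ≤ π ⁻¹ᵁ V := fun x hx => hWV y hx
    have hex (y : V) : ∃ t, π.app (W y) t = M.presheaf.map (homOfLE (hWV' y)).op s := by
      apply (hW y).surjective
      intro g h
      rw [← CommRingCat.comp_apply, Scheme.Hom.map_appLE]
      have h' := preimage_le_of_condition hπ V g
      have e := Scheme.Hom.appLE_map (ρ g) h' (homOfLE (hWV' y)).op
      have e' := congr($e s)
      refine e'.symm.trans ?_
      rw [CommRingCat.comp_apply, hs']
    choose t ht using hex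
    have hcompat : TopCat.Presheaf.IsCompatible N.presheaf W t := by
      intro i j
      apply hinj
      have hres {U U' U'' : M.Opens} (f : op U'' ⟶ op U') (f' : op U' ⟶ op U) (h : op U'' ⟶ op U)
        (z) : M.presheaf.map f' (M.presheaf.map f z) = M.presheaf.map h z := by
        rw [← CommRingCat.comp_apply, ← M.presheaf.map_comp]; rfl
      have hl : π ⁻¹ᵁ (W i ⊓ W j) ≤ π ⁻¹ᵁ V := fun x hx => hWV' i hx.1
      refine (hnat inf_le_left (fun x hx => hx.1) (t i)).trans
        (Eq.trans ?_ (hnat inf_le_right (fun x hx => hx.2) (t j)).symm)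
      rw [ht, ht]
      exact (hres _ _ (homOfLE hl).op s).trans (hres _ _ (homOfLE hl).op s).symm
    obtain ⟨T, hT, -⟩ := N.sheaf.existsUnique_gluing' W V (fun y => homOfLE (hWV y))
      (fun y hy => Opens.mem_iSup.mpr ⟨⟨y, hy⟩, hyW ⟨y, hy⟩⟩) t hcompat
    refine ⟨T, ?_⟩
    refine M.sheaf.eq_of_locally_eq' (fun y => π ⁻¹ᵁ W y) (π ⁻¹ᵁ V) (fun y => homOfLE (hWV' y))
      (fun x hx => Opens.mem_iSup.mpr ⟨⟨π x, hx⟩, hyW ⟨π x, hx⟩⟩) _ _ (fun y => ?_)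
    refine (hnat (hWV y) (hWV' y) T).symm.trans (Eq.trans ?_ (ht y))
    exact congr(π.app (W y) $(hT y))
end

/-! ### Universal property and existence of scheme quotients. -/

/-- The coequalizer is also an orbit quotient, so the comparison morphism from it is an isomorphism
and its universal property carries over. -/
lemma IsOrbitQuotient.existsUnique_desc {G : Type} [Group G] {M N : LocallyRingedSpace.{u}}
    {ρ : G → (M ⟶ M)} {π : M ⟶ N} (h : IsOrbitQuotient ρ π) (h1 : ρ 1 = 𝟙 M)
    (hmul : ∀ g h, ρ (g * h) = ρ g ≫ ρ h) {T : LocallyRingedSpace.{u}} (q : M ⟶ T)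
    (hq : ∀ g, ρ g ≫ q = q) : ∃! d : N ⟶ T, π ≫ d = q := by
  let e : wideCoequalizer ρ ⟶ N := wideCoequalizer.desc π
    (fun g g' => (h.condition g).trans (h.condition g').symm)
  have he : wideCoequalizer.π ρ ≫ e = π := wideCoequalizer.π_desc _ _
  have : IsIso e := (isOrbitQuotient_wideCoequalizer ρ h1 hmul).isIso h (𝟙 M)
    (fun g => by simp) e (by simp [he])
  refine ⟨inv e ≫ wideCoequalizer.desc q (fun g g' => (hq g).trans (hq g').symm), ?_, ?_⟩
  · change π ≫ inv e ≫ wideCoequalizer.desc q _ = q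
    rw [← he, Category.assoc, IsIso.hom_inv_id_assoc, wideCoequalizer.π_desc]
  · intro d hd
    rw [IsIso.eq_inv_comp]
    apply wideCoequalizer.hom_ext
    rw [wideCoequalizer.π_desc, ← Category.assoc, he, hd]

/-- Scheme version of `IsOrbitQuotient`. -/
abbrev IsSchemeQuotient {G : Type} {M N : Scheme.{u}} (ρ : G → (M ⟶ M)) (π : M ⟶ N) : Prop :=
  IsOrbitQuotient (fun g => (ρ g).toLRSHom) π.toLRSHom

section
variable {G : Type} [Group G] {M N : Scheme.{u}} {ρ : G → (M ⟶ M)} {π : M ⟶ N}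

lemma toLRSHom_one (h1 : ρ 1 = 𝟙 M) : (ρ 1).toLRSHom = 𝟙 M.toLocallyRingedSpace := by
  rw [h1]; rfl

lemma toLRSHom_mul (hmul : ∀ g h, ρ (g * h) = ρ g ≫ ρ h) (g h : G) :
    (ρ (g * h)).toLRSHom = (ρ g).toLRSHom ≫ (ρ h).toLRSHom := by
  rw [hmul]; rfl

lemma IsSchemeQuotient.existsUnique_desc (h : IsSchemeQuotient ρ π) (h1 : ρ 1 = 𝟙 M)
    (hmul : ∀ g h, ρ (g * h) = ρ g ≫ ρ h) {T : Scheme.{u}} (q : M ⟶ T)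
    (hq : ∀ g, ρ g ≫ q = q) : ∃! d : N ⟶ T, π ≫ d = q := by
  obtain ⟨d, hd, hd'⟩ := IsOrbitQuotient.existsUnique_desc h (toLRSHom_one h1)
    (toLRSHom_mul hmul) q.toLRSHom (fun g => congr(($(hq g)).toLRSHom))
  refine ⟨⟨d⟩, Scheme.Hom.ext' hd, fun d' hd2 => Scheme.Hom.ext' (hd' _ congr(($hd2).toLRSHom))⟩

/-- The morphism out of a quotient induced by an invariant morphism. -/
def IsSchemeQuotient.desc (h : IsSchemeQuotient ρ π) (h1 : ρ 1 = 𝟙 M)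
    (hmul : ∀ g h, ρ (g * h) = ρ g ≫ ρ h) {T : Scheme.{u}} (q : M ⟶ T)
    (hq : ∀ g, ρ g ≫ q = q) : N ⟶ T := (h.existsUnique_desc h1 hmul q hq).choose

lemma IsSchemeQuotient.π_desc (h : IsSchemeQuotient ρ π) (h1 : ρ 1 = 𝟙 M)
    (hmul : ∀ g h, ρ (g * h) = ρ g ≫ ρ h) {T : Scheme.{u}} (q : M ⟶ T)
    (hq : ∀ g, ρ g ≫ q = q) : π ≫ h.desc h1 hmul q hq = q :=
  (h.existsUnique_desc h1 hmul q hq).choose_spec.1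

lemma IsSchemeQuotient.hom_ext (h : IsSchemeQuotient ρ π) (h1 : ρ 1 = 𝟙 M)
    (hmul : ∀ g h, ρ (g * h) = ρ g ≫ ρ h) {T : Scheme.{u}} {a b : N ⟶ T}
    (hab : π ≫ a = π ≫ b) : a = b := by
  have hc g : ρ g ≫ π = π := Scheme.Hom.ext' (h.condition g)
  exact (h.existsUnique_desc h1 hmul (π ≫ b) (fun g => by rw [← Category.assoc, hc])).unique hab rfl

/-- The spectrum of the ring of invariant global functions works, with the whole space as a chart.
-/
lemma exists_isSchemeQuotient_of_isAffine [Finite G] [IsAffine M] (h1 : ρ 1 = 𝟙 M)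
    (hmul : ∀ g h, ρ (g * h) = ρ g ≫ ρ h) :
    ∃ (R : CommRingCat.{u}) (π : M ⟶ Spec R), IsSchemeQuotient ρ π := by
  let A : Subring Γ(M, ⊤) := ⨅ g : G, (ρ g).appTop.hom.eqLocus (RingHom.id _)
  have hA a : a ∈ A ↔ ∀ g, (ρ g).appTop a = a := by
    simp only [A, Subring.mem_iInf]; rfl
  let φ : CommRingCat.of A ⟶ Γ(M, ⊤) := CommRingCat.ofHom A.subtype
  let π : M ⟶ Spec (.of A) := M.toSpecΓ ≫ Spec.map φ
  have hπ g : ρ g ≫ π = π := by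
    have : φ ≫ (ρ g).appTop = φ := by
      ext a
      exact (hA a.1).mp a.2 g
    simp only [π]
    rw [Scheme.toSpecΓ_naturality_assoc, ← Spec.map_comp, this]
  have happ : π.appTop = (Scheme.ΓSpecIso (.of A)).hom ≫ φ := by
    simp only [π, Scheme.Hom.comp_appTop, Scheme.toSpecΓ_appTop]
    exact Scheme.ΓSpecIso_naturality φ
  refine ⟨.of A, π, isOrbitQuotient_of_chart h1 hmul hπ (fun y => ⟨⊤, trivial, ?_⟩)⟩
  refine ⟨isAffineOpen_top _, ?_, ?_⟩
  · change Function.Injective π.appTop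
    rw [happ]
    intro a b hab
    exact (ConcreteCategory.bijective_of_isIso (Scheme.ΓSpecIso (.of A)).hom).1
      (Subtype.val_injective hab)
  · intro s hs
    have hs' : s ∈ A := (hA s).mpr (fun g => by
      have := hs g le_top
      exact Eq.trans congr($((ρ g).app_eq_appLE (U := ⊤)) s) this)
    obtain ⟨t, ht⟩ := (ConcreteCategory.bijective_of_isIso (Scheme.ΓSpecIso (.of A)).hom).2 ⟨s, hs'⟩
    refine ⟨t, ?_⟩
    change π.appTop t = s
    rw [happ]
    exact congr(($ht).1)

/-- The affine quotients of the pieces of an invariant affine cover are open in the coequalizer of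
locally ringed spaces. That coequalizer is therefore a scheme, with no gluing data to construct. -/
theorem exists_isSchemeQuotient [Finite G] (h1 : ρ 1 = 𝟙 M)
    (hmul : ∀ g h, ρ (g * h) = ρ g ≫ ρ h)
    (hcov : ∀ x : M, ∃ (M' : Scheme.{u}) (ρ' : G → (M' ⟶ M')) (j : M' ⟶ M), IsAffine M' ∧
      IsOpenImmersion j ∧ (∀ g, ρ' g ≫ j = j ≫ ρ g) ∧ x ∈ Set.range j) :
    ∃ (N : Scheme.{u}) (π : M ⟶ N), IsAffineHom π ∧ IsSchemeQuotient ρ π := by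
  let C := wideCoequalizer (fun g => (ρ g).toLRSHom)
  let p : M.toLocallyRingedSpace ⟶ C := wideCoequalizer.π _
  have hp : IsOrbitQuotient (fun g => (ρ g).toLRSHom) p :=
    isOrbitQuotient_wideCoequalizer _ (toLRSHom_one h1) (toLRSHom_mul hmul)
  have key (x : M) : ∃ (R : CommRingCat.{u}) (M' : Scheme.{u}) (ρ' : G → (M' ⟶ M')) (j : M' ⟶ M)
      (q : M' ⟶ Spec R) (d : (Spec R).toLocallyRingedSpace ⟶ C), IsAffine M' ∧ IsOpenImmersion j ∧
      (∀ g, ρ' g ≫ j = j ≫ ρ g) ∧ x ∈ Set.range j ∧ IsSchemeQuotient ρ' q ∧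
      LocallyRingedSpace.IsOpenImmersion d ∧ q.toLRSHom ≫ d = j.toLRSHom ≫ p := by
    obtain ⟨M', ρ', j, _, _, hj, hx⟩ := hcov x
    have h1' : ρ' 1 = 𝟙 M' := by
      rw [← cancel_mono j, hj, h1]; simp
    have hmul' g h : ρ' (g * h) = ρ' g ≫ ρ' h := by
      rw [← cancel_mono j, hj, hmul]; simp [hj, reassoc_of% hj]
    obtain ⟨R, q, hq⟩ := exists_isSchemeQuotient_of_isAffine h1' hmul'
    have hj2 g : (ρ' g).toLRSHom ≫ j.toLRSHom = j.toLRSHom ≫ (ρ g).toLRSHom :=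
      congr(($(hj g)).toLRSHom)
    obtain ⟨d, hd, -⟩ := IsOrbitQuotient.existsUnique_desc hq (toLRSHom_one h1')
      (toLRSHom_mul hmul') (j.toLRSHom ≫ p) (fun g => by
        rw [← Category.assoc, hj2, Category.assoc, hp.condition])
    have : LocallyRingedSpace.IsOpenImmersion j.toLRSHom := ‹IsOpenImmersion j›
    exact ⟨R, M', ρ', j, q, d, ‹_›, ‹_›, hj, hx, hq, hq.isOpenImmersion hp _ hj2 d hd, hd⟩
  let N : Scheme.{u} := LocallyRingedSpace.IsOpenImmersion.scheme C (fun y => by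
    obtain ⟨x, rfl⟩ := hp.isQuotientMap.surjective y
    obtain ⟨R, M', ρ', j, q, d, _, _, hj, ⟨z, rfl⟩, hq, hd, hd'⟩ := key x
    exact ⟨R, d, ⟨q.toLRSHom.base z, congr(($hd').base z)⟩, hd⟩)
  let π : M ⟶ N := ⟨p⟩
  refine ⟨N, π, ?_, hp⟩
  refine isAffineHom_of_forall_exists_isAffineOpen π fun y => ?_
  obtain ⟨x, rfl⟩ := hp.isQuotientMap.surjective y
  obtain ⟨R, M', ρ', j, q, d, _, _, hj, ⟨z, rfl⟩, hq, hd, hd'⟩ := key x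
  let d' : Spec R ⟶ N := ⟨d⟩
  have : IsOpenImmersion d' := hd
  have hqd : q ≫ d' = j ≫ π := Scheme.Hom.ext' hd'
  have e z : d' (q z) = π (j z) := congr($hqd z)
  refine ⟨d'.opensRange, ⟨q z, e z⟩, isAffineOpen_opensRange d', ?_⟩
  -- An orbit that meets the stable open set `j.opensRange` lies in it.
  have : π ⁻¹ᵁ d'.opensRange = j.opensRange := by
    ext x
    constructor
    · rintro ⟨a, ha⟩
      obtain ⟨x', rfl⟩ := hq.isQuotientMap.surjective a
      obtain ⟨g, hg⟩ := hp.orbit _ _ ((e x').symm.trans ha)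
      exact ⟨ρ' g x', congr($(hj g) x').trans hg⟩
    · rintro ⟨x', rfl⟩
      exact ⟨q x', e x'⟩
  rw [this]
  exact isAffineOpen_opensRange j
end

/-! ### Fibre products and fibre powers. -/

/-- `M` with the projections `p i` is the fibre product of the `f i : X i ⟶ S`. -/
structure IsFibreProduct {n : ℕ} {M S : Scheme.{u}} {X : Fin n → Scheme.{u}}
    (b : M ⟶ S) (p : ∀ i, M ⟶ X i) (f : ∀ i, X i ⟶ S) : Prop where
  w (i) : p i ≫ f i = b
  exists_lift {T : Scheme.{u}} (t : T ⟶ S) (q : ∀ i, T ⟶ X i) : (∀ i, q i ≫ f i = t) →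
    ∃ l : T ⟶ M, l ≫ b = t ∧ ∀ i, l ≫ p i = q i
  hom_ext {T : Scheme.{u}} (a c : T ⟶ M) : a ≫ b = c ≫ b → (∀ i, a ≫ p i = c ≫ p i) → a = c

lemma isFibreProduct_widePullback {n : ℕ} {S : Scheme.{u}} {X : Fin n → Scheme.{u}}
    (f : ∀ i, X i ⟶ S) :
    IsFibreProduct (WidePullback.base f) (WidePullback.π f) f where
  w _ := WidePullback.π_arrow f _
  exists_lift t q h := ⟨WidePullback.lift t q h, WidePullback.lift_base _ _ _ _,
    fun i => WidePullback.lift_π _ _ _ _ _⟩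
  hom_ext _ _ hb hp := WidePullback.hom_ext _ _ _ hp hb

theorem IsFibreProduct.property (P : MorphismProperty Scheme.{u}) [P.IsStableUnderBaseChange]
    [P.IsMultiplicative] {n : ℕ} {M S : Scheme.{u}} {X : Fin n → Scheme.{u}}
    {b : M ⟶ S} {p : ∀ i, M ⟶ X i} {f : ∀ i, X i ⟶ S} (h : IsFibreProduct b p f)
    (hf : ∀ i, P (f i)) : P b := by
  induction n generalizing M with
  | zero =>
    -- The empty fibre product is the base itself.
    obtain ⟨l, hl, -⟩ := h.exists_lift (𝟙 S) (fun i => i.elim0) (fun i => i.elim0)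
    have : IsIso b := ⟨l, h.hom_ext _ _ (by simp [hl]) (fun i => i.elim0), hl⟩
    exact P.of_isIso b
  | succ n ih =>
    have h' := isFibreProduct_widePullback (fun i : Fin n => f i.succ)
    have hP := ih h' (fun i => hf i.succ)
    obtain ⟨l, hl, hl'⟩ := h'.exists_lift b (fun i => p i.succ) (fun i => h.w _)
    -- A product of n + 1 factors is the pullback of the first factor along the product of the
    -- others.
    have sq : IsPullback l (p 0) (WidePullback.base (fun i : Fin n => f i.succ)) (f 0) := by
      refine ⟨⟨by rw [hl, h.w]⟩, ⟨PullbackCone.IsLimit.mk _ (fun s => ?_) ?_ ?_ ?_⟩⟩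
      · exact (h.exists_lift (s.fst ≫ WidePullback.base _)
          (Fin.cons s.snd (fun i => s.fst ≫ WidePullback.π _ i)) (by
            refine Fin.cases s.condition.symm (fun i => ?_)
            simp [WidePullback.π_arrow])).choose
      all_goals intro s
      all_goals have hs := (h.exists_lift (s.fst ≫ WidePullback.base _)
          (Fin.cons s.snd (fun i => s.fst ≫ WidePullback.π _ i)) (by
            refine Fin.cases s.condition.symm (fun i => ?_)
            simp [WidePullback.π_arrow])).choose_spec
      · refine h'.hom_ext _ _ (by rw [Category.assoc, hl, hs.1]) (fun i => ?_)
        rw [Category.assoc, hl', hs.2]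
        rfl
      · rw [hs.2]; rfl
      · intro c hc hc'
        refine h.hom_ext _ _ ?_ ?_
        · rw [hs.1, ← hc, Category.assoc, hl]
        · refine Fin.cases ?_ (fun i => ?_)
          · rw [hs.2, hc']; rfl
          · rw [hs.2, ← hl', ← Category.assoc, hc]; rfl
    rw [← hl]
    exact P.comp_mem _ _ (P.of_isPullback sq.flip (hf 0)) hP

section Power
variable {X X' X'' S S' : Scheme.{u}} (m : ℕ)

/-- The projections of the fibre power. -/
def power.proj (f : X ⟶ S) (i : Fin m) : power m f ⟶ X := WidePullback.π (fun _ : Fin m => f) i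

lemma power.isFibreProduct (f : X ⟶ S) :
    IsFibreProduct (power.toBase m f) (power.proj m f) (fun _ => f) :=
  isFibreProduct_widePullback _

@[simp]
lemma power.proj_comp (f : X ⟶ S) (i) : power.proj m f i ≫ f = power.toBase m f :=
  (power.isFibreProduct m f).w i

@[simp]
lemma power.proj_comp_assoc (f : X ⟶ S) (i) {Z : Scheme.{u}} (k : S ⟶ Z) :
    power.proj m f i ≫ f ≫ k = power.toBase m f ≫ k := by
  rw [← Category.assoc, power.proj_comp]

variable {m} in
/-- The morphism into the fibre power with given components. -/
def power.lift {f : X ⟶ S} {T : Scheme.{u}} (t : T ⟶ S) (q : Fin m → (T ⟶ X))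
    (h : ∀ i, q i ≫ f = t) : T ⟶ power m f := WidePullback.lift t q h

variable {m} in
lemma power.lift_toBase {f : X ⟶ S} {T : Scheme.{u}} (t : T ⟶ S) (q : Fin m → (T ⟶ X))
    (h : ∀ i, q i ≫ f = t) : power.lift t q h ≫ power.toBase m f = t :=
  WidePullback.lift_base _ _ _ _

variable {m} in
lemma power.lift_toBase_assoc {f : X ⟶ S} {T : Scheme.{u}} (t : T ⟶ S) (q : Fin m → (T ⟶ X))
    (h : ∀ i, q i ≫ f = t) {Z : Scheme.{u}} (k : S ⟶ Z) :
    power.lift t q h ≫ power.toBase m f ≫ k = t ≫ k := by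
  rw [← Category.assoc, power.lift_toBase]

variable {m} in
lemma power.lift_proj {f : X ⟶ S} {T : Scheme.{u}} (t : T ⟶ S) (q : Fin m → (T ⟶ X))
    (h : ∀ i, q i ≫ f = t) (i) : power.lift t q h ≫ power.proj m f i = q i :=
  WidePullback.lift_π _ _ _ _ _

variable {m} in
lemma power.lift_proj_assoc {f : X ⟶ S} {T : Scheme.{u}} (t : T ⟶ S) (q : Fin m → (T ⟶ X))
    (h : ∀ i, q i ≫ f = t) (i) {Z : Scheme.{u}} (k : X ⟶ Z) :
    power.lift t q h ≫ power.proj m f i ≫ k = q i ≫ k := by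
  rw [← Category.assoc, power.lift_proj]

variable {m} in
lemma power.hom_ext {f : X ⟶ S} {T : Scheme.{u}} {a b : T ⟶ power m f}
    (h : ∀ i, a ≫ power.proj m f i = b ≫ power.proj m f i)
    (hb : a ≫ power.toBase m f = b ≫ power.toBase m f) : a = b :=
  (power.isFibreProduct m f).hom_ext _ _ hb h

lemma power.perm_proj (f : X ⟶ S) (σ : Equiv.Perm (Fin m)) (i) :
    power.perm m f σ ≫ power.proj m f i = power.proj m f (σ i) :=
  WidePullback.lift_π _ _ _ _ _

lemma power.perm_proj_assoc (f : X ⟶ S) (σ : Equiv.Perm (Fin m)) (i) {Z : Scheme.{u}} (k : X ⟶ Z) :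
    power.perm m f σ ≫ power.proj m f i ≫ k = power.proj m f (σ i) ≫ k := by
  rw [← Category.assoc, power.perm_proj]

lemma power.perm_one (f : X ⟶ S) : power.perm m f 1 = 𝟙 _ :=
  power.hom_ext (fun i => by simp [power.perm_proj]) (by simp [power.perm_toBase])

lemma power.perm_mul (f : X ⟶ S) (σ τ : Equiv.Perm (Fin m)) :
    power.perm m f (σ * τ) = power.perm m f σ ≫ power.perm m f τ :=
  power.hom_ext (fun i => by simp [power.perm_proj])
    (by simp [power.perm_toBase])

/-- The morphism of fibre powers induced by a morphism over `S ⟶ S'`. -/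
def power.map {f : X ⟶ S} {f' : X' ⟶ S'} (g : X ⟶ X') (s : S ⟶ S') (h : g ≫ f' = f ≫ s) :
    power m f ⟶ power m f' :=
  power.lift (power.toBase m f ≫ s) (fun i => power.proj m f i ≫ g) (fun i => by simp [h])

section
variable {f : X ⟶ S} {f' : X' ⟶ S'} (g : X ⟶ X') (s : S ⟶ S') (h : g ≫ f' = f ≫ s)

lemma power.map_proj (i) : power.map m g s h ≫ power.proj m f' i = power.proj m f i ≫ g :=
  power.lift_proj _ _ _ i

lemma power.map_toBase : power.map m g s h ≫ power.toBase m f' = power.toBase m f ≫ s :=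
  power.lift_toBase _ _ _

lemma power.perm_map (σ) :
    power.perm m f σ ≫ power.map m g s h = power.map m g s h ≫ power.perm m f' σ := by
  refine power.hom_ext (fun i => ?_) ?_
  · simp [power.perm_proj, power.map_proj, power.perm_proj_assoc]
  · simp [power.map_toBase, power.perm_toBase, reassoc_of% (power.perm_toBase m f σ)]

end

lemma power.isAffine (f : X ⟶ S) [IsAffine X] [IsAffine S] : IsAffine (power m f) := by
  have : ∀ i, IsAffine ((WidePullbackShape.wideCospan S (fun _ : Fin m => X) (fun _ => f)).obj i) :=
    fun i => match i with
    | none => ‹IsAffine S›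
    | some _ => ‹IsAffine X›
  exact Scheme.isAffine_of_isLimit _ (limit.isLimit
    (WidePullbackShape.wideCospan S (fun _ : Fin m => X) (fun _ => f)))

lemma power.toBase_property (P : MorphismProperty Scheme.{u}) [P.IsStableUnderBaseChange]
    [P.IsMultiplicative] (f : X ⟶ S) (hf : P f) : P (power.toBase m f) :=
  (power.isFibreProduct m f).property P (fun _ => hf)

/-- The source is the fibre product, over the target power, of the pullbacks of `g` along the m
projections; a property stable under base change and composition passes to it. -/
lemma power.map_property (P : MorphismProperty Scheme.{u}) [P.IsStableUnderBaseChange]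
    [P.IsMultiplicative] {f : X ⟶ S} {f' : X' ⟶ S} (g : X ⟶ X') (h : g ≫ f' = f ≫ 𝟙 S)
    (hg : P g) (_ : 0 < m) : P (power.map m g (𝟙 S) h) := by
  have key : IsFibreProduct (power.map m g (𝟙 S) h)
      (fun i => pullback.lift (power.map m g (𝟙 S) h) (power.proj m f i) (power.map_proj m g _ h i))
      (fun i => pullback.fst (power.proj m f' i) g) := by
    refine ⟨fun i => pullback.lift_fst _ _ _, fun {T} t q hq => ?_, fun {T} a c hb hp => ?_⟩
    · have hw i : (q i ≫ pullback.snd _ _) ≫ f = t ≫ power.toBase m f' := by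
        have := h
        rw [Category.comp_id] at this
        rw [← this, Category.assoc, ← pullback.condition_assoc, reassoc_of% hq i, power.proj_comp]
      have e : power.lift (t ≫ power.toBase m f') _ hw ≫ power.map m g (𝟙 S) h = t := by
        refine power.hom_ext (fun i => ?_) ?_
        · rw [Category.assoc, power.map_proj, power.lift_proj_assoc, Category.assoc,
            ← pullback.condition, reassoc_of% hq i]
        · rw [Category.assoc, power.map_toBase, power.lift_toBase_assoc, Category.comp_id]
      refine ⟨power.lift (t ≫ power.toBase m f') _ hw, e, fun i => ?_⟩
      apply pullback.hom_ext
      · rw [Category.assoc, pullback.lift_fst, hq]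
        exact e
      · rw [Category.assoc, pullback.lift_snd, power.lift_proj]
    · refine power.hom_ext (fun i => ?_) ?_
      · have := congr($(hp i) ≫ pullback.snd _ _)
        rwa [Category.assoc, Category.assoc, pullback.lift_snd] at this
      · have := congr($hb ≫ power.toBase m f')
        simpa [power.map_toBase] using this
  exact key.property P (fun i => P.pullback_fst _ _ hg)

/-- The fibre power commutes with base change. -/
lemma power.isPullback_map {f : X ⟶ S} {f' : X' ⟶ S'} (g : X ⟶ X') (s : S ⟶ S')
    (h : IsPullback g f f' s) :
    IsPullback (power.map m g s h.w) (power.toBase m f) (power.toBase m f') s := by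
  refine ⟨⟨power.map_toBase m g s h.w⟩, ⟨PullbackCone.IsLimit.mk _
    (fun c => power.lift c.snd (fun i => h.lift (c.fst ≫ power.proj m f' i) c.snd
      (by rw [Category.assoc, power.proj_comp, c.condition])) (fun i => by simp)) ?_ ?_ ?_⟩⟩
  · intro c
    refine power.hom_ext (fun i => ?_) ?_
    · rw [Category.assoc, power.map_proj, power.lift_proj_assoc, h.lift_fst]
    · rw [Category.assoc, power.map_toBase, power.lift_toBase_assoc, c.condition]
  · intro c
    rw [power.lift_toBase]
  · intro c d hd hd'
    refine power.hom_ext (fun i => ?_) (by rw [power.lift_toBase, hd'])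
    rw [power.lift_proj]
    apply h.hom_ext
    · rw [h.lift_fst, Category.assoc, ← power.map_proj m g s h.w, reassoc_of% hd]
    · rw [h.lift_snd, Category.assoc, power.proj_comp, hd']

lemma power.isOpenImmersion_map {f : X ⟶ S} {f' : X' ⟶ S} (g : X ⟶ X') (h : g ≫ f' = f ≫ 𝟙 S)
    [IsOpenImmersion g] (hm : 0 < m) : IsOpenImmersion (power.map m g (𝟙 S) h) :=
  power.map_property m @IsOpenImmersion g h ‹_› hm

/-- Over the residue field of `x` each component factors through the open immersion, and these
factorizations assemble to a point of the smaller power. -/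
lemma power.mem_range_map {f : X ⟶ S} {f' : X' ⟶ S} (g : X ⟶ X') (h : g ≫ f' = f ≫ 𝟙 S)
    [IsOpenImmersion g] (x : power m f') (hx : ∀ i, power.proj m f' i x ∈ Set.range g) :
    x ∈ Set.range (power.map m g (𝟙 S) h) := by
  have e i : ∃ l, l ≫ g = (power m f').fromSpecResidueField x ≫ power.proj m f' i := by
    refine ⟨IsOpenImmersion.lift g _ ?_, IsOpenImmersion.lift_fac _ _ _⟩
    rintro _ ⟨y, rfl⟩
    rw [Scheme.Hom.comp_apply, Scheme.fromSpecResidueField_apply]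
    exact hx i
  choose l hl using e
  have h' : g ≫ f' = f := by simpa using h
  let L : Spec ((power m f').residueField x) ⟶ power m f :=
    power.lift ((power m f').fromSpecResidueField x ≫ power.toBase m f') l
      (fun i => by rw [← h', reassoc_of% hl i, power.proj_comp])
  have hL : L ≫ power.map m g (𝟙 S) h = (power m f').fromSpecResidueField x :=
    power.hom_ext (fun i => by simp [L, power.map_proj, power.lift_proj_assoc, hl])
      (by simp [L, power.map_toBase, power.lift_toBase])
  refine ⟨L (IsLocalRing.closedPoint _), ?_⟩
  exact congr($hL (IsLocalRing.closedPoint _)).trans (Scheme.fromSpecResidueField_apply _ _)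

end Power

/-! ### Existence of symmetric powers. -/

/-- Every finite set of points of `X` lies in an affine open. -/
def AffineFinite (X : Scheme.{u}) : Prop :=
  ∀ s : Set X, s.Finite → ∃ U : X.Opens, IsAffineOpen U ∧ s ⊆ U

/-- The components of a point of the power are finitely many points of X, so they lie in one affine
open U; then U^m is a stable affine neighbourhood of the point. -/
theorem exists_symPower_scheme {X S : Scheme.{u}} (m : ℕ) (hm : 0 < m) (f : X ⟶ S) [IsAffine S]
    (hX : AffineFinite X) : ∃ (N : Scheme.{u}) (π : power m f ⟶ N), IsAffineHom π ∧
      IsSchemeQuotient (power.perm m f) π := by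
  refine exists_isSchemeQuotient (power.perm_one m f) (power.perm_mul m f) fun x => ?_
  obtain ⟨U, hU, hs⟩ := hX (Set.range fun i => power.proj m f i x) (Set.finite_range _)
  have : IsAffine U := hU
  have h : U.ι ≫ f = (U.ι ≫ f) ≫ 𝟙 S := by simp
  refine ⟨power m (U.ι ≫ f), power.perm m _, power.map m U.ι (𝟙 S) h, power.isAffine m _,
    power.isOpenImmersion_map m _ h hm, power.perm_map m _ _ h, ?_⟩
  exact power.mem_range_map m _ h x (fun i => by
    rw [Scheme.Opens.range_ι]; exact hs ⟨i, rfl⟩)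

/-! ### Flat base change and finiteness of quotients. -/

section
open TensorProduct

/-- Being invariant is a linear condition: A → B → B^G with b ↦ (gb − b)_g is exact, and tensoring
with a flat algebra keeps it exact. -/
lemma exists_tmul_one_eq_of_flat {A B A' : Type*} [CommRing A] [CommRing B] [CommRing A']
    [Algebra A B] [Algebra A A'] [Module.Flat A A'] {G : Type*} [Finite G] (act : G → B →ₗ[A] B)
    (hinv : ∀ b, (∀ g, act g b = b) → ∃ a, algebraMap A B a = b)
    (hact : ∀ g a, act g (algebraMap A B a) = algebraMap A B a)
    (x : A' ⊗[A] B) (hx : ∀ g, (act g).lTensor A' x = x) : ∃ a' : A', a' ⊗ₜ 1 = x := by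
  classical
  have := Fintype.ofFinite G
  let d : B →ₗ[A] (G → B) := LinearMap.pi (fun g => act g - LinearMap.id)
  have hd : Function.Exact (Algebra.linearMap A B) d := by
    intro b
    constructor
    · intro hb
      obtain ⟨a, ha⟩ := hinv b (fun g => by
        have := congrFun hb g
        simpa [d, sub_eq_zero] using this)
      exact ⟨a, ha⟩
    · rintro ⟨a, rfl⟩
      ext g
      simp [d, hact]
  have hx0 : d.lTensor A' x = 0 := by
    apply (TensorProduct.piRight A A A' (fun _ : G => B)).injective
    rw [map_zero]
    ext g
    have : ∀ y : A' ⊗[A] B, (TensorProduct.piRight A A A' (fun _ : G => B)) (d.lTensor A' y) g =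
        (act g).lTensor A' y - y := by
      intro y
      induction y with
      | zero => simp
      | tmul a b => simp [d, TensorProduct.tmul_sub]
      | add a b ha hb => rw [map_add, map_add, Pi.add_apply, ha, hb, map_add]; abel
    rw [this, hx, sub_self]; rfl
  obtain ⟨y, hy⟩ := ((Module.Flat.lTensor_exact A' hd) x).mp hx0
  refine ⟨TensorProduct.rid A A' y, ?_⟩
  have : ∀ y : A' ⊗[A] A, (TensorProduct.rid A A' y) ⊗ₜ[A] (1 : B) =
      (Algebra.linearMap A B).lTensor A' y := by
    intro y
    induction y with
    | zero => simp
    | tmul a b => simp [Algebra.algebraMap_eq_smul_one, TensorProduct.smul_tmul']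
    | add a b ha hb => rw [map_add, map_add, TensorProduct.add_tmul, ha, hb]
  rw [← hy, this]

lemma invariants_of_isPushout {A B A' B' : CommRingCat.{u}} {i : A ⟶ B} {f : A ⟶ A'} {k : B ⟶ B'}
    {i' : A' ⟶ B'} (h : IsPushout i f k i') (hf : f.hom.Flat) {G : Type} [Finite G]
    (act : G → (B ⟶ B)) (act' : G → (B' ⟶ B')) (h1 : ∀ g, i ≫ act g = i)
    (h2 : ∀ g, i' ≫ act' g = i') (h3 : ∀ g, k ≫ act' g = act g ≫ k)
    (hinj : Function.Injective i) (hinv : ∀ b, (∀ g, act g b = b) → ∃ a, i a = b) :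
    Function.Injective i' ∧ ∀ x, (∀ g, act' g x = x) → ∃ a, i' a = x := by
  algebraize [i.hom, f.hom]
  have hp := CommRingCat.isPushout_tensorProduct A A' B
  let e : CommRingCat.of (A' ⊗[A] B) ≅ B' := hp.isoIsPushout _ _ h.flip
  have e1 : CommRingCat.ofHom Algebra.TensorProduct.includeLeftRingHom ≫ e.hom = i' :=
    hp.inl_isoIsPushout_hom _ _ h.flip
  have e2 : CommRingCat.ofHom (Algebra.TensorProduct.includeRight (R := A) (A := A') (B := B)).toRingHom
      ≫ e.hom = k :=
    hp.inr_isoIsPushout_hom _ _ h.flip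
  have e1' (a) : e.hom (a ⊗ₜ 1) = i' a := congr($e1 a)
  have e2' (b) : e.hom (1 ⊗ₜ b) = k b := congr($e2 b)
  have einj : Function.Bijective e.hom := ConcreteCategory.bijective_of_isIso _
  constructor
  · intro a b hab
    rw [← e1', ← e1'] at hab
    have := einj.1 hab
    exact Algebra.TensorProduct.includeLeft_injective (S := A) hinj this
  · intro x hx
    obtain ⟨x, rfl⟩ := einj.2 x
    let actl (g : G) : B →ₗ[A] B :=
      { toFun := act g
        map_add' := map_add _
        map_smul' := fun a b => by
          rw [Algebra.smul_def, map_mul, RingHom.id_apply, Algebra.smul_def]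
          congr 1
          exact congr($(h1 g) a) }
    have key g (y : A' ⊗[A] B) : e.hom ((actl g).lTensor A' y) = act' g (e.hom y) := by
      induction y with
      | zero => simp
      | tmul a b =>
        have hl : a ⊗ₜ[A] (act g b) = (a ⊗ₜ[A] (1 : B)) * ((1 : A') ⊗ₜ[A] (act g b)) := by simp
        have hr : a ⊗ₜ[A] b = (a ⊗ₜ[A] (1 : B)) * ((1 : A') ⊗ₜ[A] b) := by simp
        rw [LinearMap.lTensor_tmul]
        change e.hom (a ⊗ₜ[A] (act g b)) = _
        rw [hl, hr]
        refine (map_mul e.hom.hom _ _).trans (Eq.trans ?_ congr(act' g $(map_mul e.hom.hom _ _)).symm)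
        refine Eq.trans ?_ (map_mul (act' g).hom _ _).symm
        refine congr_arg₂ _ ((e1' a).trans ?_) ((e2' _).trans ?_)
        · exact congr($(h2 g) a).symm.trans congr(act' g $(e1' a)).symm
        · exact congr($(h3 g) b).symm.trans congr(act' g $(e2' b)).symm
      | add a b ha hb =>
        rw [map_add]
        refine (map_add e.hom.hom _ _).trans ?_
        refine (congr_arg₂ _ ha hb).trans ?_
        rw [← map_add]
        exact congr(act' g $(map_add e.hom.hom a b)).symm
    obtain ⟨a, ha⟩ := exists_tmul_one_eq_of_flat (A' := A') actl hinv
      (fun g a => congr($(h1 g) a)) x (fun g => einj.1 ((key g x).trans (hx g)))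
    exact ⟨a, (e1' a).symm.trans congr(e.hom $ha)⟩
end

section
variable {G : Type} {M N : Scheme.{u}} {ρ : G → (M ⟶ M)} {π : M ⟶ N}

lemma IsSchemeQuotient.condition' (h : IsSchemeQuotient ρ π) (g : G) : ρ g ≫ π = π :=
  Scheme.Hom.ext' (h.condition g)

lemma IsSchemeQuotient.isInvariantChart (h : IsSchemeQuotient ρ π) {V : N.Opens}
    (hV : IsAffineOpen V) : IsInvariantChart ρ π V where
  isAffineOpen := hV
  injective := by
    have := h.injective V
    rw [secMap_self] at this
    exact this
  surjective s hs := by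
    obtain ⟨t, ht⟩ := h.surjective V s hs
    rw [secMap_self] at ht
    exact ⟨t, ht⟩

lemma IsSchemeQuotient.surjective' (h : IsSchemeQuotient ρ π) : Surjective π :=
  ⟨h.isQuotientMap.surjective⟩

end

section
variable {G : Type} [Group G] [Finite G] {M N M' N' : Scheme.{u}} {ρ : G → (M ⟶ M)} {π : M ⟶ N}
  {ρ' : G → (M' ⟶ M')} {π' : M' ⟶ N'} {a : M' ⟶ M} {n : N' ⟶ N}

lemma IsSchemeQuotient.isIntegralHom [IsAffineHom π] (h : IsSchemeQuotient ρ π) (h1 : ρ 1 = 𝟙 M)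
    (hmul : ∀ g h, ρ (g * h) = ρ g ≫ ρ h) : IsIntegralHom π :=
  IsInvariantChart.isIntegralHom h1 hmul h.condition' fun y => by
    obtain ⟨_, ⟨V, hV, rfl⟩, hyV, -⟩ := N.isBasis_affineOpens.exists_subset_of_mem_open
      (Set.mem_univ y) isOpen_univ
    exact ⟨V, hyV, h.isInvariantChart hV⟩

/-- Quotients by finite groups commute with flat base change. -/
theorem IsSchemeQuotient.of_isPullback [IsAffineHom π] (h : IsSchemeQuotient ρ π)
    (h1' : ρ' 1 = 𝟙 M') (hmul' : ∀ g h, ρ' (g * h) = ρ' g ≫ ρ' h)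
    (sq : IsPullback a π' π n) [Flat n] (hπ' : ∀ g, ρ' g ≫ π' = π')
    (ha : ∀ g, ρ' g ≫ a = a ≫ ρ g) : IsSchemeQuotient ρ' π' := by
  have : IsAffineHom π' := MorphismProperty.of_isPullback sq ‹_›
  refine isOrbitQuotient_of_chart h1' hmul' hπ' fun y => ?_
  obtain ⟨_, ⟨V, hV : IsAffineOpen V, rfl⟩, hyV, -⟩ :=
    N.isBasis_affineOpens.exists_subset_of_mem_open (Set.mem_univ (n y)) isOpen_univ
  obtain ⟨_, ⟨V', hV' : IsAffineOpen V', rfl⟩, hyV', hVV'⟩ :=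
    N'.isBasis_affineOpens.exists_subset_of_mem_open (a := y) (u := (n ⁻¹ᵁ V : N'.Opens))
      hyV (n ⁻¹ᵁ V).2
  have hU : π' ⁻¹ᵁ V' = a ⁻¹ᵁ (π ⁻¹ᵁ V) ⊓ π' ⁻¹ᵁ V' := by
    refine (inf_eq_right.mpr ?_).symm
    rw [← Scheme.Hom.comp_preimage, sq.w, Scheme.Hom.comp_preimage]
    exact fun x hx => hVV' hx
  have hle1 : π' ⁻¹ᵁ V' ≤ a ⁻¹ᵁ (π ⁻¹ᵁ V) := hU.le.trans inf_le_left
  -- On affine opens the sections of the base change are the tensor product, so the statement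
  -- becomes one about invariants in a pushout of rings.
  have hpo : IsPushout (π.appLE V (π ⁻¹ᵁ V) le_rfl) (n.appLE V V' hVV')
      (a.appLE (π ⁻¹ᵁ V) (π' ⁻¹ᵁ V') hle1) (π'.appLE V' (π' ⁻¹ᵁ V') le_rfl) :=
    (isIso_pushoutSection_iff sq hVV' le_rfl hU).mp
      (isIso_pushoutSection_of_isAffineOpen sq hVV' le_rfl hU hV hV' (hV.preimage π))
  have hch := h.isInvariantChart hV
  have hl g := preimage_le_of_condition h.condition' V g
  have hl' g := preimage_le_of_condition hπ' V' g
  have key := invariants_of_isPushout hpo (HasRingHomProperty.appLE (P := @Flat) n ‹_› ⟨V, hV⟩ ⟨V', hV'⟩ hVV')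
    (fun g => (ρ g).appLE _ _ (hl g)) (fun g => (ρ' g).appLE _ _ (hl' g))
    (fun g => by rw [Scheme.Hom.appLE_comp_appLE]; simp only [h.condition'])
    (fun g => by rw [Scheme.Hom.appLE_comp_appLE]; simp only [hπ'])
    (fun g => by rw [Scheme.Hom.appLE_comp_appLE, Scheme.Hom.appLE_comp_appLE]; simp only [ha])
    (by rw [← Scheme.Hom.app_eq_appLE]; exact hch.injective)
    (fun b hb => by
      rw [← Scheme.Hom.app_eq_appLE]
      exact hch.surjective b (fun g _ => hb g))
  rw [← Scheme.Hom.app_eq_appLE] at key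
  exact ⟨V', hyV', hV', key.1, fun s hs => key.2 s (fun g => hs g _)⟩

/-- This is the Artin–Tate lemma: the upper ring is of finite type over the noetherian base and
integral, hence finite, over the middle ring. -/
lemma locallyOfFiniteType_of_isIntegralHom_of_injective {S : Scheme.{u}} (c : N ⟶ S)
    [IsLocallyNoetherian S] [IsIntegralHom π] [LocallyOfFiniteType (π ≫ c)]
    (hinj : ∀ V, Function.Injective (π.app V)) : LocallyOfFiniteType c := by
  rw [HasRingHomProperty.iff_appLE (P := @LocallyOfFiniteType)]
  intro U V e
  have hW := V.2.preimage π
  have hft := HasRingHomProperty.appLE (P := @LocallyOfFiniteType) (π ≫ c) ‹_› U ⟨_, hW⟩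
    (show π ⁻¹ᵁ V.1 ≤ (π ≫ c) ⁻¹ᵁ U.1 from fun x hx => e hx)
  have hcomp := Scheme.Hom.appLE_comp_appLE π c U.1 V.1 (π ⁻¹ᵁ V.1) e le_rfl
  rw [← Scheme.Hom.app_eq_appLE] at hcomp
  rw [← hcomp] at hft
  have hint := IsIntegralHom.isIntegral_app (f := π) V.1 V.2
  have hinj := hinj V.1
  have : IsNoetherianRing Γ(S, U.1) := IsLocallyNoetherian.component_noetherian U
  generalize c.appLE U.1 V.1 e = φ at *
  generalize π.app V.1 = ψ at *
  algebraize [φ.hom, ψ.hom, (φ ≫ ψ).hom]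
  have : IsScalarTower Γ(S, U.1) Γ(N, V.1) Γ(M, π ⁻¹ᵁ V.1) := .of_algebraMap_eq fun _ => rfl
  have : Algebra.FiniteType Γ(N, V.1) Γ(M, π ⁻¹ᵁ V.1) :=
    .of_restrictScalars_finiteType Γ(S, U.1) _ _
  have : Module.Finite Γ(N, V.1) Γ(M, π ⁻¹ᵁ V.1) := Algebra.IsIntegral.finite
  exact ⟨fg_of_fg_of_fg Γ(S, U.1) Γ(N, V.1) Γ(M, π ⁻¹ᵁ V.1) Algebra.FiniteType.out Module.Finite.fg_top
    hinj⟩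

lemma quasiCompact_of_surjective_comp {S : Scheme.{u}} (c : N ⟶ S) [Surjective π]
    [QuasiCompact (π ≫ c)] : QuasiCompact c := by
  refine ⟨fun U hU hU' => ?_⟩
  have h := QuasiCompact.isCompact_preimage (f := π ≫ c) U hU hU'
  have : c ⁻¹' U = π '' ((π ≫ c) ⁻¹' U) := by
    change _ = π '' (π ⁻¹' (c ⁻¹' U))
    rw [Set.image_preimage_eq _ π.surjective]
  rw [this]
  exact h.image π.continuous

/-- The diagonal of `c` is the image of the closed diagonal of `π ≫ c` under `π × π`, which is a
closed map. -/
lemma isSeparated_of_surjective_comp {S : Scheme.{u}} (c : N ⟶ S) [Surjective π]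
    [UniversallyClosed π] [IsSeparated (π ≫ c)] : IsSeparated c := by
  refine ⟨.of_isPreimmersion _ ?_⟩
  let b := π ≫ c
  let q : pullback b b ⟶ pullback c c := pullback.map b b c c π π (𝟙 S) (by simp [b]) (by simp [b])
  have hq : UniversallyClosed q :=
    MorphismProperty.pullbackMap (P := @UniversallyClosed) ‹_› ‹_› rfl rfl
  have e : pullback.diagonal b ≫ q = π ≫ pullback.diagonal c := by
    apply pullback.hom_ext
    · rw [Category.assoc, pullback.lift_fst, ← Category.assoc]; simp
    · rw [Category.assoc, pullback.lift_snd, ← Category.assoc]; simp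
  have : Set.range (pullback.diagonal c) = q '' (Set.range (pullback.diagonal b)) := by
    rw [← Set.range_comp]
    change _ = Set.range (fun x => q (pullback.diagonal b x))
    have e' x : q (pullback.diagonal b x) = pullback.diagonal c (π x) := congr($e x)
    simp only [e']
    exact (π.surjective.range_comp (pullback.diagonal c)).symm
  rw [this]
  exact q.isClosedMap _ (pullback.diagonal b).isClosedEmbedding.isClosed_range
end

/-! ### Standard charts of projective space and base change. -/

section
open MvPolynomial HomogeneousLocalization

variable {n : ℕ}

lemma eval₂_mul_of_isHomogeneous {σ R L : Type*} [CommRing R] [CommRing L] {f : MvPolynomial σ R}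
    {n : ℕ} (hf : f.IsHomogeneous n) (φ : R →+* L) (a : σ → L) (c : L) :
    eval₂ φ (fun j => a j * c) f = eval₂ φ a f * c ^ n := by
  rw [eval₂_eq, eval₂_eq, Finset.sum_mul]
  refine Finset.sum_congr rfl fun d hd => ?_
  have : d.degree = n := by
    by_contra h
    exact (mem_support_iff.mp hd) (hf.coeff_eq_zero h)
  simp_rw [mul_pow, Finset.prod_mul_distrib, Finset.prod_pow_eq_pow_sum, mul_assoc]
  rw [← this]; rfl

variable {R : Type u} [CommRing R]

/-- The coefficient map into the degree zero part of a localization of the polynomial ring. -/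
def awayC (s : MvPolynomial (Fin (n + 1)) R) :
    R →+* Away (homogeneousSubmodule (Fin (n + 1)) R) s :=
  (fromZeroRingHom _ _).comp (algebraMap R (homogeneousSubmodule (Fin (n + 1)) R 0))

lemma X_mem (i : Fin (n + 1)) : (X i : MvPolynomial (Fin (n + 1)) R) ∈
    homogeneousSubmodule (Fin (n + 1)) R 1 := isHomogeneous_X R i

/-- The coordinate function `x_j / x_i`. -/
def awayX (i j : Fin (n + 1)) :
    Away (homogeneousSubmodule (Fin (n + 1)) R) (X i) :=
  Away.mk _ (X_mem i) 1 (X j) (X_mem j)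

lemma val_awayC (s : MvPolynomial (Fin (n + 1)) R) (r : R) :
    (awayC s r).val = algebraMap (MvPolynomial (Fin (n + 1)) R) (Localization.Away s) (C r) := by
  rw [← Localization.mk_one_eq_algebraMap]
  rfl

/-- Dehomogenization: a fraction of degree zero is a polynomial in the coordinates x_j / x_i. So the
chart ring is generated by these coordinates over `R`. -/
lemma away_mk_eq_eval₂ (i : Fin (n + 1)) (d : ℕ) (f : MvPolynomial (Fin (n + 1)) R)
    (hf : f ∈ homogeneousSubmodule (Fin (n + 1)) R (d • 1)) :
    Away.mk _ (X_mem i) d f hf = eval₂ (awayC (X i)) (awayX i) f := by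
  apply val_injective
  let L := Localization.Away (X i : MvPolynomial (Fin (n + 1)) R)
  have e : (eval₂ (awayC (X i)) (awayX i) f).val =
      algebraMap (Away (homogeneousSubmodule (Fin (n + 1)) R) (X i)) L
        (eval₂ (awayC (X i)) (awayX i) f) := rfl
  rw [e, hom_eval₂]
  let c : L := Localization.mk 1 ⟨X i, Submonoid.mem_powers _⟩
  have hX : (fun j => algebraMap (Away (homogeneousSubmodule (Fin (n + 1)) R) (X i)) L (awayX i j)) =
      fun j => algebraMap (MvPolynomial (Fin (n + 1)) R) L (X j) * c := by
    ext j
    change (awayX i j).val = _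
    rw [awayX, Away.val_mk, ← Localization.mk_one_eq_algebraMap, Localization.mk_mul]
    simp
  have hC : (algebraMap (Away (homogeneousSubmodule (Fin (n + 1)) R) (X i)) L).comp (awayC (X i)) =
      (algebraMap (MvPolynomial (Fin (n + 1)) R) L).comp C := by
    ext r
    exact val_awayC _ _
  have hf' : f.IsHomogeneous d := by simpa using hf
  have h1 : eval₂ ((algebraMap (MvPolynomial (Fin (n + 1)) R) L).comp C)
      (fun j => algebraMap (MvPolynomial (Fin (n + 1)) R) L (X j)) f = algebraMap _ L f := by
    have := hom_eval₂ f C (algebraMap (MvPolynomial (Fin (n + 1)) R) L) X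
    rw [eval₂_eta] at this
    exact this.symm
  rw [hX, hC, eval₂_mul_of_isHomogeneous hf', h1, Away.val_mk, ← Localization.mk_one_eq_algebraMap,
    Localization.mk_pow, Localization.mk_mul]
  simp

lemma away_hom_ext {i : Fin (n + 1)} {T : Type*} [CommRing T]
    {a b : Away (homogeneousSubmodule (Fin (n + 1)) R) (X i) →+* T}
    (hC : a.comp (awayC (X i)) = b.comp (awayC (X i))) (hX : ∀ j, a (awayX i j) = b (awayX i j)) :
    a = b := by
  ext x
  obtain ⟨d, f, hf, rfl⟩ := x.mk_surjective _ (X_mem i)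
  rw [away_mk_eq_eval₂, hom_eval₂, hom_eval₂, hC]
  congr 1
  ext j
  exact hX j

/-- With `away_hom_ext` this gives the chart ring the universal property of a polynomial ring in the
coordinates x_j / x_i, subject to x_i / x_i = 1. -/
lemma exists_away_lift (i : Fin (n + 1)) {T : Type u} [CommRing T] (φ : R →+* T)
    (g : Fin (n + 1) → T) (hg1 : g i = 1) :
    ∃ a : Away (homogeneousSubmodule (Fin (n + 1)) R) (X i) →+* T,
      a.comp (awayC (X i)) = φ ∧ ∀ j, a (awayX i j) = g j := by
  let L := Localization.Away (X i : MvPolynomial (Fin (n + 1)) R)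
  let l : L →+* T := IsLocalization.Away.lift (X i) (g := eval₂Hom φ g) (by simp [hg1])
  have hl (x : MvPolynomial (Fin (n + 1)) R) : l (algebraMap _ L x) = eval₂Hom φ g x := IsLocalization.Away.lift_eq _ _ _
  refine ⟨l.comp (algebraMap (Away (homogeneousSubmodule (Fin (n + 1)) R) (X i)) L), ?_, fun j => ?_⟩
  · ext r
    change l (awayC (X i) r).val = _
    rw [val_awayC, hl]; simp
  · change l (awayX i j).val = _
    have h1 : (awayX i j).val * algebraMap _ L (X i : MvPolynomial (Fin (n + 1)) R) =
        algebraMap _ L (X j : MvPolynomial (Fin (n + 1)) R) := by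
      rw [awayX, Away.val_mk, ← Localization.mk_one_eq_algebraMap,
        ← Localization.mk_one_eq_algebraMap, Localization.mk_mul, Localization.mk_eq_mk_iff,
        Localization.r_iff_exists]
      exact ⟨1, by simp; ring⟩
    have h2 := congr_arg l h1
    rw [map_mul, hl, hl] at h2
    simpa [hg1] using h2

variable {B : Type u} [CommRing B] (φ : R →+* B)

/-- The graded ring homomorphism induced by a homomorphism of coefficients. -/
def gradedMap (n : ℕ) : GradedRingHom (homogeneousSubmodule (Fin (n + 1)) R)
    (homogeneousSubmodule (Fin (n + 1)) B) where
  toRingHom := MvPolynomial.map φ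
  map_mem h := IsHomogeneous.map h φ

lemma gradedMap_apply (f) : gradedMap φ n f = MvPolynomial.map φ f := rfl

lemma mem_span_X_of_isHomogeneous {d : ℕ} (hd : 0 < d) (f : MvPolynomial (Fin (n + 1)) R)
    (hf : f.IsHomogeneous d) : f ∈ Ideal.span (Set.range (X : Fin (n + 1) → _)) := by
  rw [← Set.image_univ, mem_ideal_span_X_image]
  intro m hm
  by_contra! h
  have : m.degree = d := by
    by_contra h
    exact (mem_support_iff.mp hm) (hf.coeff_eq_zero h)
  have hm0 : m = 0 := by ext i; exact h i trivial
  rw [hm0] at this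
  simp at this
  omega

lemma irrelevant_le_span_X :
    (HomogeneousIdeal.irrelevant (homogeneousSubmodule (Fin (n + 1)) R)).toIdeal ≤
      Ideal.span (Set.range X) := by
  rw [HomogeneousIdeal.toIdeal_irrelevant_le]
  intro d hd f hf
  exact mem_span_X_of_isHomogeneous hd f hf

/-- This makes the morphism of homogeneous spectra induced by `φ` defined everywhere. -/
lemma irrelevant_le_map :
    HomogeneousIdeal.irrelevant (homogeneousSubmodule (Fin (n + 1)) B) ≤
      (HomogeneousIdeal.irrelevant (homogeneousSubmodule (Fin (n + 1)) R)).map (gradedMap φ n) := by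
  rw [← toIdeal_le_toIdeal_iff]
  refine irrelevant_le_span_X.trans ?_
  rw [Ideal.span_le]
  rintro _ ⟨j, rfl⟩
  have : (X j : MvPolynomial (Fin (n + 1)) B) = gradedMap φ n (X j) := by
    rw [gradedMap_apply, map_X]
  rw [this]
  refine Ideal.mem_map_of_mem _ ?_
  exact HomogeneousIdeal.mem_irrelevant_of_mem _ one_pos (X_mem j)

/-- The morphism of projective spaces induced by a ring homomorphism. -/
def projectiveSpace.map (n : ℕ) (φ : R →+* B) : projectiveSpace n B ⟶ projectiveSpace n R :=
  Proj.map (gradedMap φ n) (irrelevant_le_map φ)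

/-- Both chart rings are determined by constants and coordinates, so a morphism from the larger one
amounts to new constants with the same coordinates. -/
lemma isPushout_away (i : Fin (n + 1)) :
    IsPushout (CommRingCat.ofHom (awayC (R := R) (X i : MvPolynomial (Fin (n + 1)) R)))
      (CommRingCat.ofHom φ)
      (CommRingCat.ofHom (Away.map (gradedMap φ n) (X i)))
      (CommRingCat.ofHom (awayC (R := B) (gradedMap φ n (X i)))) := by
  -- The denominator `gradedMap φ n (X i)` equals `X i` but occurs in a dependent type; a variable
  -- `s` allows substitution.
  have key : ∀ (s : MvPolynomial (Fin (n + 1)) B) (_ : s = X i)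
      (a : Away (homogeneousSubmodule (Fin (n + 1)) R) (X i) →+*
        Away (homogeneousSubmodule (Fin (n + 1)) B) s), a.comp (awayC (X i)) = (awayC s).comp φ →
      (∀ j, (a (awayX i j)).val = Localization.mk (X j) ⟨s, Submonoid.mem_powers _⟩) →
      IsPushout (CommRingCat.ofHom (awayC (R := R) (X i : MvPolynomial (Fin (n + 1)) R)))
        (CommRingCat.ofHom φ) (CommRingCat.ofHom a) (CommRingCat.ofHom (awayC (R := B) s)) := by
    rintro s rfl a ha1 ha2
    have ha3 j : a (awayX i j) = awayX i j := by
      apply val_injective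
      rw [ha2, awayX, Away.val_mk]
      congr 2
      simp
    have hX1 : (awayX i i : Away (homogeneousSubmodule (Fin (n + 1)) R) (X i)) = 1 := by
      apply val_injective
      rw [awayX, Away.val_mk, val_one, Localization.mk_eq_monoidOf_mk']
      simp
    have hl (c : PushoutCocone (CommRingCat.ofHom (awayC (R := R) (X i : MvPolynomial (Fin (n + 1)) R)))
        (CommRingCat.ofHom φ)) := exists_away_lift i c.inr.hom (fun j => c.inl (awayX i j))
        (by rw [hX1]; exact map_one c.inl.hom)
    refine ⟨⟨CommRingCat.hom_ext ha1⟩, ⟨PushoutCocone.IsColimit.mk _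
      (fun c => CommRingCat.ofHom (hl c).choose) (fun c => ?_) (fun c => ?_) (fun c d hd hd' => ?_)⟩⟩
    · apply CommRingCat.hom_ext
      apply away_hom_ext
      · ext r
        have h1 := congr($(ha1) r)
        have h2 := congr($((hl c).choose_spec.1) (φ r))
        have h3 := congr($(c.condition) r)
        change (hl c).choose (a (awayC (X i) r)) = c.inl (awayC (X i) r)
        exact (congr((hl c).choose $h1)).trans (h2.trans h3.symm)
      · intro j
        change (hl c).choose (a (awayX i j)) = _
        rw [ha3]
        exact (hl c).choose_spec.2 j
    · ext r
      exact congr($((hl c).choose_spec.1) r)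
    · apply CommRingCat.hom_ext
      apply away_hom_ext
      · refine Eq.trans ?_ (hl c).choose_spec.1.symm
        exact congr(($hd').hom)
      · intro j
        refine Eq.trans ?_ ((hl c).choose_spec.2 j).symm
        rw [← hd]
        exact congr(d $(ha3 j)).symm
  refine key _ (by rw [gradedMap_apply, map_X]) _ ?_ fun j => ?_
  · ext r
    refine Eq.trans ?_ (val_awayC _ _).symm
    rw [← Localization.mk_one_eq_algebraMap]
    refine Eq.trans (b := Localization.mk (MvPolynomial.map φ (C r)) 1) ?_ (by rw [map_C])
    refine Eq.trans (b := Localization.mk (MvPolynomial.map φ (C r))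
      (⟨MvPolynomial.map φ 1, 0, by rw [map_one]; exact pow_zero _⟩ :
        Submonoid.powers (gradedMap φ n (X i)))) rfl ?_
    exact congr_arg₂ Localization.mk rfl (Subtype.ext (map_one _))
  · rw [awayX, Away.map_mk, Away.val_mk]
    exact congr_arg₂ Localization.mk (map_X φ j) (Subtype.ext (pow_one _))

lemma awayι_toSpec (s : MvPolynomial (Fin (n + 1)) R) {d : ℕ}
    (hs : s ∈ homogeneousSubmodule (Fin (n + 1)) R d) (hd : 0 < d) :
    Proj.awayι _ s hs hd ≫ projectiveSpace.toSpec n R = Spec.map (CommRingCat.ofHom (awayC s)) := by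
  unfold projectiveSpace.toSpec
  refine (Proj.awayι_toSpecZero_assoc ..).trans ?_
  rw [← Spec.map_comp]; rfl

/-- Being a pullback is local on ℙⁿ over `R`; on each standard chart it is the pushout of chart
rings. -/
theorem projectiveSpace.isPullback_map (n : ℕ) (φ : R →+* B) :
    IsPullback (projectiveSpace.map n φ) (projectiveSpace.toSpec n B) (projectiveSpace.toSpec n R)
      (Spec.map (CommRingCat.ofHom φ)) := by
  let 𝒰 := (Proj.affineOpenCoverOfIrrelevantLESpan (homogeneousSubmodule (Fin (n + 1)) R) X X_mem
    (fun _ => one_pos) irrelevant_le_span_X).openCover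
  refine Scheme.isPullback_of_openCover _ _ _ _ 𝒰 fun (i : Fin (n + 1)) => ?_
  have hsq := Proj.awayι_comp_map (gradedMap φ n) (irrelevant_le_map φ) one_pos (X i) (X_mem i)
  have h1 : IsPullback (Spec.map (CommRingCat.ofHom (Away.map (gradedMap φ n) (X i))))
      (Proj.awayι _ (gradedMap φ n (X i)) ((gradedMap φ n).map_mem (X_mem i)) one_pos)
      (Proj.awayι _ (X i) (X_mem i) one_pos) (projectiveSpace.map n φ) := by
    refine IsOpenImmersion.isPullback _ _ _ _ hsq ?_
    rw [Proj.opensRange_awayι, Proj.opensRange_awayι]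
    rfl
  have h2 := isPullback_SpecMap_of_isPushout _ _ _ _ (isPushout_away (n := n) φ i)
  have h2' : IsPullback (Spec.map (CommRingCat.ofHom (Away.map (gradedMap φ n) (X i))))
      (Proj.awayι _ (gradedMap φ n (X i)) ((gradedMap φ n).map_mem (X_mem i)) one_pos ≫
        projectiveSpace.toSpec n B) (Proj.awayι _ (X i) (X_mem i) one_pos ≫
        projectiveSpace.toSpec n R) (Spec.map (CommRingCat.ofHom φ)) := by
    rw [awayι_toSpec, awayι_toSpec]
    exact h2
  refine h2'.of_iso (h1.flip.isoPullback) (Iso.refl _) (Iso.refl _) (Iso.refl _) ?_ ?_ ?_ ?_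
  · refine (Category.comp_id _).trans ?_
    exact h1.flip.isoPullback_hom_snd.symm
  · refine (Category.comp_id _).trans ?_
    change _ = _ ≫ pullback.fst _ (Proj.awayι _ (X i) (X_mem i) one_pos) ≫ projectiveSpace.toSpec n B
    exact (h1.flip.isoPullback_hom_fst_assoc _).symm
  · exact (Category.comp_id _).trans (Category.id_comp _).symm
  · simp

end

/-! ### Finite sets of points in affine opens of quasi-projective schemes. -/

section
variable {A σ : Type u} [CommRing A] [SetLike σ A] [AddSubgroupClass σ A] (𝒜 : ℕ → σ) [GradedRing 𝒜]

lemma exists_homogeneous_mem_not_mem {I : HomogeneousIdeal 𝒜} {J : Ideal A}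
    (h : ¬ I.toIdeal ≤ J) : ∃ d, ∃ a ∈ 𝒜 d, a ∈ I ∧ a ∉ J := by
  by_contra! hc
  apply h
  intro a ha
  classical
  rw [← DirectSum.sum_support_decompose 𝒜 a]
  exact Ideal.sum_mem _ fun d _ => hc d _ (SetLike.coe_mem _) (I.isHomogeneous d ha)

/-- Some homogeneous component of g does not vanish at t. It is multiplied by an element of positive
degree not vanishing at t, which exists because t does not contain the irrelevant ideal. -/
lemma exists_homogeneous_pos_basicOpen (t : Proj 𝒜) (U : (Proj 𝒜).Opens) (ht : t ∈ U) :
    ∃ d, 0 < d ∧ ∃ f ∈ 𝒜 d, t ∈ Proj.basicOpen 𝒜 f ∧ Proj.basicOpen 𝒜 f ≤ U := by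
  obtain ⟨_, ⟨g, rfl⟩, htg, hgU⟩ :=
    (ProjectiveSpectrum.isTopologicalBasis_basic_opens 𝒜).exists_subset_of_mem_open ht U.2
  obtain ⟨e, he⟩ : ∃ e, ¬ (GradedRing.proj 𝒜 e g) ∈ t.asHomogeneousIdeal := by
    by_contra! hc
    apply htg
    classical
    change g ∈ t.asHomogeneousIdeal.toIdeal
    rw [← DirectSum.sum_support_decompose 𝒜 g]
    exact Ideal.sum_mem _ fun d _ => hc d
  obtain ⟨d, hd, h, hh, hht⟩ : ∃ d, 0 < d ∧ ∃ h ∈ 𝒜 d, h ∉ t.asHomogeneousIdeal := by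
    by_contra! hc
    apply t.not_irrelevant_le
    rw [HomogeneousIdeal.irrelevant_le]
    intro i hi x hx
    exact hc i hi x hx
  have := t.isPrime
  refine ⟨e + d, by omega, GradedRing.proj 𝒜 e g * h,
    SetLike.mul_mem_graded (SetLike.coe_mem _) hh, ?_, ?_⟩
  · rw [Proj.mem_basicOpen]
    intro hm
    rcases (this.mem_or_mem hm) with h' | h'
    · exact he h'
    · exact hht h'
  · refine le_trans ?_ (show Proj.basicOpen 𝒜 g ≤ U from hgU)
    rw [Proj.basicOpen_mul]
    refine inf_le_left.trans ?_
    rw [Proj.basicOpen_eq_iSup_proj 𝒜 g]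
    exact le_iSup (fun i => Proj.basicOpen 𝒜 (GradedRing.proj 𝒜 i g)) e

/-- Homogeneous prime avoidance, by induction on the number of points. The point t removed has a
minimal prime, so some form vanishes at all the other points but not at t. -/
lemma exists_homogeneous_basicOpen_of_finset (T : Finset (Proj 𝒜)) (U : (Proj 𝒜).Opens)
    (hT : ∀ t ∈ T, t ∈ U) : ∃ d, 0 < d ∧ ∃ f ∈ 𝒜 d,
      (∀ t ∈ T, t ∈ Proj.basicOpen 𝒜 f) ∧ Proj.basicOpen 𝒜 f ≤ U := by
  classical
  induction hn : T.card using Nat.strong_induction_on generalizing T with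
  | _ n ih =>
  rcases T.eq_empty_or_nonempty with rfl | hne
  · exact ⟨1, one_pos, 0, zero_mem _, by simp, by rw [Proj.basicOpen_zero]; exact bot_le⟩
  let P : Proj 𝒜 → Ideal A := fun t => t.asHomogeneousIdeal.toIdeal
  obtain ⟨t, ht, hmin⟩ := T.exists_minimalFor P hne
  obtain ⟨d, hd, f, hf, hfT, hfU⟩ := ih _ (by rw [← hn]; exact Finset.card_erase_lt_of_mem ht)
    (T.erase t) (fun t' h => hT _ (Finset.mem_of_mem_erase h)) rfl
  by_cases htf : t ∈ Proj.basicOpen 𝒜 f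
  · refine ⟨d, hd, f, hf, fun t' ht' => ?_, hfU⟩
    by_cases h : t' = t
    · rwa [h]
    · exact hfT _ (Finset.mem_erase.mpr ⟨h, ht'⟩)
  obtain ⟨e, he, h, hh, hth, hhU⟩ := exists_homogeneous_pos_basicOpen 𝒜 t U (hT t ht)
  have hex (t' : Proj 𝒜) : ∃ d, ∃ a ∈ 𝒜 d, t' ∈ T.erase t → a ∈ P t' ∧ a ∉ P t := by
    by_cases ht' : t' ∈ T.erase t
    · have : ¬ P t' ≤ P t := fun hle => by
        have := le_antisymm hle (hmin (Finset.mem_of_mem_erase ht') hle)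
        refine (Finset.ne_of_mem_erase ht') ?_
        apply ProjectiveSpectrum.ext
        exact HomogeneousIdeal.toIdeal_injective this
      obtain ⟨d, a, ha, h1, h2⟩ := exists_homogeneous_mem_not_mem 𝒜 this
      exact ⟨d, a, ha, fun _ => ⟨h1, h2⟩⟩
    · exact ⟨0, 0, zero_mem _, fun h => absurd h ht'⟩
  choose c a ha hat using hex
  let g := h * ∏ t' ∈ T.erase t, a t'
  let D := e + ∑ t' ∈ T.erase t, c t'
  have hg : g ∈ 𝒜 D := SetLike.mul_mem_graded hh (SetLike.prod_mem_graded 𝒜 c a fun i _ => ha i)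
  have hP (t : Proj 𝒜) : (P t).IsPrime := t.isPrime
  have hgt : g ∉ P t := by
    intro hm
    rcases (hP t).mem_or_mem hm with h' | h'
    · exact hth h'
    · obtain ⟨t', ht', h''⟩ := ((hP t).prod_mem_iff).mp h'
      exact (hat t' ht').2 h''
  have hgt' t' (ht' : t' ∈ T.erase t) : g ∈ P t' :=
    Ideal.mul_mem_left _ _ (Ideal.mem_of_dvd _ (Finset.dvd_prod_of_mem a ht') (hat t' ht').1)
  have hDpos : 0 < D := by omega
  have hft : f ∈ P t := by_contra fun hc => htf hc
  -- If f fails at t, the powers bring f and g to the same degree. At t only g is nonzero, at the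
  -- other points only f is, and the basic open of the sum lies in those of f and h.
  refine ⟨D * d, Nat.mul_pos hDpos hd, f ^ D + g ^ d, ?_, ?_, ?_⟩
  · refine add_mem ?_ ?_
    · have := SetLike.pow_mem_graded D hf
      simpa using this
    · have := SetLike.pow_mem_graded d hg
      rw [smul_eq_mul, mul_comm] at this
      exact this
  · intro t' ht'
    rw [Proj.mem_basicOpen]
    intro hm
    change f ^ D + g ^ d ∈ P t' at hm
    by_cases h : t' = t
    · subst h
      rw [Ideal.add_mem_iff_right _ (Ideal.pow_mem_of_mem _ hft _ hDpos)] at hm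
      exact hgt ((hP _).mem_of_pow_mem _ hm)
    · have ht'' := Finset.mem_erase.mpr ⟨h, ht'⟩
      rw [Ideal.add_mem_iff_left _ (Ideal.pow_mem_of_mem _ (hgt' _ ht'') _ hd)] at hm
      exact hfT _ ht'' ((hP _).mem_of_pow_mem _ hm)
  · intro x hx
    by_cases hxf : x ∈ Proj.basicOpen 𝒜 f
    · exact hfU hxf
    · apply hhU
      intro hxh
      apply hx
      have h1 : f ∈ P x := by_contra fun hc => hxf hc
      change f ^ D + g ^ d ∈ P x
      exact add_mem (Ideal.pow_mem_of_mem _ h1 _ hDpos)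
        (Ideal.pow_mem_of_mem _ (Ideal.mul_mem_right _ _ hxh) _ hd)

/-- The immersion is closed in its coborder, an open subset. A basic open inside the coborder
containing the given points is affine and pulls back to an affine open of X. -/
theorem affineFinite_of_isImmersion {X : Scheme.{u}} (i : X ⟶ Proj 𝒜) [IsImmersion i] :
    AffineFinite X := by
  classical
  intro s hs
  obtain ⟨d, hd, f, hf, hfT, hfU⟩ := exists_homogeneous_basicOpen_of_finset 𝒜
    (hs.image i).toFinset i.coborderRange (fun t ht => by
      obtain ⟨x, -, rfl⟩ := (Set.Finite.mem_toFinset _).mp ht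
      exact subset_coborder ⟨x, rfl⟩)
  refine ⟨i ⁻¹ᵁ Proj.basicOpen 𝒜 f, ?_, fun x hx => hfT _
    ((Set.Finite.mem_toFinset _).mpr ⟨x, hx, rfl⟩)⟩
  rw [← i.liftCoborder_ι, Scheme.Hom.comp_preimage]
  refine IsAffineOpen.preimage ?_ _
  refine (Proj.isAffineOpen_basicOpen 𝒜 f hf hd).preimage_of_isOpenImmersion _ ?_
  rw [Scheme.Opens.opensRange_ι]
  exact hfU

end

theorem AffineFinite.pullback {X Y S : Scheme.{u}} (f : X ⟶ S) (g : Y ⟶ S) [IsAffine S]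
    (hX : AffineFinite X) (hY : AffineFinite Y) : AffineFinite (pullback f g) := by
  intro s hs
  obtain ⟨U, hU, hsU⟩ := hX _ (hs.image (pullback.fst f g))
  obtain ⟨V, hV, hsV⟩ := hY _ (hs.image (pullback.snd f g))
  have : IsAffine U := hU
  have : IsAffine V := hV
  let j : Limits.pullback (U.ι ≫ f) (V.ι ≫ g) ⟶ Limits.pullback f g :=
    pullback.map _ _ _ _ U.ι V.ι (𝟙 S) (by simp) (by simp)
  refine ⟨j.opensRange, isAffineOpen_opensRange j, fun x hx => ?_⟩
  change x ∈ Set.range j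
  rw [Scheme.Pullback.range_map]
  exact ⟨by simpa using hsU ⟨x, hx, rfl⟩, by simpa using hsV ⟨x, hx, rfl⟩⟩

/-! ### Descent of immersions to finitely generated coefficients. -/

lemma le_preimage_top {X Y : Scheme.{u}} (f : X ⟶ Y) (U : X.Opens) : U ≤ f ⁻¹ᵁ ⊤ := le_top

section
variable {R : Type u} [CommRing R] {X : Scheme.{u}} (f : X ⟶ Spec (.of R))

/-- The constants of `R`, as functions on an open subset of an `R`-scheme. -/
def constMap (U : X.Opens) : R →+* Γ(X, U) :=
  ((Scheme.ΓSpecIso (.of R)).inv ≫ f.appLE ⊤ U (le_preimage_top f U)).hom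

lemma appLE_constMap {R' : Type u} [CommRing R'] {X' : Scheme.{u}} (f' : X' ⟶ Spec (.of R'))
    (q : X' ⟶ X) (b : R →+* R') (h : q ≫ f = f' ≫ Spec.map (CommRingCat.ofHom b))
    (U : X.Opens) (U' : X'.Opens) (e : U' ≤ q ⁻¹ᵁ U) (r : R) :
    q.appLE U U' e (constMap f U r) = constMap f' U' (b r) := by
  have : ((Scheme.ΓSpecIso (.of R)).inv ≫ f.appLE ⊤ U (le_preimage_top f U)) ≫ q.appLE U U' e =
      CommRingCat.ofHom b ≫ ((Scheme.ΓSpecIso (.of R')).inv ≫ f'.appLE ⊤ U' (le_preimage_top f' U')) := by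
    rw [Category.assoc, Scheme.Hom.appLE_comp_appLE, Scheme.ΓSpecIso_inv_naturality_assoc]
    congr 1
    simp only [h]
    rw [Scheme.Hom.appTop, Scheme.Hom.app_eq_appLE]
    exact (Scheme.Hom.appLE_comp_appLE ..).symm
  exact congr($this r)
end

open TensorProduct in
lemma exists_sum_of_isPushout {A B A' B' : CommRingCat.{u}} {i : A ⟶ B} {f : A ⟶ A'} {k : B ⟶ B'}
    {i' : A' ⟶ B'} (h : IsPushout i f k i') (x : B') :
    ∃ (s : Finset (B × A')), x = ∑ p ∈ s, k p.1 * i' p.2 := by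
  classical
  algebraize [i.hom, f.hom]
  have hp := CommRingCat.isPushout_tensorProduct A B A'
  let e : CommRingCat.of (TensorProduct A B A') ≅ B' := hp.isoIsPushout _ _ h
  have e1 : CommRingCat.ofHom Algebra.TensorProduct.includeLeftRingHom ≫ e.hom = k :=
    hp.inl_isoIsPushout_hom _ _ h
  have e2 : CommRingCat.ofHom (Algebra.TensorProduct.includeRight (R := A) (A := B) (B := A')).toRingHom
      ≫ e.hom = i' := hp.inr_isoIsPushout_hom _ _ h
  obtain ⟨x, rfl⟩ := (ConcreteCategory.bijective_of_isIso e.hom).2 x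
  obtain ⟨s, rfl⟩ := TensorProduct.exists_finset (R := A) (M := B) (N := A') x
  refine ⟨s, ?_⟩
  refine (map_sum e.hom.hom _ _).trans (Finset.sum_congr rfl fun c _ => ?_)
  rw [show c.1 ⊗ₜ[A] c.2 = (c.1 ⊗ₜ[A] (1 : A')) * ((1 : B) ⊗ₜ[A] c.2) by simp]
  exact (map_mul e.hom.hom _ _).trans (congr_arg₂ _ congr($e1 c.1) congr($e2 c.2))

section
variable {R₀ K : Type u} [CommRing R₀] [CommRing K] (φ : R₀ →+* K) {P₀ P : Scheme.{u}}
  {p₀ : P₀ ⟶ Spec (.of R₀)} {p : P ⟶ Spec (.of K)} {q₀ : P ⟶ P₀}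

/-- A section of the base change is a finite sum of products of sections of `P₀` with constants from
`K`. Once the finitely many constants lie in an intermediate ring, the section comes from there. -/
lemma exists_finite_coeff (sq : IsPullback q₀ p p₀ (Spec.map (CommRingCat.ofHom φ)))
    {U : P₀.Opens} (hU : IsAffineOpen U) (x : Γ(P, q₀ ⁻¹ᵁ U)) :
    ∃ T : Set K, T.Finite ∧ ∀ {R₁ : Type u} [CommRing R₁] (b : R₁ →+* K), T ⊆ Set.range b →
      ∀ {P₁ : Scheme.{u}} (p₁ : P₁ ⟶ Spec (.of R₁)) (q : P ⟶ P₁) (q' : P₁ ⟶ P₀),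
      q ≫ p₁ = p ≫ Spec.map (CommRingCat.ofHom b) → ∀ h : q ≫ q' = q₀,
      ∃ y, q.appLE (q' ⁻¹ᵁ U) (q₀ ⁻¹ᵁ U) (by rw [← h]; rfl) y = x := by
  have hpo := (isIso_pushoutSection_iff sq (US := ⊤) (UT := ⊤) (UX := U) le_top le_top
    (UY := q₀ ⁻¹ᵁ U) (by simp)).mp (isIso_pushoutSection_of_isAffineOpen _ _ _ _
      (isAffineOpen_top _) (isAffineOpen_top _) hU)
  obtain ⟨s, hs⟩ := exists_sum_of_isPushout hpo x
  refine ⟨(fun c : Γ(P₀, U) × Γ(Spec (.of K), ⊤) => (Scheme.ΓSpecIso (.of K)).hom c.2) '' s,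
    s.finite_toSet.image _, ?_⟩
  intro R₁ _ b hb P₁ p₁ q q' h1 h
  have hex (c : Γ(P₀, U) × Γ(Spec (.of K), ⊤)) :
      ∃ r, c ∈ s → b r = (Scheme.ΓSpecIso (.of K)).hom c.2 := by
    by_cases hc : c ∈ s
    · obtain ⟨r, hr⟩ := hb ⟨c, hc, rfl⟩
      exact ⟨r, fun _ => hr⟩
    · exact ⟨0, fun h => absurd h hc⟩
  choose r hr using hex
  refine ⟨∑ c ∈ s, q'.app U c.1 * constMap p₁ (q' ⁻¹ᵁ U) (r c), ?_⟩
  rw [hs, map_sum]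
  refine Finset.sum_congr rfl fun c hc => ?_
  rw [map_mul]
  congr 1
  · have : q'.app U ≫ q.appLE (q' ⁻¹ᵁ U) (q₀ ⁻¹ᵁ U) (by rw [← h]; rfl) = q₀.appLE U _ le_rfl := by
      subst h
      rw [Scheme.Hom.app_eq_appLE, Scheme.Hom.appLE_comp_appLE]
    exact congr($this c.1)
  · rw [appLE_constMap p₁ p q b h1, hr c hc]
    change p.appLE _ _ _ ((Scheme.ΓSpecIso (.of K)).inv ((Scheme.ΓSpecIso (.of K)).hom c.2)) = _
    congr 1
    exact congr($((Scheme.ΓSpecIso (.of K)).hom_inv_id) c.2)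
end

/-- Descent of an immersion along an affine morphism `q`, when the ideal of the closure and the
complementary open set come from the target of `q`. -/
lemma exists_isPullback_of_isImmersion {X P P' : Scheme.{u}} (q : P ⟶ P') [IsAffineHom q]
    (i : X ⟶ P) [IsImmersion i] [QuasiCompact i] {ι : Type*} (U : ι → P'.affineOpens)
    (hU : ⨆ j, (U j).1 = ⊤)
    (hi : ∀ j, i.ker.ideal ⟨q ⁻¹ᵁ U j, (U j).2.preimage q⟩ ≤
      Ideal.span (Set.range (q.app (U j)) ∩ i.ker.ideal ⟨q ⁻¹ᵁ U j, (U j).2.preimage q⟩))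
    (V : P'.Opens) (hV : i.toImage.opensRange = i.imageι ⁻¹ᵁ q ⁻¹ᵁ V) :
    ∃ (X' : Scheme.{u}) (i' : X' ⟶ P') (g : X ⟶ X'), IsImmersion i' ∧ IsPullback g i i' q := by
  let J := i.ker.map q
  -- The ideal of the closure is generated by sections coming from `P'`, so the closure is the base
  -- change of the closed subscheme cut out by `J`.
  have hJ : J.comap q = i.ker := by
    refine le_antisymm (Scheme.IdealSheafData.comap_map_le _ _) ?_
    refine Scheme.IdealSheafData.le_of_iSup_eq_top
      (fun j => ⟨q ⁻¹ᵁ U j, (U j).2.preimage q⟩) ?_ fun j => ?_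
    · change ⨆ j, q ⁻¹ᵁ (U j).1 = ⊤
      rw [← Scheme.Hom.preimage_iSup, hU, Scheme.Hom.preimage_top]
    · refine (hi j).trans (Ideal.span_le.mpr ?_)
      rintro _ ⟨⟨y, rfl⟩, hy⟩
      have h1 : y ∈ J.ideal (U j) := by
        rw [Scheme.IdealSheafData.ideal_map_of_isAffineHom]
        exact hy
      have h2 := Scheme.IdealSheafData.le_map_comap J q (U j) h1
      rw [Scheme.IdealSheafData.ideal_map_of_isAffineHom] at h2
      exact h2
  let Zf : i.image ⟶ J.subscheme := Scheme.IdealSheafData.subschemeMap _ _ q le_rfl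
  have sq : IsPullback i.imageι Zf q J.subschemeι :=
    AlgebraicGeometry.isPullback_of_isClosedImmersion _ _ Zf q
      (Scheme.IdealSheafData.subschemeMap_subschemeι _ _ _ _).symm (by
        rw [Scheme.IdealSheafData.ker_subschemeι, hJ]
        exact (Scheme.IdealSheafData.ker_subschemeι _).symm)
  let W := J.subschemeι ⁻¹ᵁ V
  have hW : i.toImage.opensRange = Zf ⁻¹ᵁ W := by
    rw [hV, ← Scheme.Hom.comp_preimage, ← Scheme.Hom.comp_preimage, sq.w]
  let g : X ⟶ W := IsOpenImmersion.lift W.ι (i.toImage ≫ Zf) (by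
    rw [Scheme.Opens.range_ι]
    rintro _ ⟨x, rfl⟩
    have : i.toImage x ∈ i.toImage.opensRange := ⟨x, rfl⟩
    rw [hW] at this
    simpa using this)
  have sq' : IsPullback g i.toImage W.ι Zf := by
    refine IsOpenImmersion.isPullback _ _ _ _ (by simp [g]) ?_
    rw [hW, Scheme.Opens.opensRange_ι]
  refine ⟨W, W.ι ≫ J.subschemeι, g, inferInstance, ?_⟩
  have := sq'.flip.paste_horiz sq
  rw [Scheme.Hom.toImage_imageι] at this
  exact this.flip

/-- An immersion of a quasi-compact `K`-scheme into a base change `P` to `K` of a scheme of finite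
type `P₀` over `R₀` descends to every intermediate ring containing finitely many elements. -/
theorem exists_finite_descent_isImmersion {R₀ K : Type u} [CommRing R₀] [CommRing K]
    [IsNoetherianRing K] (φ : R₀ →+* K) {P₀ P X : Scheme.{u}}
    {p₀ : P₀ ⟶ Spec (.of R₀)} {p : P ⟶ Spec (.of K)} {q₀ : P ⟶ P₀}
    (sq : IsPullback q₀ p p₀ (Spec.map (CommRingCat.ofHom φ))) [LocallyOfFiniteType p₀]
    [QuasiCompact p₀] (i : X ⟶ P) [IsImmersion i] [CompactSpace X] :
    ∃ T : Set K, T.Finite ∧ ∀ {R₁ : Type u} [CommRing R₁] (b : R₁ →+* K), T ⊆ Set.range b →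
      ∀ {P₁ : Scheme.{u}} (p₁ : P₁ ⟶ Spec (.of R₁)) (q : P ⟶ P₁) (q' : P₁ ⟶ P₀),
      IsPullback q p p₁ (Spec.map (CommRingCat.ofHom b)) → q ≫ q' = q₀ → IsAffineHom q' →
      ∃ (X' : Scheme.{u}) (i' : X' ⟶ P₁) (g : X ⟶ X'), IsImmersion i' ∧ IsPullback g i i' q := by
  classical
  have : CompactSpace P₀ := (quasiCompact_iff_compactSpace (f := p₀)).mp inferInstance
  have : LocallyOfFiniteType p := MorphismProperty.of_isPullback sq inferInstance
  have : IsLocallyNoetherian P := LocallyOfFiniteType.isLocallyNoetherian p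
  have : IsAffineHom q₀ := MorphismProperty.of_isPullback sq.flip inferInstance
  let 𝒰 := P₀.affineCover.finiteSubcover
  let U (j : 𝒰.I₀) : P₀.affineOpens := ⟨(𝒰.f j).opensRange, isAffineOpen_opensRange _⟩
  have hU : ⨆ j, (U j).1 = ⊤ := 𝒰.iSup_opensRange
  have hUP j : IsAffineOpen (q₀ ⁻¹ᵁ (U j).1) := (U j).2.preimage q₀
  -- The noetherian property gives finitely many equations for the closure on each chart.
  have hgen j : ∃ G : Finset Γ(P, q₀ ⁻¹ᵁ (U j).1),
      Ideal.span (G : Set Γ(P, q₀ ⁻¹ᵁ (U j).1)) = i.ker.ideal ⟨_, hUP j⟩ := by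
    have := IsLocallyNoetherian.component_noetherian (X := P) ⟨_, hUP j⟩
    exact IsNoetherian.noetherian (i.ker.ideal ⟨_, hUP j⟩)
  choose G hG using hgen
  -- Finitely many basic opens inside the coborder cover X by compactness; they cut X out of its
  -- closure.
  have hcov (x : X) : ∃ j, ∃ s : Γ(P, q₀ ⁻¹ᵁ (U j).1), i x ∈ P.basicOpen s ∧
      P.basicOpen s ≤ i.coborderRange := by
    obtain ⟨j, hj⟩ := TopologicalSpace.Opens.mem_iSup.mp (hU.ge (Set.mem_univ (q₀ (i x))))
    obtain ⟨s, hs, hxs⟩ := (hUP j).exists_basicOpen_le (V := i.coborderRange)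
      ⟨i x, subset_coborder ⟨x, rfl⟩⟩ hj
    exact ⟨j, s, hxs, hs⟩
  choose jx s hs hs' using hcov
  obtain ⟨F, hF⟩ := CompactSpace.elim_nhds_subcover (fun x => i ⁻¹' (P.basicOpen (s x)))
    (fun x => (i ⁻¹ᵁ P.basicOpen (s x)).2.mem_nhds (hs x))
  choose T hT hT' using fun j (x : Γ(P, q₀ ⁻¹ᵁ (U j).1)) => exists_finite_coeff φ sq (U j).2 x
  refine ⟨(⋃ j, ⋃ x ∈ G j, T j x) ∪ ⋃ x ∈ F, T _ (s x), ?_, ?_⟩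
  · refine (Set.finite_iUnion fun j => (G j).finite_toSet.biUnion fun x _ => hT j x).union
      (F.finite_toSet.biUnion fun x _ => hT _ _)
  intro R₁ _ b hb P₁ p₁ q q' sq' hq hq'
  have : IsAffineHom q := MorphismProperty.of_isPullback sq'.flip inferInstance
  rw [Set.union_subset_iff] at hb
  simp only [Set.iUnion_subset_iff] at hb
  subst hq
  have hV (x : X) : ∃ y : Γ(P₁, q' ⁻¹ᵁ (U (jx x)).1), x ∈ F → q.app _ y = s x := by
    by_cases hx : x ∈ F
    · obtain ⟨y, hy⟩ := hT' _ (s x) b (hb.2 x hx) p₁ q q' sq'.w rfl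
      refine ⟨y, fun _ => ?_⟩
      rw [Scheme.Hom.app_eq_appLE]
      exact hy
    · exact ⟨0, fun h => absurd h hx⟩
  choose y hy using hV
  refine exists_isPullback_of_isImmersion q i
    (fun j => ⟨q' ⁻¹ᵁ (U j).1, (U j).2.preimage q'⟩) ?_ (fun j => ?_)
    (⨆ x : F, P₁.basicOpen (y x)) ?_
  · change ⨆ j, q' ⁻¹ᵁ (U j).1 = ⊤
    rw [← Scheme.Hom.preimage_iSup, hU, Scheme.Hom.preimage_top]
  · change i.ker.ideal ⟨_, hUP j⟩ ≤ _
    rw [← hG j]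
    refine Ideal.span_mono fun x hx => ⟨?_, (hG j).le (Ideal.subset_span hx)⟩
    obtain ⟨y, hy⟩ := hT' j x b (hb.1 j x hx) p₁ q q' sq'.w rfl
    refine ⟨y, ?_⟩
    rw [Scheme.Hom.app_eq_appLE]
    exact hy
  · have hyx (x : F) : q ⁻¹ᵁ P₁.basicOpen (y x) = P.basicOpen (s x) := by
      rw [← hy x x.2, Scheme.preimage_basicOpen]
      rfl
    rw [Scheme.Hom.preimage_iSup, Scheme.Hom.preimage_iSup]
    simp_rw [hyx]
    ext z
    simp only [Scheme.Hom.coe_opensRange, SetLike.mem_coe, Opens.mem_iSup]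
    constructor
    · rintro ⟨x', rfl⟩
      have hx' : x' ∈ ⋃ x ∈ F, i ⁻¹' (P.basicOpen (s x)) := by rw [hF]; trivial
      obtain ⟨x, hx, hxx⟩ := Set.mem_iUnion₂.mp hx'
      refine ⟨⟨x, hx⟩, ?_⟩
      change i.imageι (i.toImage x') ∈ P.basicOpen (s x)
      rw [← Scheme.Hom.comp_apply, Scheme.Hom.toImage_imageι]
      exact hxx
    · rintro ⟨x, hz⟩
      have h1 : i.imageι z ∈ coborder (Set.range i) := hs' x hz
      have h2 : i.imageι z ∈ closure (Set.range i) := by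
        have : i.imageι z ∈ Set.range i.imageι := ⟨z, rfl⟩
        rw [Scheme.IdealSheafData.range_subschemeι, Scheme.Hom.support_ker] at this
        exact this
      have h3 : i.imageι z ∈ Set.range i := by
        exact closure_inter_coborder.le ⟨h2, h1⟩
      obtain ⟨x', hx'⟩ := h3
      refine ⟨x', i.imageι.isEmbedding.injective ?_⟩
      rw [← Scheme.Hom.comp_apply, Scheme.Hom.toImage_imageι, hx']

/-! ### Normal rings of finite type over ℤ and primes of height one. -/

lemma finiteType_int_trans (B C : Type u) [CommRing B] [CommRing C] [Algebra.FiniteType ℤ B]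
    [Algebra B C] [Algebra.FiniteType B C] : Algebra.FiniteType ℤ C :=
  Algebra.FiniteType.trans (S := B) inferInstance inferInstance

/-- In characteristic zero the integral closure of `R` in the finite extension `L` is finite over
`R`. Each generator of `D` becomes integral after multiplication by a nonzero element of `R`;
inverting the product of these multipliers puts `D` inside a normal ring. -/
lemma exists_isIntegrallyClosed_of_isAlgebraic (R D F L : Type u) [CommRing R] [IsDomain R]
    [IsIntegrallyClosed R] [IsNoetherianRing R] [Algebra.FiniteType ℤ R] [CharZero R]
    [CommRing D] [IsDomain D] [Algebra R D] [Algebra.IsAlgebraic R D]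
    [Algebra.FiniteType R D] [Field F] [Algebra R F] [IsFractionRing R F] [Field L] [Algebra D L]
    [IsFractionRing D L] [Algebra R L] [Algebra F L] [IsScalarTower R F L] [IsScalarTower R D L] :
    ∃ (B : Type u) (_ : CommRing B) (_ : IsDomain B)
      (_ : IsIntegrallyClosed B) (_ : Algebra.FiniteType ℤ B) (j : B →+* L),
      Function.Injective j ∧ (algebraMap D L).range ≤ j.range := by
  classical
  have hinj : Function.Injective (algebraMap R L) := by
    rw [IsScalarTower.algebraMap_eq R F L]
    exact (algebraMap F L).injective.comp (IsFractionRing.injective R F)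
  have : FaithfulSMul R L := (faithfulSMul_iff_algebraMap_injective _ _).mpr hinj
  have : Algebra.EssFiniteType D L := Algebra.EssFiniteType.of_isLocalization L (nonZeroDivisors D)
  have : Algebra.EssFiniteType R L := Algebra.EssFiniteType.comp R D L
  have : Algebra.EssFiniteType F L := Algebra.EssFiniteType.of_comp R F L
  have halg : Algebra.IsAlgebraic R L := (IsFractionRing.isAlgebraic_iff' R D L).mp inferInstance
  have : Algebra.IsAlgebraic F L := (IsFractionRing.comap_isAlgebraic_iff (A := R)).mp halg
  have : Module.Finite F L := Algebra.finite_of_essFiniteType_of_isAlgebraic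
  have : CharZero F := charZero_of_injective_algebraMap (IsFractionRing.injective R F)
  obtain ⟨S, hS⟩ := Algebra.FiniteType.out (R := R) (A := D)
  let B₀ := integralClosure R L
  have : Module.Finite R B₀ := IsIntegralClosure.finite R F L B₀
  have : IsIntegrallyClosed B₀ := integralClosure.isIntegrallyClosedOfFiniteExtension F
  have hint (d : D) : ∃ r : R, r ≠ 0 ∧ IsIntegral R (r • algebraMap D L d) :=
    (halg.isAlgebraic (algebraMap D L d)).exists_integral_multiple
  choose r hr hrd using hint
  let s := ∏ d ∈ S, r d
  have hs : s ≠ 0 := Finset.prod_ne_zero_iff.mpr fun d _ => hr d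
  let t : B₀ := algebraMap R B₀ s
  have ht : t ≠ 0 := fun h => hs (hinj (by
    have := congr_arg (algebraMap B₀ L) h
    simpa [t, ← IsScalarTower.algebraMap_apply] using this))
  have htL : IsUnit (algebraMap B₀ L t) := by
    rw [isUnit_iff_ne_zero]
    exact fun h => ht (Subtype.val_injective h)
  have hle : Submonoid.powers t ≤ nonZeroDivisors B₀ := powers_le_nonZeroDivisors_of_noZeroDivisors ht
  have : IsDomain (Localization.Away t) := IsLocalization.isDomain_localization hle
  have : IsIntegrallyClosed (Localization.Away t) :=
    isIntegrallyClosed_of_isLocalization _ _ hle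
  have : Algebra.FiniteType ℤ B₀ := Algebra.FiniteType.trans (S := R) inferInstance inferInstance
  have : Algebra.FiniteType B₀ (Localization.Away t) := IsLocalization.finiteType_of_monoid_fg (Submonoid.powers t) (Localization.Away t)
  have := finiteType_int_trans B₀ (Localization.Away t)
  let j : Localization.Away t →+* L := IsLocalization.Away.lift t htL
  have hj (b) : j (algebraMap B₀ _ b) = algebraMap B₀ L b := IsLocalization.Away.lift_eq t htL b
  refine ⟨Localization.Away t, inferInstance, inferInstance, inferInstance, inferInstance, j, ?_, ?_⟩
  · exact (IsLocalization.lift_injective_iff _).mpr fun x y =>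
      ⟨fun h => congr_arg _ (IsLocalization.injective _ hle h),
        fun h => congr_arg _ (Subtype.val_injective h)⟩
  · rintro _ ⟨d, rfl⟩
    have hd : d ∈ Algebra.adjoin R (S : Set D) := hS ▸ trivial
    induction hd using Algebra.adjoin_induction with
    | mem d hd =>
      have : s = r d * ∏ d ∈ S.erase d, r d := (Finset.mul_prod_erase S r hd).symm
      let b : B₀ := ⟨r d • algebraMap D L d, hrd d⟩ * algebraMap R B₀ (∏ d ∈ S.erase d, r d)
      refine ⟨algebraMap B₀ _ b * IsLocalization.Away.invSelf t, ?_⟩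
      have h1 : j (IsLocalization.Away.invSelf t) * algebraMap B₀ L t = 1 := by
        rw [← hj, ← map_mul, mul_comm, IsLocalization.Away.mul_invSelf, map_one]
      apply htL.mul_right_cancel
      rw [map_mul, mul_assoc, h1, mul_one, hj]
      have h2 : algebraMap B₀ L t = algebraMap R L s := rfl
      have h3 : algebraMap B₀ L b = algebraMap R L (r d) * algebraMap D L d *
          algebraMap R L (∏ d ∈ S.erase d, r d) := by
        rw [← Algebra.smul_def]; rfl
      rw [h2, h3, this, map_mul]
      ring
    | algebraMap r =>
      refine ⟨algebraMap B₀ _ (algebraMap R B₀ r), ?_⟩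
      rw [hj, ← IsScalarTower.algebraMap_apply, ← IsScalarTower.algebraMap_apply]
    | add a b _ _ ha hb => rw [map_add]; exact add_mem ha hb
    | mul a b _ _ ha hb => rw [map_mul]; exact mul_mem ha hb

/-- A domain of characteristic zero and of finite type over `ℤ` is contained in a normal domain of
finite type over `ℤ` with the same fraction field. -/
theorem exists_isIntegrallyClosed_of_finiteType (D L : Type u) [CommRing D] [IsDomain D] [CharZero D]
    [Field L] [Algebra D L] [IsFractionRing D L]
    [Algebra.FiniteType ℤ D] : ∃ (B : Type u) (_ : CommRing B) (_ : IsDomain B)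
      (_ : IsIntegrallyClosed B) (_ : Algebra.FiniteType ℤ B) (j : B →+* L),
      Function.Injective j ∧ (algebraMap D L).range ≤ j.range := by
  obtain ⟨S, hS⟩ := Algebra.FiniteType.out (R := ℤ) (A := D)
  have : Algebra.IsAlgebraic (Algebra.adjoin ℤ (S : Set D)) D := by
    rw [hS]
    refine ⟨fun x => ?_⟩
    exact isAlgebraic_algebraMap (A := D) (⟨x, trivial⟩ : (⊤ : Subalgebra ℤ D))
  -- A transcendence basis among the generators spans a polynomial ring over ℤ, which is normal and
  -- over which D is algebraic.
  obtain ⟨T, hTS, hT⟩ := exists_isTranscendenceBasis_subset (R := ℤ) (S : Set D)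
  have hTfin : T.Finite := S.finite_toSet.subset hTS
  have : Finite T := hTfin
  let R := Algebra.adjoin ℤ (Set.range (Subtype.val : T → D))
  have : Algebra.IsAlgebraic R D := hT.isAlgebraic
  let e : MvPolynomial T ℤ ≃ₐ[ℤ] R := hT.1.aevalEquiv
  have : IsIntegrallyClosed R := IsIntegrallyClosed.of_equiv e.toRingEquiv
  have : IsNoetherianRing R := isNoetherianRing_of_ringEquiv _ e.toRingEquiv
  have : Algebra.FiniteType ℤ R := Algebra.FiniteType.equiv inferInstance e
  have : Algebra.FiniteType R D := Algebra.FiniteType.of_restrictScalars_finiteType ℤ R D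
  have hinj : Function.Injective (algebraMap R L) :=
    (IsFractionRing.injective D L).comp Subtype.val_injective
  have : FaithfulSMul R L := (faithfulSMul_iff_algebraMap_injective _ _).mpr hinj
  let _ : Algebra (FractionRing R) L := FractionRing.liftAlgebra R L
  exact exists_isIntegrallyClosed_of_isAlgebraic R D (FractionRing R) L

/-- Generic smoothness: the extension of fraction fields is formally smooth because the lower field
has characteristic zero, and smoothness at the generic point spreads to a basic open set. -/
lemma exists_smooth_away (A B K L : Type u) [CommRing A] [IsDomain A] [CharZero A] [CommRing B]
    [IsDomain B] [Algebra A B] [Algebra.FinitePresentation A B] [Field K] [Algebra A K]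
    [IsFractionRing A K] [Field L] [Algebra B L] [IsFractionRing B L] [Algebra A L] [Algebra K L]
    [IsScalarTower A K L] [IsScalarTower A B L] :
    ∃ s : B, s ≠ 0 ∧ Algebra.Smooth A (Localization.Away s) := by
  have : Algebra.EssFiniteType B L := Algebra.EssFiniteType.of_isLocalization L (nonZeroDivisors B)
  have : Algebra.EssFiniteType A L := Algebra.EssFiniteType.comp A B L
  have : Algebra.EssFiniteType K L := Algebra.EssFiniteType.of_comp A K L
  have : CharZero K := charZero_of_injective_algebraMap (IsFractionRing.injective A K)
  have : Algebra.FormallySmooth K L := Algebra.FormallySmooth.of_perfectField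
  have : Algebra.FormallyEtale A K := Algebra.FormallyEtale.of_isLocalization (nonZeroDivisors A)
  have : Algebra.FormallySmooth A L := Algebra.FormallySmooth.comp A K L
  have : IsLocalization (⊥ : Ideal B).primeCompl L := by
    rw [show (⊥ : Ideal B).primeCompl = nonZeroDivisors B by
      ext; simp [Ideal.primeCompl]]
    infer_instance
  have : Algebra.IsSmoothAt A (⊥ : Ideal B) :=
    Algebra.FormallySmooth.of_equiv ((IsLocalization.algEquiv (⊥ : Ideal B).primeCompl L
      (Localization.AtPrime (⊥ : Ideal B))).restrictScalars A)
  obtain ⟨s, hs, hsm⟩ := Algebra.IsSmoothAt.exists_notMem_smooth A (⊥ : Ideal B)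
  exact ⟨s, hs, hsm⟩

/-- Flat extensions have going-down, so the height upstairs is the height below plus that of the
fibre. -/
lemma height_comap_le_of_flat (A B : Type u) [CommRing A] [IsNoetherianRing A] [CommRing B] [IsNoetherianRing B]
    [Algebra A B] [Module.Flat A B] (q : Ideal B) [q.IsPrime] :
    (q.comap (algebraMap A B)).height ≤ q.height := by
  have : q.LiesOver (q.comap (algebraMap A B)) := ⟨rfl⟩
  rw [Ideal.height_eq_height_add_of_liesOver_of_hasGoingDown (q.comap (algebraMap A B)) q]
  exact le_self_add

section
variable {k : Type u} [Field k]

lemma exists_subalgebra_of_injective {B : Type u} [CommRing B] [Algebra.FiniteType ℤ B]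
    (j : B →+* k) (hj : Function.Injective j) :
    ∃ (A : Subalgebra ℤ k) (e : B ≃+* A), A.FG ∧ ∀ b, (e b : k) = j b := by
  refine ⟨j.toIntAlgHom.range, (AlgEquiv.ofInjective j.toIntAlgHom hj).toRingEquiv, ?_, fun b => rfl⟩
  rw [Subalgebra.fg_iff_finiteType]
  exact Algebra.FiniteType.equiv inferInstance (AlgEquiv.ofInjective j.toIntAlgHom hj)

theorem exists_isIntegrallyClosed_subalgebra [CharZero k] (A : Subalgebra ℤ k) (hA : A.FG) :
    ∃ A' : Subalgebra ℤ k, A ≤ A' ∧ A'.FG ∧ IsIntegrallyClosed A' := by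
  have : Algebra.FiniteType ℤ A := A.fg_iff_finiteType.mp hA
  obtain ⟨B, _, _, _, _, j, hj, hr⟩ := exists_isIntegrallyClosed_of_finiteType A (FractionRing A)
  let l : FractionRing A →+* k := IsFractionRing.lift (g := algebraMap A k) Subtype.val_injective
  obtain ⟨A', e, hfg, he⟩ := exists_subalgebra_of_injective (l.comp j) (l.injective.comp hj)
  refine ⟨A', fun a ha => ?_, hfg, IsIntegrallyClosed.of_equiv e⟩
  obtain ⟨b, hb⟩ := hr ⟨⟨a, ha⟩, rfl⟩
  have : (e b : k) = a := by
    rw [he]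
    change l (j b) = a
    rw [hb]
    exact IsFractionRing.lift_algebraMap _ _
  rw [← this]
  exact (e b).2

lemma exists_subalgebra_away (A : Subalgebra ℤ k) (hA : A.FG) (s : A) (hs : s ≠ 0) :
    ∃ (A' : Subalgebra ℤ k) (e : Localization.Away s ≃+* A'), A'.FG ∧
      ∀ a : A, (e (algebraMap A _ a) : k) = a := by
  have : Algebra.FiniteType ℤ A := A.fg_iff_finiteType.mp hA
  have : Algebra.FiniteType A (Localization.Away s) := IsLocalization.finiteType_of_monoid_fg (Submonoid.powers s) (Localization.Away s)
  have := finiteType_int_trans A (Localization.Away s)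
  have hu : IsUnit (algebraMap A k s) := isUnit_iff_ne_zero.mpr fun h => hs (Subtype.val_injective h)
  obtain ⟨A', e, hfg, he⟩ := exists_subalgebra_of_injective
    (IsLocalization.Away.lift s hu : Localization.Away s →+* k)
    ((IsLocalization.lift_injective_iff _).mpr fun x y =>
      ⟨fun h => congr_arg _ (IsLocalization.injective _
        (powers_le_nonZeroDivisors_of_noZeroDivisors hs) h),
        fun h => congr_arg _ (Subtype.val_injective h)⟩)
  exact ⟨A', e, hfg, fun a => (he _).trans (IsLocalization.Away.lift_eq s hu a)⟩

/-- The localization is a noetherian normal local domain with a unique nonzero prime, hence a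
discrete valuation ring. -/
lemma valuationRing_localization_of_height_eq_one (A : Type u) [CommRing A] [IsDomain A] [IsNoetherianRing A]
    [IsIntegrallyClosed A] (p : Ideal A) [p.IsPrime] (hp : p.height = 1) :
    ValuationRing (Localization.AtPrime p) := by
  have hle := p.primeCompl_le_nonZeroDivisors
  have hne : p ≠ ⊥ := Ideal.ne_bot_of_height_eq_one hp
  have : IsNoetherianRing (Localization.AtPrime p) :=
    IsLocalization.isNoetherianRing p.primeCompl _ inferInstance
  have : IsIntegrallyClosed (Localization.AtPrime p) :=
    isIntegrallyClosed_of_isLocalization _ _ hle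
  have hnf := IsLocalization.AtPrime.not_isField A hne (Localization.AtPrime p)
  have key : (IsIntegrallyClosed (Localization.AtPrime p) ∧ ∃! P : Ideal (Localization.AtPrime p),
      P ≠ ⊥ ∧ P.IsPrime) ↔ ValuationRing (Localization.AtPrime p) :=
    (IsDiscreteValuationRing.TFAE (Localization.AtPrime p) hnf).out 3 1
  refine key.mp ⟨this,
    IsLocalRing.maximalIdeal (Localization.AtPrime p), ⟨fun hb => hnf
      (IsLocalRing.isField_iff_maximalIdeal_eq.mpr hb), inferInstance⟩, ?_⟩
  rintro q ⟨hq, hqp⟩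
  refine Ideal.eq_of_le_of_height_le q (IsLocalRing.le_maximalIdeal hqp.ne_top) ?_
  have h1 : (IsLocalRing.maximalIdeal (Localization.AtPrime p)).height = 1 := by
    rw [← hp, ← IsLocalization.height_under p.primeCompl]
    congr 1
    exact Localization.AtPrime.under_maximalIdeal
  rw [h1, Order.one_le_iff_ne_zero]
  exact fun h => hq (Ideal.height_eq_zero_iff_eq_bot.mp h)

/-- Normalizing `A₂` gives valuation rings at height one; then inverting one element makes the
extension smooth, hence flat, over `A₀`, and preserves normality. The bound is 1 and not equality
because a prime of height one may contract to zero. -/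
theorem exists_subalgebra_height_comap_le [CharZero k] (A₀ A₂ : Subalgebra ℤ k) (h : A₀ ≤ A₂) (hA₀ : A₀.FG) (hA₂ : A₂.FG) :
    ∃ (A : Subalgebra ℤ k) (h' : A₂ ≤ A), A.FG ∧ ∀ (p : Ideal A) [p.IsPrime], p.height = 1 →
      ValuationRing (Localization.AtPrime p) ∧
      (p.comap (Subalgebra.inclusion (h.trans h'))).height ≤ 1 := by
  obtain ⟨A₃, h₃, hA₃, _⟩ := exists_isIntegrallyClosed_subalgebra A₂ hA₂
  let i : A₀ →+* A₃ := (Subalgebra.inclusion (h.trans h₃)).toRingHom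
  let _ : Algebra A₀ A₃ := i.toAlgebra
  have : Algebra.FiniteType ℤ A₀ := A₀.fg_iff_finiteType.mp hA₀
  have : Algebra.FiniteType ℤ A₃ := A₃.fg_iff_finiteType.mp hA₃
  have : IsNoetherianRing A₀ := Algebra.FiniteType.isNoetherianRing ℤ A₀
  have : Algebra.FiniteType A₀ A₃ := Algebra.FiniteType.of_restrictScalars_finiteType ℤ A₀ A₃
  have : Algebra.FinitePresentation A₀ A₃ := Algebra.FinitePresentation.of_finiteType.mp this
  have hinj : Function.Injective (algebraMap A₀ (FractionRing A₃)) :=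
    (IsFractionRing.injective A₃ (FractionRing A₃)).comp
      (Subalgebra.inclusion_injective (h.trans h₃))
  have : FaithfulSMul A₀ (FractionRing A₃) := (faithfulSMul_iff_algebraMap_injective _ _).mpr hinj
  let _ : Algebra (FractionRing A₀) (FractionRing A₃) := FractionRing.liftAlgebra A₀ (FractionRing A₃)
  obtain ⟨s, hs, hsm⟩ := exists_smooth_away A₀ A₃ (FractionRing A₀) (FractionRing A₃)
  let C := Localization.Away s
  obtain ⟨A, e, hA, he⟩ := exists_subalgebra_away A₃ hA₃ s hs
  have hle : Submonoid.powers s ≤ nonZeroDivisors A₃ := powers_le_nonZeroDivisors_of_noZeroDivisors hs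
  have : IsIntegrallyClosed C := isIntegrallyClosed_of_isLocalization _ _ hle
  have : IsIntegrallyClosed A := IsIntegrallyClosed.of_equiv e
  have : Algebra.FiniteType ℤ A := A.fg_iff_finiteType.mp hA
  have : IsNoetherianRing A := Algebra.FiniteType.isNoetherianRing ℤ A
  have : IsNoetherianRing C := isNoetherianRing_of_ringEquiv _ e.symm
  have h3A : A₃ ≤ A := fun a ha => by
    have h1 := he ⟨a, ha⟩
    change _ = a at h1
    rw [← h1]
    exact (e _).2
  refine ⟨A, h₃.trans h3A, hA, fun p _ hp =>
    ⟨valuationRing_localization_of_height_eq_one A p hp, ?_⟩⟩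
  let q := p.comap e
  have hq : q.height = 1 := by rw [← hp]; exact RingEquiv.height_comap e p
  refine le_trans (le_of_eq ?_) ((height_comap_le_of_flat A₀ C q).trans hq.le)
  congr 1
  ext a
  rw [Ideal.mem_comap, Ideal.mem_comap, Ideal.mem_comap]
  have : e (algebraMap A₀ C a) = Subalgebra.inclusion (h.trans (h₃.trans h3A)) a :=
    Subtype.ext (he _)
  rw [← this]
end

/-! ### Morphisms to affine schemes and spreading out. -/

section
variable {R : Type u} [CommRing R] {X : Scheme.{u}}

lemma toSpecΓ_SpecMap_constMap (h : X ⟶ Spec (.of R)) :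
    X.toSpecΓ ≫ Spec.map (CommRingCat.ofHom (constMap h ⊤)) = h := by
  have : CommRingCat.ofHom (constMap h ⊤) = (Scheme.ΓSpecIso (.of R)).inv ≫ h.appTop := by
    change (Scheme.ΓSpecIso (.of R)).inv ≫ h.appLE ⊤ ⊤ (le_preimage_top h ⊤) = _
    rw [Scheme.Hom.appTop, Scheme.Hom.app_eq_appLE]
    rfl
  rw [this, Spec.map_comp, ← Category.assoc]
  refine (congr_arg (· ≫ Spec.map (Scheme.ΓSpecIso (.of R)).inv)
    (Scheme.toSpecΓ_naturality h).symm).trans ?_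
  rw [Category.assoc]
  refine (congr_arg (h ≫ ·) (toSpecΓ_SpecMap_ΓSpecIso_inv (.of R))).trans (Category.comp_id _)

lemma spec_hom_ext {h h' : X ⟶ Spec (.of R)} (e : constMap h ⊤ = constMap h' ⊤) : h = h' := by
  rw [← toSpecΓ_SpecMap_constMap h, ← toSpecΓ_SpecMap_constMap h', e]

lemma constMap_comp {R' : Type u} [CommRing R'] (h : X ⟶ Spec (.of R)) (φ : R' →+* R) (U : X.Opens) :
    constMap (h ≫ Spec.map (CommRingCat.ofHom φ)) U = (constMap h U).comp φ := by
  ext r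
  have := appLE_constMap (h ≫ Spec.map (CommRingCat.ofHom φ)) h (𝟙 X) φ (by simp) U U le_rfl r
  refine Eq.trans ?_ this
  have e : (𝟙 X : X ⟶ X).appLE U U le_rfl = 𝟙 _ := by
    exact (Category.id_comp _).trans (X.presheaf.map_id _)
  exact congr($e (constMap (h ≫ Spec.map (CommRingCat.ofHom φ)) U r)).symm

lemma constMap_toSpecΓ (φ : R →+* Γ(X, ⊤)) :
    constMap (X.toSpecΓ ≫ Spec.map (CommRingCat.ofHom φ)) ⊤ = φ := by
  have : CommRingCat.ofHom (constMap (X.toSpecΓ ≫ Spec.map (CommRingCat.ofHom φ)) ⊤) =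
      CommRingCat.ofHom φ := by
    change (Scheme.ΓSpecIso (.of R)).inv ≫ Scheme.Hom.appLE _ ⊤ ⊤ (le_preimage_top _ ⊤) = _
    rw [Iso.inv_comp_eq, ← Scheme.ΓSpecIso_naturality]
    have h1 : (X.toSpecΓ ≫ Spec.map (CommRingCat.ofHom φ)).appTop =
      (Spec.map (CommRingCat.ofHom φ)).appTop ≫ (Scheme.ΓSpecIso Γ(X, ⊤)).hom := by
      rw [Scheme.Hom.comp_appTop, Scheme.toSpecΓ_appTop]
    rw [← h1, Scheme.Hom.appTop, Scheme.Hom.app_eq_appLE]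
    rfl
  exact congr(($this).hom)
end

section
variable {k : Type u} [Field k] (A₁ : Subalgebra ℤ k)

/-- The finitely generated subrings of `k` containing `A₁`. -/
abbrev FGExtension : Type u := {A : Subalgebra ℤ k // A₁ ≤ A ∧ A.FG}

variable {A₁}

/-- The inclusion of an extension into a larger one. -/
def FGExtension.inclusion {A B : FGExtension A₁} (h : A ≤ B) : A.1 →+* B.1 :=
  (Subalgebra.inclusion h).toRingHom

/-- The inclusion of the base ring into an extension. -/
def FGExtension.base (A : FGExtension A₁) : A₁ →+* A.1 := (Subalgebra.inclusion A.2.1).toRingHom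

lemma FGExtension.directed : Directed (· ≤ ·) (fun A : FGExtension A₁ => A.1) := fun A B =>
  ⟨⟨A.1 ⊔ B.1, A.2.1.trans le_sup_left, A.2.2.sup B.2.2⟩, le_sup_left, le_sup_right⟩

lemma FGExtension.exists_mem (h : A₁.FG) (x : k) : ∃ A : FGExtension A₁, x ∈ A.1 :=
  ⟨⟨A₁ ⊔ Algebra.adjoin ℤ {x}, le_sup_left, h.sup ⟨{x}, by simp⟩⟩,
    (le_sup_right : _ ≤ A₁ ⊔ Algebra.adjoin ℤ {x}) (Algebra.self_mem_adjoin_singleton ℤ x)⟩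

lemma spec_field_hom_ext (h : A₁.FG) {T : Scheme.{u}} {a b : T ⟶ Spec (.of k)}
    (hab : ∀ A : FGExtension A₁, a ≫ specToSubring k A.1 = b ≫ specToSubring k A.1) : a = b := by
  apply spec_hom_ext
  ext x
  obtain ⟨A, hA⟩ := FGExtension.exists_mem h x
  have := congr(constMap $(hab A) ⊤ ⟨x, hA⟩)
  unfold specToSubring at this
  rwa [constMap_comp, constMap_comp] at this

/-- The field is the directed union of the finitely generated subrings containing `A₁`, so
compatible ring maps on these glue to a map on `k`. -/
lemma exists_spec_field_hom (h : A₁.FG) {T : Scheme.{u}} (t : ∀ A : FGExtension A₁, T ⟶ Spec (.of A.1))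
    (ht : ∀ A B (hAB : A ≤ B), t B ≫ Spec.map (CommRingCat.ofHom (FGExtension.inclusion hAB)) = t A) :
    ∃ a : T ⟶ Spec (.of k), ∀ A, a ≫ specToSubring k A.1 = t A := by
  have : Nonempty (FGExtension A₁) := ⟨⟨A₁, le_rfl, h⟩⟩
  have hsup : (⊤ : Subalgebra ℤ k) ≤ ⨆ A : FGExtension A₁, A.1 := fun x _ => by
    obtain ⟨A, hA⟩ := FGExtension.exists_mem h x
    exact (le_iSup (fun A : FGExtension A₁ => A.1) A) hA
  have hf (A B : FGExtension A₁) (hAB : A.1 ≤ B.1) : (constMap (t A) ⊤).toIntAlgHom =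
      (constMap (t B) ⊤).toIntAlgHom.comp (Subalgebra.inclusion hAB) := by
    ext x
    have := congr(constMap $(ht A B hAB) ⊤ x)
    rw [constMap_comp] at this
    exact this.symm
  let φ := Subalgebra.iSupLift (fun A : FGExtension A₁ => A.1) FGExtension.directed
    (fun A => (constMap (t A) ⊤).toIntAlgHom) hf ⊤ hsup
  refine ⟨T.toSpecΓ ≫ Spec.map (CommRingCat.ofHom
    (φ.toRingHom.comp (Subalgebra.topEquiv (R := ℤ) (A := k)).symm.toAlgHom.toRingHom)), fun A => ?_⟩
  apply spec_hom_ext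
  unfold specToSubring
  rw [constMap_comp, constMap_toSpecΓ]
  ext x
  refine Eq.trans ?_ (Subalgebra.iSupLift_of_mem (R := ℤ) (A := k) (B := Γ(T, ⊤))
    (K := fun A : FGExtension A₁ => A.1) (dir := FGExtension.directed)
    (f := fun A => (constMap (t A) ⊤).toIntAlgHom) (hf := hf) (hT := hsup) (i := A)
    (⟨x, trivial⟩ : (⊤ : Subalgebra ℤ k)) x.2)
  rfl
end

section
variable {k : Type u} [Field k] {A₁ : Subalgebra ℤ k} {Y : Scheme.{u}} (g : Y ⟶ Spec (.of A₁))

/-- The base change of `Y` to an extension of the base ring. -/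
def FGExtension.baseChange (A : FGExtension A₁) : Scheme.{u} :=
  pullback g (Spec.map (CommRingCat.ofHom A.base))

/-- The projection of the base change to the original scheme. -/
def FGExtension.fst (A : FGExtension A₁) : A.baseChange g ⟶ Y := pullback.fst _ _

/-- The structure morphism of the base change. -/
def FGExtension.snd (A : FGExtension A₁) : A.baseChange g ⟶ Spec (.of A.1) := pullback.snd _ _

lemma FGExtension.isPullback (A : FGExtension A₁) : IsPullback (A.fst g) (A.snd g) g
    (Spec.map (CommRingCat.ofHom A.base)) := IsPullback.of_hasPullback _ _

lemma FGExtension.specMap_inclusion_comp {A B : FGExtension A₁} (h : A ≤ B) :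
    Spec.map (CommRingCat.ofHom (inclusion h)) ≫ Spec.map (CommRingCat.ofHom A.base) =
      Spec.map (CommRingCat.ofHom B.base) := by
  rw [← Spec.map_comp]; rfl

lemma FGExtension.specToSubring_inclusion {A B : FGExtension A₁} (h : A ≤ B) :
    specToSubring k B.1 ≫ Spec.map (CommRingCat.ofHom (inclusion h)) = specToSubring k A.1 := by
  unfold specToSubring
  rw [← Spec.map_comp]; rfl

lemma FGExtension.specToSubring_base (A : FGExtension A₁) :
    specToSubring k A.1 ≫ Spec.map (CommRingCat.ofHom A.base) = specToSubring k A₁ := by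
  unfold specToSubring
  rw [← Spec.map_comp]; rfl

/-- The morphism between the base changes to an extension and to a smaller one. -/
def FGExtension.transition {A B : FGExtension A₁} (h : A ≤ B) : B.baseChange g ⟶ A.baseChange g :=
  (A.isPullback g).lift (B.fst g) (B.snd g ≫ Spec.map (CommRingCat.ofHom (inclusion h))) (by
    rw [Category.assoc, specMap_inclusion_comp, (B.isPullback g).w])

lemma FGExtension.transition_fst {A B : FGExtension A₁} (h : A ≤ B) :
    transition g h ≫ A.fst g = B.fst g := (A.isPullback g).lift_fst _ _ _

lemma FGExtension.transition_snd {A B : FGExtension A₁} (h : A ≤ B) :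
    transition g h ≫ A.snd g = B.snd g ≫ Spec.map (CommRingCat.ofHom (inclusion h)) :=
  (A.isPullback g).lift_snd _ _ _

/-- The inverse system of the base changes to all extensions. -/
def FGExtension.diagram : (FGExtension A₁)ᵒᵖ ⥤ Scheme.{u} where
  obj A := A.unop.baseChange g
  map f := transition g f.unop.le
  map_id A := (A.unop.isPullback g).hom_ext (by rw [transition_fst, Category.id_comp]) (by
    rw [transition_snd, Category.id_comp]
    exact (congr_arg _ (Spec.map_id _)).trans (Category.comp_id _))
  map_comp {A B C} f f' := (C.unop.isPullback g).hom_ext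
    (by rw [transition_fst, Category.assoc, transition_fst, transition_fst]) (by
      rw [transition_snd, Category.assoc, transition_snd, ← Category.assoc, transition_snd,
        Category.assoc, ← Spec.map_comp]
      rfl)

variable {g} {Yk : Scheme.{u}} {p : Yk ⟶ Y} {pk : Yk ⟶ Spec (.of k)}
  (sq : IsPullback p pk g (specToSubring k A₁))

/-- The morphism from the base change to the field to the base change to an extension. -/
def FGExtension.lift (A : FGExtension A₁) : Yk ⟶ A.baseChange g :=
  (A.isPullback g).lift p (pk ≫ specToSubring k A.1) (by
    rw [Category.assoc, specToSubring_base, sq.w])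

lemma FGExtension.lift_fst (A : FGExtension A₁) : A.lift sq ≫ A.fst g = p :=
  (A.isPullback g).lift_fst _ _ _

lemma FGExtension.lift_snd (A : FGExtension A₁) : A.lift sq ≫ A.snd g = pk ≫ specToSubring k A.1 :=
  (A.isPullback g).lift_snd _ _ _

lemma FGExtension.lift_transition {A B : FGExtension A₁} (h : A ≤ B) :
    B.lift sq ≫ transition g h = A.lift sq := (A.isPullback g).hom_ext
  (by rw [Category.assoc, transition_fst, lift_fst, lift_fst]) (by
    rw [Category.assoc, transition_snd, ← Category.assoc, lift_snd, lift_snd, Category.assoc,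
      specToSubring_inclusion])

/-- All the σ have the same component in Y, while their components in the spectra of the extensions
glue to a morphism to Spec k. -/
lemma FGExtension.existsUnique_lift (h : A₁.FG) {T : Scheme.{u}}
    (σ : ∀ A : FGExtension A₁, T ⟶ A.baseChange g)
    (hσ : ∀ {A B : FGExtension A₁} (hAB : A ≤ B), σ B ≫ transition g hAB = σ A) :
    ∃! l : T ⟶ Yk, ∀ A : FGExtension A₁, l ≫ A.lift sq = σ A := by
  let A₀ : FGExtension A₁ := ⟨A₁, le_rfl, h⟩
  obtain ⟨a, ha⟩ := exists_spec_field_hom h (fun A => σ A ≫ A.snd g) (fun A B hAB => by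
    rw [Category.assoc, ← transition_snd, ← Category.assoc, hσ])
  have hfst (A : FGExtension A₁) : σ A ≫ A.fst g = σ A₀ ≫ A₀.fst g := by
    have hA : A₀ ≤ A := A.2.1
    rw [← hσ hA, Category.assoc, transition_fst]
  have hw : (σ A₀ ≫ A₀.fst g) ≫ g = a ≫ specToSubring k A₁ := by
    rw [Category.assoc, (A₀.isPullback g).w, ← specToSubring_base A₀, ← Category.assoc,
      ← Category.assoc, ha]
  refine ⟨sq.lift (σ A₀ ≫ A₀.fst g) a hw, fun A => ?_, fun b hb => ?_⟩
  · refine (A.isPullback g).hom_ext ?_ ?_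
    · rw [Category.assoc, lift_fst, sq.lift_fst, hfst A]
    · rw [Category.assoc, lift_snd, ← Category.assoc, sq.lift_snd, ha]
  · refine sq.hom_ext ?_ ?_
    · rw [sq.lift_fst, ← lift_fst sq A₀, ← Category.assoc, hb]
    · rw [sq.lift_snd]
      refine spec_field_hom_ext h fun A => ?_
      rw [ha, Category.assoc, ← lift_snd sq A, ← Category.assoc, hb]

/-- The base change to the field as a cone over the base changes to the extensions. -/
def FGExtension.cone : Cone (diagram g) where
  pt := Yk
  π :=
  { app := fun A => A.unop.lift sq
    naturality := fun _ _ f =>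
      (Category.id_comp _).trans (lift_transition sq f.unop.le).symm }

lemma FGExtension.nonempty_isLimit_cone (h : A₁.FG) : Nonempty (IsLimit (cone sq)) := by
  refine ⟨IsLimit.ofExistsUnique fun s => ?_⟩
  obtain ⟨l, hl, hu⟩ := existsUnique_lift sq h (fun A => s.π.app (op A))
    (fun hAB => s.w (homOfLE hAB).op)
  exact ⟨l, fun A => hl A.unop, fun b hb => hu b fun A => hb (op A)⟩

/-- The base change to `k` is the limit of the base changes to finitely generated extensions along
affine transition maps. A morphism from such a limit to a scheme locally of finite presentation is
defined at a finite stage. -/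
theorem exists_spread_out (hA₁ : A₁.FG)
    {N : Scheme.{u}} [QuasiCompact g] [QuasiSeparated g]
    (c : N ⟶ Spec (.of A₁)) [LocallyOfFinitePresentation c] (a : Yk ⟶ N) (ha : a ≫ c = p ≫ g) :
    ∃ (A : FGExtension A₁) (ψ : A.baseChange g ⟶ N), ψ ≫ c = A.fst g ≫ g ∧ A.lift sq ≫ ψ = a := by
  let t : FGExtension.diagram g ⟶ (Functor.const _).obj (Spec (.of A₁)) :=
    { app := fun A => A.unop.fst g ≫ g
      naturality := fun A B f => by
        refine (Category.assoc _ _ _).symm.trans ?_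
        exact (congr_arg (· ≫ g) (FGExtension.transition_fst g f.unop.le)).trans
          (Category.comp_id _).symm }
  have : Nonempty (FGExtension A₁) := ⟨⟨A₁, le_rfl, hA₁⟩⟩
  have : IsDirectedOrder (FGExtension A₁) := ⟨fun A B => FGExtension.directed A B⟩
  have : CompactSpace (Spec (.of A₁)) := inferInstance
  have (A : FGExtension A₁) : QuasiCompact (A.snd g) :=
    MorphismProperty.of_isPullback (A.isPullback g) inferInstance
  have (A : FGExtension A₁) : QuasiSeparated (A.snd g) :=
    MorphismProperty.of_isPullback (A.isPullback g) inferInstance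
  have (A : (FGExtension A₁)ᵒᵖ) : CompactSpace ((FGExtension.diagram g).obj A) :=
    (quasiCompact_iff_compactSpace (f := A.unop.snd g)).mp inferInstance
  have (A : (FGExtension A₁)ᵒᵖ) : QuasiSeparatedSpace ((FGExtension.diagram g).obj A) :=
    (quasiSeparated_iff_quasiSeparatedSpace (A.unop.snd g)).mp inferInstance
  have (A : FGExtension A₁) : IsAffineHom (A.fst g) :=
    MorphismProperty.of_isPullback (A.isPullback g).flip inferInstance
  have {A B} (f : A ⟶ B) : IsAffineHom ((FGExtension.diagram g).map f) := by
    have : IsAffineHom (FGExtension.transition g f.unop.le ≫ FGExtension.fst g _) := by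
      rw [FGExtension.transition_fst]; infer_instance
    exact MorphismProperty.of_postcomp (W := @IsAffineHom) (W' := @IsSeparated)
      (FGExtension.transition g f.unop.le) (FGExtension.fst g _) inferInstance this
  obtain ⟨hcone⟩ := FGExtension.nonempty_isLimit_cone sq hA₁
  obtain ⟨A, ψ, h1, h2⟩ := Scheme.exists_π_app_comp_eq_of_locallyOfFinitePresentation
    (FGExtension.diagram g) t c (FGExtension.cone sq) hcone a (by
      ext A
      refine (Category.assoc _ _ _).symm.trans ?_
      exact (congr_arg (· ≫ g) (FGExtension.lift_fst sq A.unop)).trans ha.symm)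
  exact ⟨A.unop, ψ, h2, h1⟩
end

/-! ### The affine chart of the projective line. -/

section
open MvPolynomial HomogeneousLocalization
variable {R : Type u} [CommRing R] {n : ℕ}

lemma awayX_self (i : Fin (n + 1)) :
    (awayX i i : Away (homogeneousSubmodule (Fin (n + 1)) R) (X i)) = 1 := by
  apply val_injective
  rw [awayX, Away.val_mk, val_one, Localization.mk_eq_monoidOf_mk']
  simp

/-- On the standard chart the base change morphism changes the constants and fixes the coordinates;
this lets points given by a coordinate be compared over different rings. -/
lemma exists_awayι_comp_map {B : Type u} [CommRing B] (φ : R →+* B) (i : Fin (n + 1)) :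
    ∃ a : Away (homogeneousSubmodule (Fin (n + 1)) R) (X i) →+*
      Away (homogeneousSubmodule (Fin (n + 1)) B) (X i),
      a.comp (awayC (X i)) = (awayC (X i)).comp φ ∧ (∀ j, a (awayX i j) = awayX i j) ∧
      Proj.awayι _ (X i) (X_mem i) one_pos ≫ projectiveSpace.map n φ =
        Spec.map (CommRingCat.ofHom a) ≫ Proj.awayι _ (X i) (X_mem i) one_pos := by
  have key : ∀ (s : MvPolynomial (Fin (n + 1)) B) (_ : s = X i) (hs : s ∈ homogeneousSubmodule (Fin (n + 1)) B 1)
      (a : Away (homogeneousSubmodule (Fin (n + 1)) R) (X i) →+*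
        Away (homogeneousSubmodule (Fin (n + 1)) B) s), a.comp (awayC (X i)) = (awayC s).comp φ →
      (∀ j, (a (awayX i j)).val = Localization.mk (X j) ⟨s, Submonoid.mem_powers _⟩) →
      Proj.awayι _ s hs one_pos ≫ projectiveSpace.map n φ =
        Spec.map (CommRingCat.ofHom a) ≫ Proj.awayι _ (X i) (X_mem i) one_pos →
      ∃ a : Away (homogeneousSubmodule (Fin (n + 1)) R) (X i) →+*
      Away (homogeneousSubmodule (Fin (n + 1)) B) (X i),
      a.comp (awayC (X i)) = (awayC (X i)).comp φ ∧ (∀ j, a (awayX i j) = awayX i j) ∧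
      Proj.awayι _ (X i) (X_mem i) one_pos ≫ projectiveSpace.map n φ =
        Spec.map (CommRingCat.ofHom a) ≫ Proj.awayι _ (X i) (X_mem i) one_pos := by
    rintro s rfl hs a ha1 ha2 ha
    refine ⟨a, ha1, fun j => ?_, ha⟩
    apply val_injective
    rw [ha2, awayX, Away.val_mk]
    congr 2
    simp
  have hsq := Proj.awayι_comp_map (gradedMap φ n) (irrelevant_le_map φ) one_pos (X i) (X_mem i)
  refine key _ (map_X φ i) ((gradedMap φ n).map_mem (X_mem i)) _ ?_ (fun j => ?_) hsq
  · ext r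
    refine Eq.trans ?_ (val_awayC _ _).symm
    rw [← Localization.mk_one_eq_algebraMap]
    refine Eq.trans (b := Localization.mk (MvPolynomial.map φ (C r)) 1) ?_ (by rw [map_C])
    refine Eq.trans (b := Localization.mk (MvPolynomial.map φ (C r))
      (⟨MvPolynomial.map φ 1, 0, by rw [map_one]; exact pow_zero _⟩ :
        Submonoid.powers (gradedMap φ n (X i)))) rfl ?_
    exact congr_arg₂ Localization.mk rfl (Subtype.ext (map_one _))
  · refine (congr_arg val (Away.map_mk (gradedMap φ n) (X i) (X_mem i) 1 (X j) (X_mem j))).trans ?_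
    refine (Away.val_mk _ _ _ _ _).trans ?_
    exact congr_arg₂ Localization.mk (map_X φ j) (Subtype.ext (pow_one _))

/-- The homomorphism from the coordinate ring of the standard chart of the projective line given by
a value of the coordinate. -/
def evalAway {T : Type u} [CommRing T] (φ : R →+* T) (t : T) :
    Away (homogeneousSubmodule (Fin (1 + 1)) R) (X 0) →+* T :=
  (exists_away_lift 0 φ ![1, t] rfl).choose

lemma evalAway_comp_awayC {T : Type u} [CommRing T] (φ : R →+* T) (t : T) :
    (evalAway φ t).comp (awayC (X 0)) = φ := (exists_away_lift 0 φ ![1, t] rfl).choose_spec.1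

lemma evalAway_awayX {T : Type u} [CommRing T] (φ : R →+* T) (t : T) :
    evalAway φ t (awayX 0 1) = t := (exists_away_lift 0 φ ![1, t] rfl).choose_spec.2 1

lemma eq_evalAway {T : Type u} [CommRing T] {φ : R →+* T} {t : T}
    {a : Away (homogeneousSubmodule (Fin (1 + 1)) R) (X 0) →+* T}
    (ha : a.comp (awayC (X 0)) = φ) (ht : a (awayX 0 1) = t) : a = evalAway φ t := by
  refine away_hom_ext (ha.trans (evalAway_comp_awayC φ t).symm) fun j => ?_
  fin_cases j
  · change a (awayX 0 0) = evalAway φ t (awayX 0 0)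
    rw [awayX_self, map_one, map_one]
  · exact ht.trans (evalAway_awayX φ t).symm

/-- The inclusion of the standard chart in the projective line. -/
def projectiveLine.chart (R : Type u) [CommRing R] :
    Spec (.of (Away (homogeneousSubmodule (Fin (1 + 1)) R) (X 0))) ⟶ projectiveSpace 1 R :=
  Proj.awayι _ (X 0) (X_mem 0) one_pos

instance : IsOpenImmersion (projectiveLine.chart R) :=
  inferInstanceAs (IsOpenImmersion (Proj.awayι (homogeneousSubmodule (Fin (1 + 1)) R) (X 0)
    (X_mem 0) one_pos))

lemma projectiveLine.chart_toSpec :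
    projectiveLine.chart R ≫ projectiveSpace.toSpec 1 R = Spec.map (CommRingCat.ofHom (awayC (X 0))) :=
  awayι_toSpec _ _ _

lemma constMap_comp_appTop {T T' : Scheme.{u}} (g : T' ⟶ T) (f : T ⟶ Spec (.of R)) :
    g.appTop.hom.comp (constMap f ⊤) = constMap (g ≫ f) ⊤ := by
  ext r
  have := appLE_constMap f (g ≫ f) g (RingHom.id R) (by
    exact (Category.comp_id _).symm.trans (congr_arg _ (Spec.map_id _).symm)) ⊤ ⊤ le_top r
  refine Eq.trans ?_ this
  rw [Scheme.Hom.appTop, Scheme.Hom.app_eq_appLE]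
  rfl

/-- The morphism to the projective line given by a function. -/
def toProjectiveLine {T : Scheme.{u}} (f : T ⟶ Spec (.of R)) (t : Γ(T, ⊤)) :
    T ⟶ projectiveSpace 1 R :=
  T.toSpecΓ ≫ Spec.map (CommRingCat.ofHom (evalAway (constMap f ⊤) t)) ≫ projectiveLine.chart R

lemma toProjectiveLine_toSpec {T : Scheme.{u}} (f : T ⟶ Spec (.of R)) (t : Γ(T, ⊤)) :
    toProjectiveLine f t ≫ projectiveSpace.toSpec 1 R = f := by
  unfold toProjectiveLine
  rw [Category.assoc, Category.assoc, projectiveLine.chart_toSpec, ← Spec.map_comp]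
  refine Eq.trans ?_ (toSpecΓ_SpecMap_constMap f)
  rw [← CommRingCat.ofHom_comp, evalAway_comp_awayC]

lemma comp_toProjectiveLine {T T' : Scheme.{u}} (g : T' ⟶ T) (f : T ⟶ Spec (.of R)) (t : Γ(T, ⊤)) :
    g ≫ toProjectiveLine f t = toProjectiveLine (g ≫ f) (g.appTop t) := by
  unfold toProjectiveLine
  rw [← Category.assoc, ← Category.assoc, Scheme.toSpecΓ_naturality, ← Category.assoc,
    Category.assoc T'.toSpecΓ]
  congr 2
  rw [← Spec.map_comp]
  congr 1
  ext1
  refine eq_evalAway ?_ ?_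
  · rw [← constMap_comp_appTop]
    exact congr_arg g.appTop.hom.comp (evalAway_comp_awayC (constMap f ⊤) t)
  · exact congr(g.appTop $(evalAway_awayX (constMap f ⊤) t))

lemma toProjectiveLine_map {B : Type u} [CommRing B] (φ : R →+* B) {T : Scheme.{u}}
    (f : T ⟶ Spec (.of B)) (t : Γ(T, ⊤)) :
    toProjectiveLine f t ≫ projectiveSpace.map 1 φ =
      toProjectiveLine (f ≫ Spec.map (CommRingCat.ofHom φ)) t := by
  obtain ⟨a, ha1, ha2, ha⟩ := exists_awayι_comp_map (n := 1) φ 0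
  unfold toProjectiveLine
  rw [Category.assoc, Category.assoc]
  refine (congr_arg (fun z => T.toSpecΓ ≫ Spec.map (CommRingCat.ofHom (evalAway (constMap f ⊤) t)) ≫ z) ha).trans ?_
  congr 1
  have e : CommRingCat.ofHom a ≫ CommRingCat.ofHom (evalAway (constMap f ⊤) t) =
      CommRingCat.ofHom (evalAway (constMap (f ≫ Spec.map (CommRingCat.ofHom φ)) ⊤) t) := ?_
  · rw [← e, Spec.map_comp, Category.assoc]; rfl
  ext1
  refine eq_evalAway ?_ ?_
  · change ((evalAway (constMap f ⊤) t).comp a).comp (awayC (X 0)) = _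
    rw [RingHom.comp_assoc, ha1, ← RingHom.comp_assoc, evalAway_comp_awayC, constMap_comp]
  · change evalAway (constMap f ⊤) t (a (awayX 0 1)) = t
    rw [ha2, evalAway_awayX]

lemma exists_eq_toProjectiveLine {T : Scheme.{u}} (f : T ⟶ Spec (.of R)) (v : T ⟶ projectiveSpace 1 R)
    (hv : v ≫ projectiveSpace.toSpec 1 R = f)
    (hr : Set.range v ⊆ Set.range (projectiveLine.chart R)) : ∃ t, v = toProjectiveLine f t := by
  let v' := IsOpenImmersion.lift (projectiveLine.chart R) v hr
  have hv' : v' ≫ projectiveLine.chart R = v := IsOpenImmersion.lift_fac _ _ _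
  refine ⟨constMap v' ⊤ (awayX 0 1), ?_⟩
  unfold toProjectiveLine
  rw [← hv', ← toSpecΓ_SpecMap_constMap v', Category.assoc]
  congr 3
  rw [toSpecΓ_SpecMap_constMap]
  congr 1
  refine eq_evalAway ?_ rfl
  rw [← hv, ← hv', Category.assoc, projectiveLine.chart_toSpec, constMap_comp]

/-- The generic point of projective space over a field. -/
def projectiveSpace.genericPoint (n : ℕ) (k : Type u) [Field k] : projectiveSpace n k :=
  (⟨⊥, by
    change (⊥ : Ideal (MvPolynomial (Fin (n + 1)) k)).IsPrime
    exact Ideal.isPrime_bot, fun h => by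
    have h1 := h (HomogeneousIdeal.mem_irrelevant_of_mem _ one_pos (X_mem (R := k) (n := n) 0))
    exact X_ne_zero (R := k) (0 : Fin (n + 1)) h1⟩ :
      ProjectiveSpectrum (homogeneousSubmodule (Fin (n + 1)) k))

/-- The generic point lies in the chart and in every nonempty open set. -/
lemma projectiveLine.denseRange_chart (k : Type u) [Field k] : DenseRange (projectiveLine.chart k) := by
  intro x
  rw [mem_closure_iff]
  intro U hU hx
  obtain ⟨_, ⟨f, rfl⟩, hxf, hfU⟩ := (ProjectiveSpectrum.isTopologicalBasis_basic_opens
    (homogeneousSubmodule (Fin (1 + 1)) k)).exists_subset_of_mem_open hx hU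
  have hf : f ≠ 0 := fun h => hxf (h ▸ zero_mem _)
  refine ⟨projectiveSpace.genericPoint 1 k, hfU fun h => hf h, ?_⟩
  have : projectiveSpace.genericPoint 1 k ∈ (projectiveLine.chart k).opensRange := by
    refine (Proj.opensRange_awayι (homogeneousSubmodule (Fin (1 + 1)) k) (X 0) (X_mem 0)
      one_pos).ge ?_
    intro h
    exact X_ne_zero (R := k) (0 : Fin (1 + 1)) h
  exact this

lemma bijective_algebraMap_homogeneousSubmodule_zero (n : ℕ) :
    Function.Bijective (algebraMap R (homogeneousSubmodule (Fin (n + 1)) R 0)) := by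
  refine ⟨fun a b h => C_injective (Fin (n + 1)) R (congr_arg Subtype.val h), fun ⟨f, hf⟩ => ?_⟩
  refine ⟨coeff 0 f, Subtype.ext ?_⟩
  exact ((totalDegree_eq_zero_iff_eq_C).mp ((totalDegree_zero_iff_isHomogeneous _).mpr hf)).symm

/-- The homogeneous spectrum is proper over its degree zero part, which here is `R`. -/
instance projectiveSpace.isProper_toSpec (n : ℕ) : IsProper (projectiveSpace.toSpec n R) := by
  have : IsScalarTower R (homogeneousSubmodule (Fin (n + 1)) R 0) (MvPolynomial (Fin (n + 1)) R) :=
    ⟨fun x y z => smul_mul_assoc x (y : MvPolynomial (Fin (n + 1)) R) z⟩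
  have : Algebra.FiniteType (homogeneousSubmodule (Fin (n + 1)) R 0) (MvPolynomial (Fin (n + 1)) R) :=
    Algebra.FiniteType.of_restrictScalars_finiteType R _ _
  have : IsIso (CommRingCat.ofHom (algebraMap R (homogeneousSubmodule (Fin (n + 1)) R 0))) :=
    (ConcreteCategory.isIso_iff_bijective _).mpr (bijective_algebraMap_homogeneousSubmodule_zero n)
  have h1 : IsProper (Proj.toSpecZero (homogeneousSubmodule (Fin (n + 1)) R)) := inferInstance
  unfold projectiveSpace.toSpec
  exact MorphismProperty.comp_mem @IsProper _ _ h1 inferInstance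
end

/-! ### Properties of symmetric powers. -/

/-- `N` with the projection `π` from the fibre power is the symmetric power of `f`. -/
structure IsSymPower {X S N : Scheme.{u}} (m : ℕ) (f : X ⟶ S) (c : N ⟶ S)
    (π : power m f ⟶ N) : Prop where
  isAffineHom : IsAffineHom π
  quotient : IsSchemeQuotient (power.perm m f) π
  comp : π ≫ c = power.toBase m f

section
variable {X X' S S' N N' : Scheme.{u}} {m : ℕ} {f : X ⟶ S} {c : N ⟶ S} {π : power m f ⟶ N}
  {f' : X' ⟶ S} {c' : N' ⟶ S} {π' : power m f' ⟶ N'}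

lemma exists_isSymPower (hm : 0 < m) (f : X ⟶ S) [IsAffine S] (hX : AffineFinite X) :
    ∃ (N : Scheme.{u}) (c : N ⟶ S) (π : power m f ⟶ N), IsSymPower m f c π := by
  obtain ⟨N, π, h1, h2⟩ := exists_symPower_scheme m hm f hX
  exact ⟨N, h2.desc (power.perm_one m f) (power.perm_mul m f) _ (power.perm_toBase m f), π, h1, h2,
    h2.π_desc _ _ _ _⟩

lemma IsSymPower.isIntegralHom (h : IsSymPower m f c π) : IsIntegralHom π :=
  have := h.isAffineHom
  h.quotient.isIntegralHom (power.perm_one m f) (power.perm_mul m f)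

lemma IsSymPower.surjective (h : IsSymPower m f c π) : Surjective π := h.quotient.surjective'

lemma IsSymPower.hom_ext (h : IsSymPower m f c π) {T : Scheme.{u}} {a b : N ⟶ T}
    (hab : π ≫ a = π ≫ b) : a = b :=
  h.quotient.hom_ext (power.perm_one m f) (power.perm_mul m f) hab

lemma IsSymPower.locallyOfFiniteType (h : IsSymPower m f c π) [IsLocallyNoetherian S]
    [LocallyOfFiniteType f] : LocallyOfFiniteType c := by
  have := h.isIntegralHom
  have : LocallyOfFiniteType (π ≫ c) := by
    rw [h.comp]
    exact power.toBase_property m @LocallyOfFiniteType f inferInstance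
  refine locallyOfFiniteType_of_isIntegralHom_of_injective (π := π) c fun V => ?_
  have := h.quotient.injective V
  rw [secMap_self] at this
  exact this

lemma IsSymPower.quasiCompact (h : IsSymPower m f c π) [QuasiCompact f] : QuasiCompact c := by
  have := h.surjective
  have : QuasiCompact (π ≫ c) := by
    rw [h.comp]
    exact power.toBase_property m @QuasiCompact f inferInstance
  exact quasiCompact_of_surjective_comp (π := π) c

lemma IsSymPower.isSeparated (h : IsSymPower m f c π) [IsSeparated f] : IsSeparated c := by
  have := h.surjective
  have := h.isIntegralHom
  have : IsSeparated (π ≫ c) := by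
    rw [h.comp]
    exact power.toBase_property m @IsSeparated f inferInstance
  exact isSeparated_of_surjective_comp (π := π) c

/-- The saturation of an open set is the union of its translates. -/
lemma IsSymPower.isOpenMap (h : IsSymPower m f c π) : IsOpenMap π := by
  intro U hU
  have hq : Topology.IsQuotientMap π := h.quotient.isQuotientMap
  rw [← hq.isOpen_preimage]
  have : π ⁻¹' (π '' U) = ⋃ σ, (power.perm m f σ) ⁻¹' U := by
    ext x
    simp only [Set.mem_preimage, Set.mem_iUnion]
    constructor
    · rintro ⟨y, hy, hxy⟩
      obtain ⟨σ, hσ⟩ := h.quotient.orbit _ _ hxy.symm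
      exact ⟨σ, by rw [show power.perm m f σ x = y from hσ]; exact hy⟩
    · rintro ⟨σ, hσ⟩
      exact ⟨_, hσ, congr($(h.quotient.condition' σ) x)⟩
  rw [this]
  exact isOpen_iUnion fun σ => hU.preimage (power.perm m f σ).continuous

lemma IsSymPower.exists_map (h : IsSymPower m f c π) (h' : IsSymPower m f' c' π') (g : X ⟶ X')
    (hg : g ≫ f' = f ≫ 𝟙 S) :
    ∃ d : N ⟶ N', π ≫ d = power.map m g (𝟙 S) hg ≫ π' ∧ d ≫ c' = c := by
  obtain ⟨d, hd, -⟩ := h.quotient.existsUnique_desc (power.perm_one m f) (power.perm_mul m f)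
    (power.map m g (𝟙 S) hg ≫ π') (fun σ => by
      rw [← Category.assoc, power.perm_map, Category.assoc, h'.quotient.condition'])
  refine ⟨d, hd, h.hom_ext ?_⟩
  rw [← Category.assoc, hd, Category.assoc, h'.comp, h.comp, power.map_toBase, Category.comp_id]

lemma IsSymPower.isOpenImmersion (h : IsSymPower m f c π) (h' : IsSymPower m f' c' π') (hm : 0 < m)
    (g : X ⟶ X') [IsOpenImmersion g]
    (hg : g ≫ f' = f ≫ 𝟙 S) (d : N ⟶ N') (hd : π ≫ d = power.map m g (𝟙 S) hg ≫ π') :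
    IsOpenImmersion d := by
  have : LocallyRingedSpace.IsOpenImmersion (power.map m g (𝟙 S) hg).toLRSHom :=
    power.isOpenImmersion_map m g hg hm
  exact h.quotient.isOpenImmersion h'.quotient (power.map m g (𝟙 S) hg).toLRSHom
    (fun σ => congr(($(power.perm_map m g (𝟙 S) hg σ)).toLRSHom)) d.toLRSHom
    congr(($hd).toLRSHom)

/-- Universal closedness is inherited from `π ≫ d` because π is surjective; finite type and
separatedness come from the structure morphism of the source. Applied to the projection from 𝒳 × ℙ¹,
this makes near-integral points lift. -/
lemma IsSymPower.isProper (h : IsSymPower m f c π) (h' : IsSymPower m f' c' π') (hm : 0 < m)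
    (g : X ⟶ X') [IsProper g] [IsLocallyNoetherian S] [LocallyOfFiniteType f] [IsSeparated f]
    (hg : g ≫ f' = f ≫ 𝟙 S) (d : N ⟶ N') (hd : π ≫ d = power.map m g (𝟙 S) hg ≫ π')
    (hdc : d ≫ c' = c) : IsProper d := by
  have := h.surjective
  have := h'.isIntegralHom
  have h1 : UniversallyClosed (π ≫ d) := by
    rw [hd]
    have := power.map_property m @UniversallyClosed g hg inferInstance hm
    infer_instance
  have : UniversallyClosed d := UniversallyClosed.of_comp_surjective π d
  have h2 : LocallyOfFiniteType (d ≫ c') := by rw [hdc]; exact h.locallyOfFiniteType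
  have : LocallyOfFiniteType d := locallyOfFiniteType_of_comp d c'
  have h3 : IsSeparated (d ≫ c') := by rw [hdc]; exact h.isSeparated
  have : IsSeparated d := IsSeparated.of_comp d c'
  exact {}
end

section
variable {X X₀ S S₀ N N₀ : Scheme.{u}} {m : ℕ} {f₀ : X₀ ⟶ S₀} {c₀ : N₀ ⟶ S₀}
  {π₀ : power m f₀ ⟶ N₀} {f : X ⟶ S} {g : X ⟶ X₀} {s : S ⟶ S₀} {c : N ⟶ S} {a : N ⟶ N₀}

/-- The projection to the base change of a symmetric power. -/
def IsSymPower.baseChange (h : IsSymPower m f₀ c₀ π₀) (sq : IsPullback g f f₀ s)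
    (sqN : IsPullback a c c₀ s) : power m f ⟶ N :=
  sqN.lift (power.map m g s sq.w ≫ π₀) (power.toBase m f)
    (by rw [Category.assoc, h.comp, power.map_toBase])

variable (h : IsSymPower m f₀ c₀ π₀) (sq : IsPullback g f f₀ s) (sqN : IsPullback a c c₀ s)

lemma IsSymPower.baseChange_fst : h.baseChange sq sqN ≫ a = power.map m g s sq.w ≫ π₀ :=
  sqN.lift_fst _ _ _

lemma IsSymPower.baseChange_snd : h.baseChange sq sqN ≫ c = power.toBase m f :=
  sqN.lift_snd _ _ _

/-- Fibre powers commute with any base change, the quotient by the permutations with a flat one. The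
case used is that of Spec k over a finitely generated subring. -/
lemma IsSymPower.isSymPower_baseChange [Flat s] : IsSymPower m f c (h.baseChange sq sqN) := by
  have := h.isAffineHom
  have sq' : IsPullback (power.map m g s sq.w) (h.baseChange sq sqN) π₀ a := by
    refine IsPullback.of_bot ?_ (h.baseChange_fst sq sqN).symm sqN
    rw [h.baseChange_snd sq sqN, h.comp]
    exact power.isPullback_map m g s sq
  have : Flat a := MorphismProperty.of_isPullback sqN.flip inferInstance
  refine ⟨MorphismProperty.of_isPullback sq' inferInstance, h.quotient.of_isPullback
    (power.perm_one m f) (power.perm_mul m f) sq' (fun σ => ?_) (power.perm_map m g s sq.w),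
    h.baseChange_snd sq sqN⟩
  refine sqN.hom_ext ?_ ?_
  · rw [Category.assoc, h.baseChange_fst sq sqN, ← Category.assoc, power.perm_map, Category.assoc,
      h.quotient.condition']
  · rw [Category.assoc, h.baseChange_snd sq sqN, power.perm_toBase]

end

/-- The symmetric power in locally ringed spaces is given by a scheme that is one. -/
lemma IsSymPower.exists_iso {X S N : Scheme.{u}} {m : ℕ} {f : X ⟶ S} {c : N ⟶ S}
    {π : power m f ⟶ N} (h : IsSymPower m f c π) :
    ∃ e : N.toLocallyRingedSpace ≅ symPower m f, e.hom ≫ symPower.toBase m f = c.toLRSHom := by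
  have hq := isOrbitQuotient_wideCoequalizer (fun σ => (power.perm m f σ).toLRSHom)
    (toLRSHom_one (power.perm_one m f)) (toLRSHom_mul (power.perm_mul m f))
  obtain ⟨d, hd, -⟩ := IsOrbitQuotient.existsUnique_desc h.quotient
    (toLRSHom_one (power.perm_one m f)) (toLRSHom_mul (power.perm_mul m f))
    (wideCoequalizer.π _) hq.condition
  have : IsIso d := IsOrbitQuotient.isIso h.quotient hq (𝟙 _) (fun σ => by simp) d (by simp [hd])
  let e : N.toLocallyRingedSpace ≅ wideCoequalizer (fun σ => (power.perm m f σ).toLRSHom) :=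
    @asIso _ _ _ _ d this
  refine ⟨e, ?_⟩
  refine (IsOrbitQuotient.existsUnique_desc h.quotient
    (toLRSHom_one (power.perm_one m f)) (toLRSHom_mul (power.perm_mul m f))
    (power.toBase m f).toLRSHom (fun σ => congr(($(power.perm_toBase m f σ)).toLRSHom))).unique
    ?_ congr(($(h.comp)).toLRSHom)
  refine (Category.assoc _ _ _).symm.trans ?_
  refine (congr_arg (· ≫ symPower.toBase m f) hd).trans ?_
  exact wideCoequalizer.π_desc _ _

/-! ### Near-integral points and the valuative criterion. -/

lemma exists_lift_of_isProper {M N : Scheme.{u}} (d : M ⟶ N) [IsProper d] {R K : Type u} [CommRing R]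
    [IsDomain R] [ValuationRing R] [Field K] (φ : R →+* K) (hφ : @IsFractionRing R _ K _ φ.toAlgebra)
    (P : Spec (.of K) ⟶ M) (Q : Spec (.of R) ⟶ N)
    (h : P ≫ d = Spec.map (CommRingCat.ofHom φ) ≫ Q) :
    ∃ l : Spec (.of R) ⟶ M, Spec.map (CommRingCat.ofHom φ) ≫ l = P ∧ l ≫ d = Q := by
  let _ : Algebra R K := φ.toAlgebra
  have hv : ValuativeCriterion.Existence d := by
    have : UniversallyClosed d := inferInstance
    rw [UniversallyClosed.eq_valuativeCriterion] at this
    exact this.1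
  obtain ⟨⟨l, hl1, hl2⟩⟩ := (hv ⟨R, K, P, Q, ⟨h⟩⟩).exists_lift
  exact ⟨l, hl1, hl2⟩

lemma isFractionRing_localization_lift {A : Type u} [CommRing A] [IsDomain A] (p : Ideal A)
    [p.IsPrime] : @IsFractionRing (Localization.AtPrime p) _ (FractionRing A) _
      (IsLocalization.lift (M := p.primeCompl)
        (S := Localization.AtPrime p) (g := algebraMap A (FractionRing A))
        (fun y => IsLocalization.map_units (FractionRing A)
          (⟨y, p.primeCompl_le_nonZeroDivisors y.2⟩ : nonZeroDivisors A))).toAlgebra := by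
  let _ : Algebra (Localization.AtPrime p) (FractionRing A) := (IsLocalization.lift (M := p.primeCompl)
    (S := Localization.AtPrime p) (g := algebraMap A (FractionRing A))
    (fun y => IsLocalization.map_units (FractionRing A)
      (⟨y, p.primeCompl_le_nonZeroDivisors y.2⟩ : nonZeroDivisors A))).toAlgebra
  have : IsScalarTower A (Localization.AtPrime p) (FractionRing A) :=
    IsScalarTower.of_algebraMap_eq fun x => by
      rw [RingHom.algebraMap_toAlgebra, IsLocalization.lift_eq]
  exact IsFractionRing.isFractionRing_of_isDomain_of_isLocalization p.primeCompl _ _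

lemma specFractionToLocal_comp {A : Type u} [CommRing A] [IsDomain A] (p : Ideal A)
    [p.IsPrime] : specFractionToLocal A p ≫
      Spec.map (CommRingCat.ofHom (algebraMap A (Localization.AtPrime p))) =
    Spec.map (CommRingCat.ofHom (algebraMap A (FractionRing A))) := by
  rw [specFractionToLocal, ← Spec.map_comp, ← CommRingCat.ofHom_comp]
  congr 2
  exact IsLocalization.lift_comp _

lemma specToFraction_comp {k : Type u} [Field k] (A : Subalgebra ℤ k) :
    specToFraction k A ≫ Spec.map (CommRingCat.ofHom (algebraMap A (FractionRing A))) =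
      specToSubring k A := by
  rw [specToFraction, specToSubring, ← Spec.map_comp, ← CommRingCat.ofHom_comp]
  congr 2
  exact RingHom.ext fun x => IsFractionRing.lift_algebraMap (g := algebraMap A k)
    Subtype.val_injective x

section
variable {k : Type u} [Field k] {A₁ : Subalgebra ℤ k} (A : FGExtension A₁)

/-- The `k`-points over `A₁` that come from near-integral points over an extension of `A₁`. -/
def NearIntegral {N : Scheme.{u}} (c : N ⟶ Spec (.of A₁)) (y : Spec (.of k) ⟶ N) : Prop :=
  ∃ P : Spec (.of (FractionRing A.1)) ⟶ N, specToFraction k A.1 ≫ P = y ∧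
    P ≫ c = Spec.map (CommRingCat.ofHom (algebraMap A.1 (FractionRing A.1))) ≫
      Spec.map (CommRingCat.ofHom A.base) ∧
    ∀ (p : Ideal A.1) [p.IsPrime], p.height = 1 →
      ∃ Q : Spec (.of (Localization.AtPrime p)) ⟶ N,
        Q ≫ c = Spec.map (CommRingCat.ofHom (algebraMap A.1 (Localization.AtPrime p))) ≫
          Spec.map (CommRingCat.ofHom A.base) ∧
        specFractionToLocal A.1 p ≫ Q = P

variable {A}

lemma FGExtension.isPullback_lift {Y Yk : Scheme.{u}} {g : Y ⟶ Spec (.of A₁)} {p : Yk ⟶ Y}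
    {pk : Yk ⟶ Spec (.of k)} (sq : IsPullback p pk g (specToSubring k A₁)) :
    IsPullback (A.lift sq) pk (A.snd g) (specToSubring k A.1) := by
  refine IsPullback.of_right (h₁₂ := A.fst g) (h₂₂ := Spec.map (CommRingCat.ofHom A.base)) ?_
    (A.lift_snd sq) (A.isPullback g)
  rw [A.lift_fst sq, A.specToSubring_base]
  exact sq

/-- The K-point underlying `y ≫ j` factors through U, and `s` lifts it to M. At a prime of height
one its extension to N lifts to M by the valuative criterion for `d`. -/
lemma NearIntegral.of_isProper {N M U : Scheme.{u}} {c : N ⟶ Spec (.of A₁)} {c' : M ⟶ Spec (.of A₁)}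
    (hA : ∀ (p : Ideal A.1) [p.IsPrime], p.height = 1 → ValuationRing (Localization.AtPrime p))
    {d : M ⟶ N} [IsProper d] (hd : d ≫ c = c') {j : U ⟶ N} [IsOpenImmersion j] {s : U ⟶ M}
    (hs : s ≫ d = j) {y : Spec (.of k) ⟶ U} (h : NearIntegral A c (y ≫ j)) :
    NearIntegral A c' (y ≫ s) := by
  obtain ⟨P, hPy, hPc, hQ⟩ := h
  -- Spec K has a single point, the image of the point of Spec k, which already maps into U.
  have hr : Set.range P ⊆ Set.range j := by
    rintro _ ⟨x, rfl⟩
    have : x = specToFraction k A.1 (IsLocalRing.closedPoint k) := Subsingleton.elim _ _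
    rw [this]
    exact ⟨y (IsLocalRing.closedPoint k), congr($hPy (IsLocalRing.closedPoint k)).symm⟩
  have hP' := IsOpenImmersion.lift_fac j P hr
  generalize IsOpenImmersion.lift j P hr = P' at hP'
  have hcom : P' ≫ s ≫ d = P := by rw [hs, hP']
  refine ⟨P' ≫ s, ?_, ?_, fun p _ hp => ?_⟩
  · rw [← Category.assoc]
    congr 1
    rw [← cancel_mono j, Category.assoc, hP', hPy]
  · rw [← hPc, ← hd, ← hcom]; simp only [Category.assoc]
  · obtain ⟨Q, hQc, hQP⟩ := hQ p hp
    have := hA p hp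
    obtain ⟨l, hl1, hl2⟩ := exists_lift_of_isProper d _ (isFractionRing_localization_lift p)
      (P' ≫ s) Q (by rw [Category.assoc, hcom]; exact hQP.symm)
    refine ⟨l, ?_, hl1⟩
    rw [← hd, ← hQc]
    exact (Category.assoc _ _ _).symm.trans (congr_arg (· ≫ c) hl2)

/-- The required model is the base change of M to the extension `A`; its near-integral points are
those that `NearIntegral` describes on M itself. -/
lemma isArithmeticallySpecial_of_isSymPower {W M Mk : Scheme.{u}} {m : ℕ}
    {w : W ⟶ Spec (.of k)} {c : M ⟶ Spec (.of A₁)}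
    {a : Mk ⟶ M} {ck : Mk ⟶ Spec (.of k)} {πk : power m w ⟶ Mk}
    (h : IsSymPower m w ck πk) (sqM : IsPullback a ck c (specToSubring k A₁))
    [LocallyOfFiniteType c] [QuasiCompact c] [IsSeparated c]
    (hd : Dense {y : Mk | ∃ r : Spec (.of k) ⟶ Mk, r ≫ ck = 𝟙 _ ∧ NearIntegral A c (r ≫ a) ∧
      y = r (IsLocalRing.closedPoint k)}) :
    IsArithmeticallySpecial k (symPower m w) (symPower.toBase m w) := by
  obtain ⟨e, he⟩ := h.exists_iso
  have sqA := A.isPullback c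
  have : LocallyOfFiniteType (A.snd c) := MorphismProperty.of_isPullback sqA inferInstance
  have : QuasiCompact (A.snd c) := MorphismProperty.of_isPullback sqA inferInstance
  have : IsSeparated (A.snd c) := MorphismProperty.of_isPullback sqA inferInstance
  have sq1 := A.isPullback_lift sqM
  let i : pullback (A.snd c) (specToSubring k A.1) ≅ Mk := (sq1.isoPullback).symm
  have hi1 : i.hom ≫ A.lift sqM = pullback.fst _ _ := sq1.isoPullback_inv_fst
  have hi2 : i.hom ≫ ck = pullback.snd _ _ := sq1.isoPullback_inv_snd
  let i' := Scheme.forgetToLocallyRingedSpace.mapIso i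
  refine ⟨A.1, A.2.2, A.baseChange c, A.snd c, inferInstance, inferInstance, inferInstance,
    i' ≪≫ e, ?_, ?_⟩
  · refine (Category.assoc _ _ _).trans ((congr_arg (i.hom.toLRSHom ≫ ·) he).trans ?_)
    exact congr(($hi2).toLRSHom)
  · have hhom : Dense (e.hom.base '' {y : Mk | ∃ r : Spec (.of k) ⟶ Mk, r ≫ ck = 𝟙 _ ∧
        NearIntegral A c (r ≫ a) ∧ y = r (IsLocalRing.closedPoint k)}) := by
      have : Function.Surjective e.hom.base :=
        (TopCat.epi_iff_surjective _).mp (inferInstanceAs (Epi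
          ((LocallyRingedSpace.forgetToTop.mapIso e).hom)))
      exact this.denseRange.dense_image e.hom.base.hom.continuous hd
    refine hhom.mono ?_
    rintro _ ⟨_, ⟨r, hr, ⟨P, hPy, hPc, hQ⟩, rfl⟩, rfl⟩
    refine ⟨sqA.lift P (Spec.map (CommRingCat.ofHom (algebraMap A.1 (FractionRing A.1)))) hPc,
      ⟨sqA.lift_snd _ _ _, fun p _ hp => ?_⟩, r ≫ i.inv, ?_, ?_, IsLocalRing.closedPoint k, ?_⟩
    · obtain ⟨Q, hQc, hQP⟩ := hQ p hp
      refine ⟨sqA.lift Q _ hQc, sqA.lift_snd _ _ _, sqA.hom_ext ?_ ?_⟩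
      · rw [Category.assoc, sqA.lift_fst, sqA.lift_fst, hQP]
      · rw [Category.assoc, sqA.lift_snd, sqA.lift_snd, specFractionToLocal_comp]
    · rw [← hi1, Category.assoc, Iso.inv_hom_id_assoc]
      refine sqA.hom_ext ?_ ?_
      · rw [Category.assoc, A.lift_fst, Category.assoc, sqA.lift_fst, hPy]
      · rw [Category.assoc, A.lift_snd, Category.assoc, sqA.lift_snd, ← Category.assoc, hr,
          Category.id_comp, specToFraction_comp]
    · rw [← hi2, Category.assoc, Iso.inv_hom_id_assoc, hr]
    · change e.hom.base (r _) = e.hom.base (i.hom ((r ≫ i.inv) _))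
      congr 1
      have : (r ≫ i.inv) ≫ i.hom = r := by rw [Category.assoc, Iso.inv_hom_id, Category.comp_id]
      exact congr($this _).symm
end

/-! ### Rational points and density in fibre powers of X × ℙ¹. -/

section
variable {R : Type u} [CommRing R] {X T T' : Scheme.{u}} (f : X ⟶ Spec (.of R))

/-- The point of `X × ℙ¹` with given first component and coordinate. -/
def linePoint (x : T ⟶ X) (t : Γ(T, ⊤)) : T ⟶ pullback f (projectiveSpace.toSpec 1 R) :=
  pullback.lift x (toProjectiveLine (x ≫ f) t) (toProjectiveLine_toSpec _ _).symm

lemma linePoint_fst (x : T ⟶ X) (t : Γ(T, ⊤)) : linePoint f x t ≫ pullback.fst _ _ = x :=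
  pullback.lift_fst _ _ _

lemma linePoint_snd (x : T ⟶ X) (t : Γ(T, ⊤)) :
    linePoint f x t ≫ pullback.snd _ _ = toProjectiveLine (x ≫ f) t := pullback.lift_snd _ _ _

lemma comp_linePoint (g : T' ⟶ T) (x : T ⟶ X) (t : Γ(T, ⊤)) :
    g ≫ linePoint f x t = linePoint f (g ≫ x) (g.appTop t) := by
  apply pullback.hom_ext
  · rw [Category.assoc, linePoint_fst, linePoint_fst]
  · rw [Category.assoc, linePoint_snd, linePoint_snd, comp_toProjectiveLine, Category.assoc]
end

section
variable {k : Type u} [Field k]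

lemma bijective_constMap_id : Function.Bijective (constMap (𝟙 (Spec (.of k))) ⊤) := by
  have : CommRingCat.ofHom (constMap (𝟙 (Spec (.of k))) ⊤) = (Scheme.ΓSpecIso (.of k)).inv := by
    change (Scheme.ΓSpecIso (.of k)).inv ≫ Scheme.Hom.appLE _ ⊤ ⊤ _ = _
    have e : Scheme.Hom.appLE (𝟙 (Spec (.of k))) ⊤ ⊤ (le_preimage_top _ ⊤) = 𝟙 _ :=
      (Category.id_comp _).trans ((Spec (.of k)).presheaf.map_id _)
    exact (congr_arg _ e).trans (Category.comp_id _)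
  have h : IsIso (CommRingCat.ofHom (constMap (𝟙 (Spec (.of k))) ⊤)) := by rw [this]; infer_instance
  exact (ConcreteCategory.isIso_iff_bijective _).mp h

lemma appTop_constMap_id {B : Type u} [CommRing B] (φ : B →+* k) (b : B) :
    (Spec.map (CommRingCat.ofHom φ)).appTop (constMap (𝟙 (Spec (.of B))) ⊤ b) =
      constMap (𝟙 (Spec (.of k))) ⊤ (φ b) := by
  have h1 := congr($(constMap_comp_appTop (Spec.map (CommRingCat.ofHom φ)) (𝟙 (Spec (.of B)))) b)
  refine h1.trans ?_
  have h2 := congr($(constMap_comp (𝟙 (Spec (.of k))) φ ⊤) b)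
  rw [Category.id_comp] at h2
  rw [Category.comp_id]
  exact h2

variable {X : Scheme.{u}}

/-- Closed points are dense in every locally closed subset of a Jacobson space, and over an
algebraically closed field they are rational. -/
lemma exists_section_mem [IsAlgClosed k] (f : X ⟶ Spec (.of k)) [LocallyOfFiniteType f] {O : Set X}
    (hO : IsLocallyClosed O) (hne : O.Nonempty) :
    ∃ e : Spec (.of k) ⟶ X, e ≫ f = 𝟙 _ ∧ e (IsLocalRing.closedPoint k) ∈ O := by
  have : JacobsonSpace X := LocallyOfFiniteType.jacobsonSpace f
  obtain ⟨x, hxO, hx⟩ := nonempty_inter_closedPoints hne hO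
  refine ⟨pointOfClosedPoint f x hx, pointOfClosedPoint_comp f x hx, ?_⟩
  exact (pointOfClosedPoint_apply f x hx _).symm ▸ hxO

variable {m : ℕ}

/-- The point of the fibre power given by a family of rational points. -/
def tuplePoint {w : X ⟶ Spec (.of k)} (ω : Fin m → (Spec (.of k) ⟶ X)) (hω : ∀ i, ω i ≫ w = 𝟙 _) :
    power m w := power.lift (𝟙 _) ω hω (IsLocalRing.closedPoint k)

lemma lift_apply_eq_tuplePoint {w : X ⟶ Spec (.of k)} {T : Scheme.{u}} (b : T ⟶ Spec (.of k))
    (q : Fin m → (T ⟶ X)) (hq : ∀ i, q i ≫ w = b) (e : Spec (.of k) ⟶ T) (he : e ≫ b = 𝟙 _) :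
    power.lift b q hq (e (IsLocalRing.closedPoint k)) = tuplePoint (w := w) (fun i => e ≫ q i)
      (fun i => by rw [Category.assoc, hq, he]) := by
  have : e ≫ power.lift b q hq = power.lift (𝟙 _) (fun i => e ≫ q i)
      (fun i => by rw [Category.assoc, hq, he]) :=
    power.hom_ext (fun i => by rw [Category.assoc, power.lift_proj, power.lift_proj])
      (by rw [Category.assoc, power.lift_toBase, power.lift_toBase, he])
  exact congr($this _)

/-- A family of tuples parametrized by T lies in the closed set Z if it does so for parameters
meeting every nonempty open subset of T. All later specializations take this form, with T an affine
space, X or ℙ¹. -/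
lemma tuplePoint_mem_of_dense {w : X ⟶ Spec (.of k)} {Z : Set (power m w)} (hZ : IsClosed Z)
    {T : Scheme.{u}} (b : T ⟶ Spec (.of k))
    (q : Fin m → (T ⟶ X)) (hq : ∀ i, q i ≫ w = b)
    (h : ∀ O : T.Opens, (O : Set T).Nonempty → ∃ (e : Spec (.of k) ⟶ T) (he : e ≫ b = 𝟙 _),
      e (IsLocalRing.closedPoint k) ∈ O ∧ tuplePoint (w := w) (fun i => e ≫ q i)
        (fun i => by rw [Category.assoc, hq, he]) ∈ Z)
    (e : Spec (.of k) ⟶ T) (he : e ≫ b = 𝟙 _) : tuplePoint (w := w) (fun i => e ≫ q i)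
        (fun i => by rw [Category.assoc, hq, he]) ∈ Z := by
  by_contra hn
  obtain ⟨e', he', hO, hZ'⟩ := h ⟨power.lift b q hq ⁻¹' Zᶜ,
    hZ.isOpen_compl.preimage (power.lift b q hq).continuous⟩ ⟨e (IsLocalRing.closedPoint k), by
      change power.lift b q hq _ ∈ Zᶜ
      rw [lift_apply_eq_tuplePoint b q hq e he]
      exact hn⟩
  rw [← lift_apply_eq_tuplePoint b q hq e' he'] at hZ'
  exact hO hZ'

lemma eq_univ_of_tuplePoint_mem [IsAlgClosed k] {w : X ⟶ Spec (.of k)} [LocallyOfFiniteType w]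
    {Z : Set (power m w)} (hZ : IsClosed Z) (h : ∀ ω hω, tuplePoint (w := w) ω hω ∈ Z) :
    Z = Set.univ := by
  by_contra hne
  have : LocallyOfFiniteType (power.toBase m w) :=
    power.toBase_property m @LocallyOfFiniteType w inferInstance
  obtain ⟨e, he, hO⟩ := exists_section_mem (power.toBase m w) hZ.isOpen_compl.isLocallyClosed
    (Set.nonempty_compl.mpr hne)
  have hω i : (e ≫ power.proj m w i) ≫ w = 𝟙 _ := by rw [Category.assoc, power.proj_comp, he]
  refine hO ?_
  have e' : power.lift (𝟙 _) (fun i => e ≫ power.proj m w i) hω = e :=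
    power.hom_ext (fun i => by rw [power.lift_proj]) (by rw [power.lift_toBase, he])
  have := h (fun i => e ≫ power.proj m w i) hω
  unfold tuplePoint at this
  rwa [e'] at this

/-- A nonzero polynomial over a field of characteristic zero cannot vanish at all integer vectors.
-/
lemma exists_int_eval_mem [CharZero k] (O : (Spec (.of (MvPolynomial (Fin m) k))).Opens)
    (hO : (O : Set (Spec (.of (MvPolynomial (Fin m) k)))).Nonempty) : ∃ c : Fin m → ℤ,
      Spec.map (CommRingCat.ofHom (MvPolynomial.eval (fun i => (c i : k))))
        (IsLocalRing.closedPoint k) ∈ O := by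
  obtain ⟨x, hx⟩ := hO
  obtain ⟨_, ⟨p, rfl⟩, hxp, hpO⟩ := (PrimeSpectrum.isTopologicalBasis_basic_opens
    (R := MvPolynomial (Fin m) k)).exists_subset_of_mem_open hx O.2
  have hp : p ≠ 0 := fun h => hxp (h ▸ zero_mem _)
  have : ∃ c : Fin m → ℤ, MvPolynomial.eval (fun i => (c i : k)) p ≠ 0 := by
    by_contra! h
    refine hp (MvPolynomial.funext_set (fun _ => Set.range ((↑) : ℤ → k))
      (fun _ => Set.infinite_range_of_injective Int.cast_injective) fun x hx => ?_)
    choose c hc using fun i => hx i trivial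
    rw [map_zero, ← h c]
    congr 2
    exact funext fun i => (hc i).symm
  obtain ⟨c, hc⟩ := this
  refine ⟨c, hpO ?_⟩
  intro h
  have : MvPolynomial.eval (fun i => (c i : k)) p ∈ IsLocalRing.maximalIdeal k := h
  rw [IsLocalRing.maximalIdeal_eq_bot] at this
  exact hc this

variable (f : X ⟶ Spec (.of k))

lemma linePoint_comp {T : Scheme.{u}} {x : T ⟶ X} {t : Γ(T, ⊤)} {b : T ⟶ Spec (.of k)}
    (h : x ≫ f = b) : linePoint f x t ≫ pullback.fst f (projectiveSpace.toSpec 1 k) ≫ f = b := by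
  rw [← Category.assoc, linePoint_fst, h]

/-- The coordinate tuples `a c` with c integral are dense in k^m, since integer vectors are dense
and `a` is invertible. -/
lemma tuplePoint_linePoint_mem [CharZero k]
    {Z : Set (power m (pullback.fst f (projectiveSpace.toSpec 1 k) ≫ f))} (hZ : IsClosed Z)
    (ξ : Fin m → (Spec (.of k) ⟶ X)) (hξ : ∀ i, ξ i ≫ f = 𝟙 _) (a : Matrix (Fin m) (Fin m) k)
    (ha : IsUnit a.det)
    (h : ∀ c : Fin m → ℤ, tuplePoint (w := pullback.fst f (projectiveSpace.toSpec 1 k) ≫ f)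
      (fun i => linePoint f (ξ i) (constMap (𝟙 _) ⊤ (a.mulVec (fun j => (c j : k)) i)))
      (fun i => linePoint_comp f (hξ i)) ∈ Z) (t : Fin m → k) :
    tuplePoint (w := pullback.fst f (projectiveSpace.toSpec 1 k) ≫ f)
      (fun i => linePoint f (ξ i) (constMap (𝟙 _) ⊤ (t i)))
      (fun i => linePoint_comp f (hξ i)) ∈ Z := by
  let b : Spec (.of (MvPolynomial (Fin m) k)) ⟶ Spec (.of k) :=
    Spec.map (CommRingCat.ofHom MvPolynomial.C)
  let e (c : Fin m → k) : Spec (.of k) ⟶ Spec (.of (MvPolynomial (Fin m) k)) :=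
    Spec.map (CommRingCat.ofHom (MvPolynomial.eval c))
  have he c : e c ≫ b = 𝟙 _ := by
    rw [← Spec.map_comp, ← CommRingCat.ofHom_comp, show (MvPolynomial.eval c).comp
      MvPolynomial.C = RingHom.id k from RingHom.ext fun x => MvPolynomial.eval_C x]
    exact Spec.map_id _
  -- The universal coordinates: the i-th linear form with coefficients in row i of `a`, over affine
  -- m-space.
  let q (i : Fin m) := linePoint f (b ≫ ξ i) (constMap (𝟙 _) ⊤
    (∑ j, MvPolynomial.C (a i j) * MvPolynomial.X j))
  have hq i : q i ≫ pullback.fst f (projectiveSpace.toSpec 1 k) ≫ f = b :=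
    linePoint_comp f (by rw [Category.assoc, hξ, Category.comp_id])
  have heq c i : e c ≫ q i = linePoint f (ξ i) (constMap (𝟙 _) ⊤ (a.mulVec c i)) := by
    unfold q
    rw [comp_linePoint, ← Category.assoc, he, Category.id_comp]
    congr 1
    refine (appTop_constMap_id _ _).trans ?_
    congr 1
    simp [Matrix.mulVec, dotProduct]
  obtain ⟨c, rfl⟩ : ∃ c, a.mulVec c = t := ⟨a⁻¹.mulVec t, by
    rw [Matrix.mulVec_mulVec, Matrix.mul_nonsing_inv _ ha, Matrix.one_mulVec]⟩
  have key := tuplePoint_mem_of_dense hZ b q hq (fun O hO => by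
    obtain ⟨c, hc⟩ := exists_int_eval_mem O hO
    refine ⟨e _, he _, hc, ?_⟩
    simp only [heq]
    exact h c) (e c) (he c)
  simp only [heq] at key
  exact key

lemma exists_toProjectiveLine_mem [IsAlgClosed k] (O : (projectiveSpace 1 k).Opens)
    (hO : (O : Set (projectiveSpace 1 k)).Nonempty) :
    ∃ t : k, toProjectiveLine (𝟙 _) (constMap (𝟙 _) ⊤ t) (IsLocalRing.closedPoint k) ∈ O := by
  obtain ⟨x, hx⟩ := (projectiveLine.denseRange_chart k).inter_open_nonempty O O.2 hO
  obtain ⟨e, he, hO'⟩ := exists_section_mem (projectiveSpace.toSpec 1 k)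
    (O := O ∩ Set.range (projectiveLine.chart k))
    (O.2.inter (projectiveLine.chart k).isOpenEmbedding.isOpen_range).isLocallyClosed ⟨x, hx⟩
  obtain ⟨t, ht⟩ := exists_eq_toProjectiveLine (𝟙 _) e he (by
    rintro _ ⟨y, rfl⟩
    rw [Subsingleton.elim y (IsLocalRing.closedPoint k)]
    exact hO'.2)
  obtain ⟨t, rfl⟩ := bijective_constMap_id.2 t
  exact ⟨t, ht ▸ hO'.1⟩

/-- Components are moved to general position one at a time, which uses only the irreducibility of X
and the density of the affine chart in ℙ¹. `Good` and `Rel` stand for open conditions on single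
components and on pairs. -/
theorem eq_univ_of_tuplePoint_linePoint_mem [IsAlgClosed k] [LocallyOfFiniteType f]
    [IrreducibleSpace X]
    {Z : Set (power m (pullback.fst f (projectiveSpace.toSpec 1 k) ≫ f))} (hZ : IsClosed Z)
    (Good : (Spec (.of k) ⟶ X) → Prop) (Rel : (Spec (.of k) ⟶ X) → (Spec (.of k) ⟶ X) → Prop)
    (hdense : ∀ s : Set (Spec (.of k) ⟶ X), s.Finite → ∃ O : X.Opens, (O : Set X).Nonempty ∧
      ∀ e : Spec (.of k) ⟶ X, e ≫ f = 𝟙 _ → e (IsLocalRing.closedPoint k) ∈ O →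
        Good e ∧ ∀ e' ∈ s, Rel e e' ∧ Rel e' e)
    (h : ∀ (ξ : Fin m → (Spec (.of k) ⟶ X)) (hξ : ∀ i, ξ i ≫ f = 𝟙 _), (∀ i, Good (ξ i)) →
      (∀ i j, i ≠ j → Rel (ξ i) (ξ j)) → ∀ t : Fin m → k,
      tuplePoint (w := pullback.fst f (projectiveSpace.toSpec 1 k) ≫ f)
      (fun i => linePoint f (ξ i) (constMap (𝟙 _) ⊤ (t i)))
      (fun i => linePoint_comp f (hξ i)) ∈ Z) : Z = Set.univ := by
  classical
  refine eq_univ_of_tuplePoint_mem hZ fun ω hω => ?_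
  -- J is the set of components that are still arbitrary; it is everything at the end and empty in
  -- the base case.
  have key : ∀ (J : Finset (Fin m)) (ω : Fin m → (Spec (.of k) ⟶ _)) hω,
      (∀ i ∉ J, Good (ω i ≫ pullback.fst f (projectiveSpace.toSpec 1 k)) ∧ ∃ t : k,
        ω i = linePoint f (ω i ≫ pullback.fst f (projectiveSpace.toSpec 1 k)) (constMap (𝟙 _) ⊤ t)) →
      (∀ i ∉ J, ∀ j ∉ J, i ≠ j → Rel (ω i ≫ pullback.fst f (projectiveSpace.toSpec 1 k))
        (ω j ≫ pullback.fst f (projectiveSpace.toSpec 1 k))) →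
      tuplePoint (w := pullback.fst f (projectiveSpace.toSpec 1 k) ≫ f) ω hω ∈ Z := by
    intro J
    induction J using Finset.induction_on with
    | empty =>
      intro ω hω h1 h2
      have hω' i : (ω i ≫ pullback.fst f (projectiveSpace.toSpec 1 k)) ≫ f = 𝟙 _ := by
        rw [Category.assoc, hω]
      choose t ht using fun i => (h1 i (by simp)).2
      have := h _ hω' (fun i => (h1 i (by simp)).1)
        (fun i j hij => h2 i (by simp) j (by simp) hij) t
      simp only [← ht] at this
      exact this
    | insert a J ha ih =>
      intro ω hω h1 h2
      obtain ⟨v, hv₀⟩ : ∃ v, v = ω a ≫ pullback.snd f (projectiveSpace.toSpec 1 k) := ⟨_, rfl⟩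
      have hv : v ≫ projectiveSpace.toSpec 1 k = 𝟙 _ := by
        rw [hv₀, Category.assoc, ← pullback.condition, hω]
      -- The X-coordinate of component a varies over X, with its ℙ¹-coordinate v and the other
      -- components fixed.
      let q (i : Fin m) : X ⟶ pullback f (projectiveSpace.toSpec 1 k) :=
        if i = a then pullback.lift (𝟙 X) (f ≫ v) (by
          rw [Category.assoc, hv, Category.comp_id, Category.id_comp]) else f ≫ ω i
      have hq i : q i ≫ pullback.fst f (projectiveSpace.toSpec 1 k) ≫ f = f := by
        unfold q
        split_ifs
        · rw [pullback.lift_fst_assoc, Category.id_comp]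
        · rw [Category.assoc, hω, Category.comp_id]
      have hωq i : (ω a ≫ pullback.fst f (projectiveSpace.toSpec 1 k)) ≫ q i = ω i := by
        unfold q
        split_ifs with hi
        · subst hi
          apply pullback.hom_ext
          · rw [Category.assoc, pullback.lift_fst, Category.comp_id]
          · rw [Category.assoc, pullback.lift_snd, ← Category.assoc, Category.assoc (ω i), hω,
              Category.id_comp, hv₀]
        · rw [← Category.assoc, Category.assoc (ω a), hω, Category.id_comp]
      have := tuplePoint_mem_of_dense hZ f q hq (fun O hO => ?_)
        (ω a ≫ pullback.fst f (projectiveSpace.toSpec 1 k)) (by rw [Category.assoc, hω])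
      · simp only [hωq] at this
        exact this
      obtain ⟨O', hO', hgood⟩ := hdense
        (Set.range fun i => ω i ≫ pullback.fst f (projectiveSpace.toSpec 1 k)) (Set.finite_range _)
      obtain ⟨x, hx⟩ := nonempty_preirreducible_inter O.2 O'.2 hO hO'
      obtain ⟨e, he, heO⟩ := exists_section_mem f (O.2.inter O'.2).isLocallyClosed ⟨x, hx⟩
      refine ⟨e, he, heO.1, ?_⟩
      obtain ⟨hg, hr⟩ := hgood e he heO.2
      -- With the X-coordinate now at a general point e, the ℙ¹-coordinate varies until it lies in
      -- the affine chart.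
      let q' (i : Fin m) : projectiveSpace 1 k ⟶ pullback f (projectiveSpace.toSpec 1 k) :=
        if i = a then pullback.lift (projectiveSpace.toSpec 1 k ≫ e) (𝟙 _) (by
          rw [Category.assoc, he, Category.comp_id, Category.id_comp])
        else projectiveSpace.toSpec 1 k ≫ ω i
      have hq' i : q' i ≫ pullback.fst f (projectiveSpace.toSpec 1 k) ≫ f =
          projectiveSpace.toSpec 1 k := by
        unfold q'
        split_ifs
        · rw [pullback.lift_fst_assoc, Category.assoc, he, Category.comp_id]
        · rw [Category.assoc, hω, Category.comp_id]
      have hqq i : v ≫ q' i = e ≫ q i := by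
        unfold q q'
        split_ifs
        · apply pullback.hom_ext
          · rw [Category.assoc, pullback.lift_fst, Category.assoc, pullback.lift_fst,
              ← Category.assoc, hv, Category.comp_id, Category.id_comp]
          · rw [Category.assoc, pullback.lift_snd, Category.assoc, pullback.lift_snd,
              ← Category.assoc, he, Category.comp_id, Category.id_comp]
        · rw [← Category.assoc, hv, ← Category.assoc, he]
      have := tuplePoint_mem_of_dense hZ (projectiveSpace.toSpec 1 k) q' hq' (fun U hU => ?_) v hv
      · simp only [hqq] at this
        exact this
      obtain ⟨t, ht⟩ := exists_toProjectiveLine_mem U hU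
      refine ⟨_, toProjectiveLine_toSpec _ _, ht, ih _ _ ?_ ?_⟩
      all_goals
        have hne : ∀ i ≠ a, toProjectiveLine (𝟙 _) (constMap (𝟙 _) ⊤ t) ≫ q' i = ω i := fun i hi => by
          unfold q'
          rw [if_neg hi, ← Category.assoc, toProjectiveLine_toSpec, Category.id_comp]
        have heq : toProjectiveLine (𝟙 _) (constMap (𝟙 _) ⊤ t) ≫ q' a =
            linePoint f e (constMap (𝟙 _) ⊤ t) := by
          unfold q'
          rw [if_pos rfl]
          apply pullback.hom_ext
          · rw [Category.assoc, pullback.lift_fst, linePoint_fst, ← Category.assoc,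
              toProjectiveLine_toSpec, Category.id_comp]
          · rw [Category.assoc, pullback.lift_snd, linePoint_snd, Category.comp_id, he]
      · intro i hi
        by_cases hia : i = a
        · subst hia
          rw [heq, linePoint_fst]
          exact ⟨hg, t, rfl⟩
        · rw [hne i hia]
          exact h1 i (by simp [hia, hi])
      · intro i hi j hj hij
        by_cases hia : i = a
        · subst hia
          rw [heq, linePoint_fst, hne j hij.symm]
          exact (hr _ ⟨j, rfl⟩).1
        · by_cases hja : j = a
          · subst hja
            rw [heq, linePoint_fst, hne i hij]
            exact (hr _ ⟨i, rfl⟩).2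
          · rw [hne i hia, hne j hja]
            exact h2 i (by simp [hia, hi]) j (by simp [hja, hj]) hij
  exact key Finset.univ ω hω (by simp) (by simp)
end

/-! ### Base change of X × ℙ¹ and nonconstant functions. -/

section
variable {R B : Type u} [CommRing R] [CommRing B] {φ : R →+* B} {X 𝒳 : Scheme.{u}}
  {f : X ⟶ Spec (.of B)} {F : 𝒳 ⟶ Spec (.of R)} {g : X ⟶ 𝒳}
  (sq : IsPullback g f F (Spec.map (CommRingCat.ofHom φ)))

/-- The base change morphism between the products with the projective line. -/
def lineBaseChange : pullback f (projectiveSpace.toSpec 1 B) ⟶ pullback F (projectiveSpace.toSpec 1 R) :=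
  pullback.lift (pullback.fst _ _ ≫ g) (pullback.snd _ _ ≫ projectiveSpace.map 1 φ) (by
    rw [Category.assoc, sq.w, ← Category.assoc, pullback.condition, Category.assoc,
      ← (projectiveSpace.isPullback_map 1 φ).w, Category.assoc])

lemma lineBaseChange_fst : lineBaseChange sq ≫ pullback.fst _ _ = pullback.fst _ _ ≫ g :=
  pullback.lift_fst _ _ _

lemma lineBaseChange_snd : lineBaseChange sq ≫ pullback.snd _ _ =
    pullback.snd _ _ ≫ projectiveSpace.map 1 φ := pullback.lift_snd _ _ _

lemma isPullback_lineBaseChange : IsPullback (lineBaseChange sq)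
    (pullback.fst f (projectiveSpace.toSpec 1 B) ≫ f)
    (pullback.fst F (projectiveSpace.toSpec 1 R) ≫ F) (Spec.map (CommRingCat.ofHom φ)) := by
  have h1 := (IsPullback.of_hasPullback f (projectiveSpace.toSpec 1 B)).flip.paste_horiz
    (projectiveSpace.isPullback_map 1 φ)
  rw [← sq.w, ← lineBaseChange_snd sq] at h1
  exact (IsPullback.of_right h1 (lineBaseChange_fst sq)
    (IsPullback.of_hasPullback F (projectiveSpace.toSpec 1 R)).flip).paste_vert sq

lemma linePoint_lineBaseChange {T : Scheme.{u}} (x : T ⟶ X) (t : Γ(T, ⊤)) :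
    linePoint f x t ≫ lineBaseChange sq = linePoint F (x ≫ g) t := by
  apply pullback.hom_ext
  · rw [Category.assoc, lineBaseChange_fst, linePoint_fst, ← Category.assoc, linePoint_fst]
  · rw [Category.assoc, lineBaseChange_snd, linePoint_snd, ← Category.assoc, linePoint_snd,
      toProjectiveLine_map, Category.assoc, Category.assoc, sq.w]
end

lemma constMap_top {R : Type u} [CommRing R] {X : Scheme.{u}} (f : X ⟶ Spec (.of R)) :
    CommRingCat.ofHom (constMap f ⊤) = (Scheme.ΓSpecIso (.of R)).inv ≫ f.appTop := by
  change (Scheme.ΓSpecIso (.of R)).inv ≫ f.appLE ⊤ ⊤ (le_preimage_top f ⊤) = _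
  rw [Scheme.Hom.appTop, Scheme.Hom.app_eq_appLE]
  rfl

lemma exists_sum_constMap_of_isPullback {R B : Type u} [CommRing R] [CommRing B] {φ : R →+* B}
    {V 𝒱 : Scheme.{u}} [IsAffine 𝒱]
    {f : V ⟶ Spec (.of B)} {F : 𝒱 ⟶ Spec (.of R)} {g : V ⟶ 𝒱}
    (sq : IsPullback g f F (Spec.map (CommRingCat.ofHom φ))) (x : Γ(V, ⊤)) :
    ∃ s : Finset (Γ(𝒱, ⊤) × B), x = ∑ p ∈ s, g.appTop p.1 * constMap f ⊤ p.2 := by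
  classical
  obtain ⟨s, rfl⟩ := exists_sum_of_isPushout (isPushout_appTop_of_isPullback sq) x
  let q (p : Γ(𝒱, ⊤) × Γ(Spec (.of B), ⊤)) : Γ(𝒱, ⊤) × B := (p.1, (Scheme.ΓSpecIso (.of B)).hom p.2)
  have hinj : Function.Injective q := by
    rintro ⟨a, b⟩ ⟨a', b'⟩ h
    have h1 := (Prod.ext_iff.mp h).1
    have h2 := (ConcreteCategory.bijective_of_isIso (Scheme.ΓSpecIso (.of B)).hom).1
      (Prod.ext_iff.mp h).2
    exact Prod.ext h1 h2
  refine ⟨s.image q, ?_⟩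
  rw [Finset.sum_image fun _ _ _ _ h => hinj h]
  refine Finset.sum_congr rfl fun p _ => ?_
  congr 1
  refine Eq.trans ?_ congr($(constMap_top f) ((Scheme.ΓSpecIso (.of B)).hom p.2)).symm
  exact congr(f.appTop ($((Scheme.ΓSpecIso (.of B)).hom_inv_id) p.2)).symm

/-- A variety over a field is a point if the functions on a nonempty affine open that come from a model
are all constant. -/
lemma exists_forall_appTop_ne_constMap {R k : Type u} [CommRing R] [Field k] {φ : R →+* k}
    {V X 𝒱 : Scheme.{u}} [IsAffine 𝒱] [IrreducibleSpace X] [Nonempty V]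
    {f : X ⟶ Spec (.of k)} {F : 𝒱 ⟶ Spec (.of R)} {g : V ⟶ 𝒱} (v : V ⟶ X)
    [IsOpenImmersion v] (sq : IsPullback g (v ≫ f) F (Spec.map (CommRingCat.ofHom φ)))
    (hf : ¬ IsIso f) : ∃ h : Γ(𝒱, ⊤), ∀ a, g.appTop h ≠ constMap (v ≫ f) ⊤ a := by
  by_contra! hc
  choose a ha using hc
  have hV : IsAffine V := .of_isPullback sq
  -- Functions on V are combinations over the field of functions from the model, so if those are
  -- constant then V is a rational point.
  have hbij : Function.Bijective (constMap (v ≫ f) ⊤) := by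
    have : Nonempty (⊤ : V.Opens) := ⟨⟨Classical.arbitrary V, trivial⟩⟩
    have : Nontrivial Γ(V, ⊤) := Scheme.component_nontrivial V ⊤
    refine ⟨RingHom.injective _, fun x => ?_⟩
    obtain ⟨s, rfl⟩ := exists_sum_constMap_of_isPullback sq x
    refine ⟨∑ p ∈ s, a p.1 * p.2, ?_⟩
    rw [map_sum]
    refine Finset.sum_congr rfl fun p _ => ?_
    rw [map_mul, ← ha]
  have hiso : IsIso (v ≫ f) := by
    rw [← toSpecΓ_SpecMap_constMap (v ≫ f)]
    have : IsIso (CommRingCat.ofHom (constMap (v ≫ f) ⊤)) :=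
      (ConcreteCategory.isIso_iff_bijective _).mpr hbij
    infer_instance
  have hs : (inv (v ≫ f) ≫ v) ≫ f = 𝟙 _ := by rw [Category.assoc, IsIso.inv_hom_id]
  have hcl := isClosedImmersion_of_comp_eq_id _ _ hs
  -- The resulting point is open as V and closed as a section, so it is all of the irreducible X.
  have hrange : Set.range (inv (v ≫ f) ≫ v) = Set.univ :=
    IsClopen.eq_univ ⟨(inv (v ≫ f) ≫ v).isClosedEmbedding.isClosed_range,
      (inv (v ≫ f) ≫ v).isOpenEmbedding.isOpen_range⟩ (Set.range_nonempty _)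
  have : IsIso (inv (v ≫ f) ≫ v) :=
    isIso_of_isOpenImmersion_of_opensRange_eq_top _ (Opens.ext hrange)
  have : IsIso ((inv (v ≫ f) ≫ v) ≫ f) := by rw [hs]; infer_instance
  exact hf (IsIso.of_isIso_comp_left (inv (v ≫ f) ≫ v) f)

lemma ringHom_flat_of_field {K L : Type*} [Field K] [Field L] (ψ : K →+* L) : ψ.Flat := by
  let _ := ψ.toAlgebra
  change Module.Flat K L
  infer_instance

/-- The inclusion factors through the fraction field: a localization followed by a field extension.
-/
instance flat_specToSubring {k : Type u} [Field k] (A : Subalgebra ℤ k) : Flat (specToSubring k A) := by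
  unfold specToSubring
  rw [Flat.SpecMap_iff]
  have : Module.Flat A (FractionRing A) := IsLocalization.flat _ (nonZeroDivisors A)
  let ψ : FractionRing A →+* k := IsFractionRing.lift (A := A) (K := FractionRing A) (L := k)
    (g := algebraMap A k) Subtype.val_injective
  have h : (algebraMap A k) = ψ.comp (algebraMap A (FractionRing A)) :=
    RingHom.ext fun x => (IsFractionRing.lift_algebraMap (g := algebraMap A k)
      Subtype.val_injective x).symm
  have h1 : (algebraMap A (FractionRing A)).Flat := (RingHom.flat_algebraMap_iff).mpr this
  have h2 : ψ.Flat := ringHom_flat_of_field ψ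
  rw [CommRingCat.hom_ofHom, h]
  exact RingHom.Flat.comp h1 h2

lemma AffineFinite.of_isAffine (X : Scheme.{u}) [IsAffine X] : AffineFinite X := fun _ _ =>
  ⟨⊤, isAffineOpen_top X, fun _ _ => trivial⟩

/-! ### Lifting near-integral points along sections of 𝒳 × ℙ¹ → 𝒳. -/

section
variable {k : Type u} [Field k] {A₁ : Subalgebra ℤ k} {A : FGExtension A₁} {m : ℕ}
  {X 𝒳 : Scheme.{u}} {F : 𝒳 ⟶ Spec (.of A₁)} {N M : Scheme.{u}}
  {c : N ⟶ Spec (.of A₁)} {π : power m F ⟶ N} {c' : M ⟶ Spec (.of A₁)}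
  {π' : power m (pullback.fst F (projectiveSpace.toSpec 1 A₁) ≫ F) ⟶ M}

lemma power.map_map {X₁ X₂ X₃ S₁ S₂ S₃ : Scheme.{u}} {f₁ : X₁ ⟶ S₁} {f₂ : X₂ ⟶ S₂} {f₃ : X₃ ⟶ S₃}
    (g : X₁ ⟶ X₂) (s : S₁ ⟶ S₂) (h : g ≫ f₂ = f₁ ≫ s) (g' : X₂ ⟶ X₃) (s' : S₂ ⟶ S₃)
    (h' : g' ≫ f₃ = f₂ ≫ s') (g'' : X₁ ⟶ X₃) (s'' : S₁ ⟶ S₃) (h'' : g'' ≫ f₃ = f₁ ≫ s'')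
    (hg : g ≫ g' = g'') (hs : s ≫ s' = s'') :
    power.map m g s h ≫ power.map m g' s' h' = power.map m g'' s'' h'' := by
  subst hg hs
  refine power.hom_ext (fun i => ?_) ?_
  · rw [Category.assoc, power.map_proj, power.map_proj, ← Category.assoc, power.map_proj,
      Category.assoc]
  · rw [Category.assoc, power.map_toBase, power.map_toBase, ← Category.assoc, power.map_toBase,
      Category.assoc]

/-- A section of the projection `𝒳 × ℙ¹ ⟶ 𝒳` over an affine open preserves near-integrality. -/
lemma NearIntegral.of_section (hm : 0 < m) [IsLocallyNoetherian (Spec (.of A₁))]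
    [LocallyOfFiniteType F] [IsSeparated F]
    (hA : ∀ (p : Ideal A.1) [p.IsPrime], p.height = 1 → ValuationRing (Localization.AtPrime p))
    (hN : IsSymPower m F c π)
    (hM : IsSymPower m (pullback.fst F (projectiveSpace.toSpec 1 A₁) ≫ F) c' π')
    {𝒱 : Scheme.{u}} [IsAffine 𝒱] (j : 𝒱 ⟶ 𝒳) [IsOpenImmersion j]
    (σ : 𝒱 ⟶ pullback F (projectiveSpace.toSpec 1 A₁)) (hσ : σ ≫ pullback.fst _ _ = j)
    (hj' : j ≫ F = (j ≫ F) ≫ 𝟙 _)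
    (hσ' : σ ≫ pullback.fst F (projectiveSpace.toSpec 1 A₁) ≫ F = (j ≫ F) ≫ 𝟙 _)
    (e : Spec (.of k) ⟶ power m (j ≫ F))
    (he : NearIntegral A c (e ≫ power.map m j (𝟙 _) hj' ≫ π)) :
    NearIntegral A c' (e ≫ power.map m σ (𝟙 _) hσ' ≫ π') := by
  obtain ⟨N', cN, πN, hN'⟩ := exists_isSymPower hm (j ≫ F) (AffineFinite.of_isAffine 𝒱)
  have hpr : pullback.fst F (projectiveSpace.toSpec 1 A₁) ≫ F =
      (pullback.fst F (projectiveSpace.toSpec 1 A₁) ≫ F) ≫ 𝟙 _ := (Category.comp_id _).symm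
  obtain ⟨d, hd, hdc⟩ := hM.exists_map hN (pullback.fst F (projectiveSpace.toSpec 1 A₁)) hpr
  obtain ⟨dj, hdj, -⟩ := hN'.exists_map hN j hj'
  obtain ⟨s, hs, -⟩ := hN'.exists_map hM σ hσ'
  have : IsProper (pullback.fst F (projectiveSpace.toSpec 1 A₁)) := inferInstance
  have : IsProper d := hM.isProper hN hm _ hpr d hd hdc
  have : IsOpenImmersion dj := hN'.isOpenImmersion hN hm j hj' dj hdj
  -- The section of symmetric powers lies over the open immersion of Sym^m(𝒱), which is the
  -- situation of `NearIntegral.of_isProper`.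
  have hsd : s ≫ d = dj := by
    refine hN'.hom_ext ?_
    rw [← Category.assoc, hs, Category.assoc, hd, hdj, ← Category.assoc]
    congr 1
    exact power.map_map σ _ hσ' _ _ hpr j _ hj' hσ (Category.id_comp _)
  rw [← hs]
  rw [← hdj] at he
  rw [← Category.assoc] at he ⊢
  exact NearIntegral.of_isProper hA hdc hsd he
end

section
variable {k : Type u} [Field k] [IsAlgClosed k] {A₁ : Subalgebra ℤ k} {A : FGExtension A₁} {m : ℕ}
  {X 𝒳 : Scheme.{u}} {f : X ⟶ Spec (.of k)} {F : 𝒳 ⟶ Spec (.of A₁)} {g : X ⟶ 𝒳}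
  {N M Nk Mk : Scheme.{u}}
  {c : N ⟶ Spec (.of A₁)} {π : power m F ⟶ N} {c' : M ⟶ Spec (.of A₁)}
  {π' : power m (pullback.fst F (projectiveSpace.toSpec 1 A₁) ≫ F) ⟶ M}
  {a : Nk ⟶ N} {ck : Nk ⟶ Spec (.of k)} {a' : Mk ⟶ M} {ck' : Mk ⟶ Spec (.of k)}
  (sq : IsPullback g f F (specToSubring k A₁))
  (sqM : IsPullback a' ck' c' (specToSubring k A₁))

/-- The rational points given by near-integral points. -/
def nearIntegralSet (A : FGExtension A₁) (c : N ⟶ Spec (.of A₁)) (a : Nk ⟶ N)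
    (ck : Nk ⟶ Spec (.of k)) : Set Nk :=
  {y | ∃ r : Spec (.of k) ⟶ Nk, r ≫ ck = 𝟙 _ ∧ NearIntegral A c (r ≫ a) ∧
    y = r (IsLocalRing.closedPoint k)}

/-- If the image of x were outside Z, so would be that of an open set of tuples. Its image in
Sym^m(X) is open, hence contains a near-integral point; lifting that point along the section gives a
near-integral point outside Z. -/
lemma map_mem_of_nearIntegralSet_subset (hm : 0 < m) [IsLocallyNoetherian (Spec (.of A₁))]
    [LocallyOfFiniteType F] [IsSeparated F]
    (hA : ∀ (p : Ideal A.1) [p.IsPrime], p.height = 1 → ValuationRing (Localization.AtPrime p))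
    (hN : IsSymPower m F c π) (sqN : IsPullback a ck c (specToSubring k A₁))
    (hM : IsSymPower m (pullback.fst F (projectiveSpace.toSpec 1 A₁) ≫ F) c' π')
    (hD : Dense (nearIntegralSet A c a ck))
    {Z : Set Mk} (hZ : IsClosed Z) (hE : nearIntegralSet A c' a' ck' ⊆ Z)
    {V 𝒱 : Scheme.{u}} [IsAffine 𝒱] (j : 𝒱 ⟶ 𝒳) [IsOpenImmersion j] (v : V ⟶ X)
    [IsOpenImmersion v] {gV : V ⟶ 𝒱} (hv : v ≫ g = gV ≫ j) (t : Γ(𝒱, ⊤))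
    (hσ : linePoint f v (gV.appTop t) ≫ pullback.fst f (projectiveSpace.toSpec 1 k) ≫ f =
      (v ≫ f) ≫ 𝟙 _) (x : power m (v ≫ f)) :
    hM.baseChange (isPullback_lineBaseChange (φ := algebraMap A₁ k) sq) sqM
      (power.map m (linePoint f v (gV.appTop t)) (𝟙 _) hσ x) ∈ Z := by
  let σ := linePoint f v (gV.appTop t)
  let πN := hN.baseChange sq sqN
  let πM := hM.baseChange (isPullback_lineBaseChange (φ := algebraMap A₁ k) sq) sqM
  have hv' : v ≫ f = (v ≫ f) ≫ 𝟙 _ := (Category.comp_id _).symm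
  have : IsOpenImmersion (power.map m v (𝟙 _) hv') := power.isOpenImmersion_map m v hv' hm
  have : LocallyOfFiniteType f := MorphismProperty.of_isPullback sq inferInstance
  have : LocallyOfFiniteType (power.toBase m (v ≫ f)) :=
    power.toBase_property m @LocallyOfFiniteType _ inferInstance
  have hπN : IsSymPower m f ck πN := hN.isSymPower_baseChange sq sqN
  have : LocallyOfFiniteType c := hN.locallyOfFiniteType
  have : LocallyOfFiniteType ck := MorphismProperty.of_isPullback sqN inferInstance
  by_contra hx
  let O : Set (power m (v ≫ f)) := (power.map m σ (𝟙 _) hσ ≫ πM) ⁻¹' Zᶜ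
  have hO : IsOpen O := hZ.isOpen_compl.preimage (Scheme.Hom.continuous _)
  have hxO : x ∈ O := hx
  obtain ⟨_, ⟨y, hy, rfl⟩, r, hr, hrN, hyr⟩ := hD.inter_open_nonempty
    ((power.map m v (𝟙 _) hv' ≫ πN) '' O) (by
      have : IsOpenMap (power.map m v (𝟙 _) hv' ≫ πN) := by
        have h2 := hπN.isOpenMap.comp (power.map m v (𝟙 _) hv').isOpenEmbedding.isOpenMap
        exact h2
      exact this _ hO) ⟨_, x, hxO, rfl⟩
  have hrcl : IsClosed {r (IsLocalRing.closedPoint k)} := by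
    have := isClosedImmersion_of_comp_eq_id _ _ hr
    have := r.isClosedEmbedding.isClosed_range
    rwa [Set.range_eq_singleton] at this
    exact fun x => congr(r $(Subsingleton.elim _ _))
  -- The near-integral point r need not come with an ordering of its components; algebraic
  -- closedness provides a rational tuple over it inside the open set.
  obtain ⟨e, he, heO, her⟩ := exists_section_mem (power.toBase m (v ≫ f))
    (O := O ∩ (power.map m v (𝟙 _) hv' ≫ πN) ⁻¹' {r (IsLocalRing.closedPoint k)})
    (hO.isLocallyClosed.inter (hrcl.preimage (Scheme.Hom.continuous _)).isLocallyClosed)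
    ⟨y, hy, hyr⟩
  have her' : e ≫ power.map m v (𝟙 _) hv' ≫ πN = r := by
    refine ext_of_apply_closedPoint_eq ck ?_ hr her
    rw [Category.assoc, Category.assoc, hπN.comp, power.map_toBase, Category.comp_id, he]
  have hgV : gV ≫ j ≫ F = (v ≫ f) ≫ specToSubring k A₁ := by
    rw [← Category.assoc, ← hv, Category.assoc, sq.w, Category.assoc]
  have hj' : j ≫ F = (j ≫ F) ≫ 𝟙 _ := (Category.comp_id _).symm
  have hσ'0 : linePoint F j t ≫ pullback.fst F (projectiveSpace.toSpec 1 A₁) = j := linePoint_fst _ _ _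
  have hσ' : linePoint F j t ≫ pullback.fst F (projectiveSpace.toSpec 1 A₁) ≫ F = (j ≫ F) ≫ 𝟙 _ := by
    rw [← Category.assoc, hσ'0, Category.comp_id]
  have e1 : r ≫ a = (e ≫ power.map m gV _ hgV) ≫ power.map m j (𝟙 _) hj' ≫ π := by
    rw [← her', Category.assoc, Category.assoc, hN.baseChange_fst sq sqN, Category.assoc,
      ← Category.assoc (power.map m v _ _), ← Category.assoc (power.map m gV _ _),
      power.map_map v _ hv' g _ sq.w (v ≫ g) (specToSubring k A₁)
        (by rw [Category.assoc, sq.w, Category.assoc]) rfl (Category.id_comp _),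
      power.map_map gV _ hgV j _ hj' (v ≫ g) (specToSubring k A₁)
        (by rw [Category.assoc, sq.w, Category.assoc]) hv.symm (Category.comp_id _)]
  rw [e1] at hrN
  have key := NearIntegral.of_section hm hA hN hM j (linePoint F j t) hσ'0 hj' hσ' _ hrN
  have hcomm : σ ≫ lineBaseChange (φ := algebraMap A₁ k) sq = gV ≫ linePoint F j t := by
    refine (linePoint_lineBaseChange (φ := algebraMap A₁ k) sq v _).trans ?_
    rw [comp_linePoint, hv]
  have hw : (σ ≫ lineBaseChange (φ := algebraMap A₁ k) sq) ≫
      pullback.fst F (projectiveSpace.toSpec 1 A₁) ≫ F = (v ≫ f) ≫ specToSubring k A₁ := by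
    rw [hcomm, Category.assoc, hσ', Category.comp_id, hgV]
  have e2 : (e ≫ power.map m gV _ hgV) ≫ power.map m (linePoint F j t) (𝟙 _) hσ' ≫ π' =
      (e ≫ power.map m σ (𝟙 _) hσ ≫ πM) ≫ a' := by
    rw [Category.assoc, Category.assoc, Category.assoc,
      hM.baseChange_fst (isPullback_lineBaseChange (φ := algebraMap A₁ k) sq) sqM,
      ← Category.assoc (power.map m σ _ _), ← Category.assoc (power.map m gV _ _),
      power.map_map σ _ hσ _ _ (isPullback_lineBaseChange (φ := algebraMap A₁ k) sq).w _ _ hw rfl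
        (Category.id_comp _),
      power.map_map gV _ hgV _ _ hσ' _ _ hw hcomm.symm (Category.comp_id _)]
  rw [e2] at key
  refine heO (hE ⟨e ≫ power.map m σ (𝟙 _) hσ ≫ πM, ?_, key, rfl⟩)
  rw [Category.assoc, Category.assoc, hM.baseChange_snd (isPullback_lineBaseChange
    (φ := algebraMap A₁ k) sq) sqM, power.map_toBase, Category.comp_id, he]
end

/-! ### The Vandermonde argument. -/

section
variable {k : Type u} [Field k] {X Y : Scheme.{u}} {m : ℕ}

lemma map_tuplePoint {f : X ⟶ Spec (.of k)} {w : Y ⟶ Spec (.of k)} (σ : X ⟶ Y)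
    (hσ : σ ≫ w = f ≫ 𝟙 _) (ω : Fin m → (Spec (.of k) ⟶ X)) (hω : ∀ i, ω i ≫ f = 𝟙 _)
    (ω' : Fin m → (Spec (.of k) ⟶ Y)) (hω' : ∀ i, ω' i ≫ w = 𝟙 _) (h : ∀ i, ω i ≫ σ = ω' i) :
    power.map m σ (𝟙 _) hσ (tuplePoint ω hω) = tuplePoint ω' hω' := by
  have : power.lift (𝟙 _) ω hω ≫ power.map m σ (𝟙 _) hσ = power.lift (𝟙 _) ω' hω' :=
    power.hom_ext (fun i => by
      rw [Category.assoc, power.map_proj, power.lift_proj_assoc, power.lift_proj, h])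
      (by rw [Category.assoc, power.map_toBase, power.lift_toBase_assoc, power.lift_toBase,
        Category.comp_id])
  exact congr($this _)

lemma appTop_constMap {f : X ⟶ Spec (.of k)} {e : Spec (.of k) ⟶ X} (he : e ≫ f = 𝟙 _) (b : k) :
    e.appTop (constMap f ⊤ b) = constMap (𝟙 _) ⊤ b :=
  congr($(constMap_comp_appTop e f) b).trans (by rw [he])

/-- On an integral scheme the product of the functions H − b over b in S is nonzero; the open set is
its nonvanishing locus. -/
lemma exists_opens_forall_appTop_notMem [IsIntegral X] {f : X ⟶ Spec (.of k)} (H : Γ(X, ⊤))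
    (hH : ∀ a, H ≠ constMap f ⊤ a) {S : Set k} (hS : S.Finite) :
    ∃ O : X.Opens, (O : Set X).Nonempty ∧ ∀ e : Spec (.of k) ⟶ X, e ≫ f = 𝟙 _ →
      e (IsLocalRing.closedPoint k) ∈ O → ∀ b ∈ S, e.appTop H ≠ constMap (𝟙 _) ⊤ b := by
  have : Nonempty (⊤ : X.Opens) := ⟨⟨Classical.arbitrary X, trivial⟩⟩
  have hP : ∏ b ∈ hS.toFinset, (H - constMap f ⊤ b) ≠ 0 :=
    Finset.prod_ne_zero_iff.mpr fun b _ => sub_ne_zero.mpr (hH b)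
  refine ⟨X.basicOpen (∏ b ∈ hS.toFinset, (H - constMap f ⊤ b)), ?_, fun e he heO b hb heq => ?_⟩
  · rw [Set.nonempty_iff_ne_empty]
    intro h
    exact hP ((basicOpen_eq_bot_iff _).mp (Opens.ext h))
  · have h1 : e ⁻¹ᵁ X.basicOpen (∏ b ∈ hS.toFinset, (H - constMap f ⊤ b)) = ⊥ := by
      rw [Scheme.preimage_basicOpen]
      refine (basicOpen_eq_bot_iff _).mpr ?_
      refine (map_prod e.appTop.hom _ _).trans
        (Finset.prod_eq_zero (hS.mem_toFinset.mpr hb) ?_)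
      refine (map_sub e.appTop.hom _ _).trans ?_
      exact sub_eq_zero.mpr (heq.trans (appTop_constMap he b).symm)
    exact (h1.le heO : _ ∈ (⊥ : Opens _))
end

section
variable {k : Type u} [Field k] [IsAlgClosed k] [CharZero k] {A₁ : Subalgebra ℤ k}
  {A : FGExtension A₁} {m : ℕ}
  {X 𝒳 : Scheme.{u}} {f : X ⟶ Spec (.of k)} {F : 𝒳 ⟶ Spec (.of A₁)} {g : X ⟶ 𝒳}
  {N M Nk Mk : Scheme.{u}}
  {c : N ⟶ Spec (.of A₁)} {π : power m F ⟶ N} {c' : M ⟶ Spec (.of A₁)}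
  {π' : power m (pullback.fst F (projectiveSpace.toSpec 1 A₁) ≫ F) ⟶ M}
  {a : Nk ⟶ N} {ck : Nk ⟶ Spec (.of k)} {a' : Mk ⟶ M} {ck' : Mk ⟶ Spec (.of k)}

/-- A nonconstant function h from the model separates general points. The graphs of its integer
polynomials of degree below m then realize, up to closure, all tuples of ℙ¹-coordinates. -/
theorem dense_nearIntegralSet_of_not_isIso (hm : 0 < m) [IsLocallyNoetherian (Spec (.of A₁))]
    [LocallyOfFiniteType F] [IsSeparated F] [IsIntegral X] (hf : ¬ IsIso f)
    (hA : ∀ (p : Ideal A.1) [p.IsPrime], p.height = 1 → ValuationRing (Localization.AtPrime p))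
    (sq : IsPullback g f F (specToSubring k A₁))
    (hN : IsSymPower m F c π) (sqN : IsPullback a ck c (specToSubring k A₁))
    (hM : IsSymPower m (pullback.fst F (projectiveSpace.toSpec 1 A₁) ≫ F) c' π')
    (sqM : IsPullback a' ck' c' (specToSubring k A₁))
    (hD : Dense (nearIntegralSet A c a ck)) : Dense (nearIntegralSet A c' a' ck') := by
  have : LocallyOfFiniteType f := MorphismProperty.of_isPullback sq inferInstance
  obtain ⟨U, hU, hxU⟩ : ∃ U : 𝒳.Opens, IsAffineOpen U ∧ g (Classical.arbitrary X) ∈ U := by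
    obtain ⟨_, ⟨U, hU : IsAffineOpen U, rfl⟩, hxU, -⟩ :=
      𝒳.isBasis_affineOpens.exists_subset_of_mem_open (Set.mem_univ (g (Classical.arbitrary X)))
        isOpen_univ
    exact ⟨U, hU, hxU⟩
  have : IsAffine U := hU
  let v := pullback.fst g U.ι
  let gV := pullback.snd g U.ι
  have hv : v ≫ g = gV ≫ U.ι := pullback.condition
  have sqV : IsPullback gV (v ≫ f) (U.ι ≫ F) (Spec.map (CommRingCat.ofHom (algebraMap A₁ k))) :=
    (IsPullback.of_hasPullback g U.ι).flip.paste_vert sq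
  have : Nonempty (pullback g U.ι : Scheme.{u}) := by
    obtain ⟨z, -, -⟩ := Scheme.Pullback.exists_preimage_pullback (f := g) (g := U.ι)
      (Classical.arbitrary X) ⟨_, hxU⟩ rfl
    exact ⟨z⟩
  have : IsIntegral (pullback g U.ι : Scheme.{u}) := isIntegral_of_isOpenImmersion v
  obtain ⟨h, hh⟩ := exists_forall_appTop_ne_constMap v sqV hf
  let πM := hM.baseChange (isPullback_lineBaseChange (φ := algebraMap A₁ k) sq) sqM
  have : Flat (Spec.map (CommRingCat.ofHom (algebraMap A₁ k))) := flat_specToSubring A₁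
  have hπM : IsSymPower m _ ck' πM :=
    hM.isSymPower_baseChange (isPullback_lineBaseChange (φ := algebraMap A₁ k) sq) sqM
  have hZ : IsClosed (closure (nearIntegralSet A c' a' ck')) := isClosed_closure
  have key : πM ⁻¹' closure (nearIntegralSet A c' a' ck') = Set.univ := by
    refine eq_univ_of_tuplePoint_linePoint_mem f (hZ.preimage πM.continuous)
      -- Good points lie in the affine open V, and related points have different values of h.
      (fun e => ∃ e', e' ≫ v = e)
      (fun e₁ e₂ => ∀ e₁' e₂', e₁' ≫ v = e₁ → e₂' ≫ v = e₂ →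
        e₁'.appTop (gV.appTop h) ≠ e₂'.appTop (gV.appTop h)) ?_ ?_
    · intro s hs
      obtain ⟨O, hO, hO'⟩ := exists_opens_forall_appTop_notMem (gV.appTop h) hh
        -- The values to avoid: each of the given points has at most one value of h, as it lifts to
        -- V in at most one way.
        (S := ⋃ e ∈ s, {b | ∃ e', e' ≫ v = e ∧ e'.appTop (gV.appTop h) = constMap (𝟙 _) ⊤ b})
        (hs.biUnion fun e _ => Set.Subsingleton.finite (by
          rintro b ⟨e₁, h₁, hb⟩ b' ⟨e₂, h₂, hb'⟩
          rw [← h₂, cancel_mono] at h₁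
          subst h₁
          exact bijective_constMap_id.1 (hb.symm.trans hb')))
      refine ⟨v ''ᵁ O, hO.image _, fun e he heO => ?_⟩
      have hr : Set.range e ⊆ Set.range v := by
        rintro _ ⟨x, rfl⟩
        rw [Subsingleton.elim x (IsLocalRing.closedPoint k)]
        exact Set.image_subset_range _ _ heO
      have hl := IsOpenImmersion.lift_fac v e hr
      generalize IsOpenImmersion.lift v e hr = l at hl
      have hlO : l (IsLocalRing.closedPoint k) ∈ O := by
        rw [← hl] at heO
        obtain ⟨z, hz, hz'⟩ := heO
        have : z = l (IsLocalRing.closedPoint k) := v.isOpenEmbedding.injective hz'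
        exact this ▸ hz
      have hlf : l ≫ v ≫ f = 𝟙 _ := by rw [← Category.assoc, hl, he]
      have hne : ∀ e' ∈ s, ∀ l', l' ≫ v = e' →
          l.appTop (gV.appTop h) ≠ l'.appTop (gV.appTop h) := by
        intro e' he' l' hl' heq
        obtain ⟨b, hb⟩ := bijective_constMap_id.2 (l'.appTop (gV.appTop h))
        refine hO' l hlf hlO b ?_ (heq.trans hb.symm)
        simp only [Set.mem_iUnion]
        exact ⟨e', he', l', hl', hb.symm⟩
      refine ⟨⟨l, hl⟩, fun e' he' => ⟨fun l₁ l₂ h₁ h₂ => ?_, fun l₁ l₂ h₁ h₂ => ?_⟩⟩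
      · rw [← hl, cancel_mono] at h₁
        subst h₁
        exact hne e' he' l₂ h₂
      · rw [← hl, cancel_mono] at h₂
        subst h₂
        exact (hne e' he' l₁ h₁).symm
    · intro ξ hξ hgood hrel
      choose l hl using hgood
      choose b hb using fun i => bijective_constMap_id.2 ((l i).appTop (gV.appTop h))
      have hbinj : Function.Injective b := by
        intro i j hij
        by_contra hne
        refine hrel i j hne (l i) (l j) (hl i) (hl j) ?_
        rw [← hb, ← hb, hij]
      -- The distinct values b make the Vandermonde matrix invertible; it sends the coefficients n
      -- to the values of ∑ n_j h^j at the points.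
      refine tuplePoint_linePoint_mem f (hZ.preimage πM.continuous) ξ hξ (Matrix.vandermonde b)
        (isUnit_iff_ne_zero.mpr (Matrix.det_vandermonde_ne_zero_iff.mpr hbinj)) fun n => ?_
      have hlf i : l i ≫ v ≫ f = 𝟙 _ := by rw [← Category.assoc, hl, hξ]
      have hσ : linePoint f v (gV.appTop (∑ j, (n j : Γ(U, ⊤)) * h ^ (j : ℕ))) ≫
          pullback.fst f (projectiveSpace.toSpec 1 k) ≫ f = (v ≫ f) ≫ 𝟙 _ := by
        rw [← Category.assoc, linePoint_fst, Category.comp_id]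
      have := map_mem_of_nearIntegralSet_subset sq sqM hm hA hN sqN hM hD hZ subset_closure U.ι v hv
        (∑ j, (n j : Γ(U, ⊤)) * h ^ (j : ℕ)) hσ (tuplePoint l hlf)
      rw [map_tuplePoint _ hσ l hlf _ (fun i => linePoint_comp f (hξ i)) (fun i => ?_)] at this
      · exact this
      rw [comp_linePoint, hl]
      congr 1
      refine Eq.trans (b := ((l i).appTop.hom.comp gV.appTop.hom) (∑ j, (n j : Γ(U, ⊤)) * h ^ (j : ℕ)))
        rfl ?_
      have hb' : ((l i).appTop.hom.comp gV.appTop.hom) h = constMap (𝟙 _) ⊤ (b i) := (hb i).symm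
      simp only [map_sum, map_mul, map_intCast, map_pow, hb', Matrix.mulVec, dotProduct,
        Matrix.vandermonde_apply]
      exact Finset.sum_congr rfl fun j _ => mul_comm _ _
  rw [dense_iff_closure_eq, Set.eq_univ_iff_forall]
  intro y
  obtain ⟨x, rfl⟩ := hπM.surjective.surj y
  exact (Set.eq_univ_iff_forall.mp key x : _)
end

lemma affineFinite_proj {A σ : Type u} [CommRing A] [SetLike σ A] [AddSubgroupClass σ A] (𝒜 : ℕ → σ)
    [GradedRing 𝒜] : AffineFinite (Proj 𝒜) :=
  affineFinite_of_isImmersion 𝒜 (𝟙 (Proj 𝒜))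

lemma affineFinite_projectiveSpace (n : ℕ) (R : Type u) [CommRing R] :
    AffineFinite (projectiveSpace n R) :=
  affineFinite_proj (MvPolynomial.homogeneousSubmodule (Fin (n + 1)) R)

/-! ### The case where X is a point. -/

section
variable {k : Type u} [Field k]

lemma isNoetherianRing_of_fg {A : Subalgebra ℤ k} (h : A.FG) : IsNoetherianRing A := by
  have : Algebra.FiniteType ℤ A := A.fg_iff_finiteType.mp h
  exact Algebra.FiniteType.isNoetherianRing ℤ A

lemma NearIntegral.of_spec {A₁ : Subalgebra ℤ k} (A : FGExtension A₁) {N : Scheme.{u}}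
    {c : N ⟶ Spec (.of A₁)} (T : Spec (.of A.1) ⟶ N)
    (hT : T ≫ c = Spec.map (CommRingCat.ofHom A.base)) : NearIntegral A c (specToSubring k A.1 ≫ T) := by
  refine ⟨Spec.map (CommRingCat.ofHom (algebraMap A.1 (FractionRing A.1))) ≫ T, ?_, ?_,
    fun p _ _ => ⟨Spec.map (CommRingCat.ofHom (algebraMap A.1 (Localization.AtPrime p))) ≫ T, ?_, ?_⟩⟩
  · rw [← Category.assoc, specToFraction_comp]
  · rw [Category.assoc, hT]
  · rw [Category.assoc, hT]
  · rw [← Category.assoc, specFractionToLocal_comp]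

variable [IsAlgClosed k] [CharZero k]

/-- Here X has no nonconstant function, but the model Spec of the image of ℤ is explicit and tuples
of integers on the affine line are integral points outright. -/
theorem isArithmeticallySpecial_symPower_line_of_isIso {X : Scheme.{u}} (f : X ⟶ Spec (.of k))
    [IrreducibleSpace X] [IsIso f] {m : ℕ} (hm : 0 < m) : IsArithmeticallySpecial k
      (symPower m (pullback.fst f (projectiveSpace.toSpec 1 k) ≫ f))
      (symPower.toBase m (pullback.fst f (projectiveSpace.toSpec 1 k) ≫ f)) := by
  let A₁ : Subalgebra ℤ k := ⊥
  have hA₁ : A₁.FG := Subalgebra.fg_bot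
  have : IsNoetherianRing A₁ := isNoetherianRing_of_fg hA₁
  let A : FGExtension A₁ := ⟨A₁, le_rfl, hA₁⟩
  have hbase : Spec.map (CommRingCat.ofHom A.base) = 𝟙 _ := Spec.map_id _
  have sq : IsPullback (f ≫ specToSubring k A₁) f (𝟙 (Spec (.of A₁))) (specToSubring k A₁) :=
    IsPullback.of_vert_isIso ⟨Category.comp_id _⟩
  obtain ⟨M, c, π, hM⟩ := exists_isSymPower hm
    (pullback.fst (𝟙 (Spec (.of A₁))) (projectiveSpace.toSpec 1 A₁) ≫ 𝟙 (Spec (.of A₁)))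
    (AffineFinite.pullback _ _ (AffineFinite.of_isAffine _) (affineFinite_projectiveSpace 1 A₁))
  have : LocallyOfFiniteType c := hM.locallyOfFiniteType
  have : QuasiCompact c := hM.quasiCompact
  have : IsSeparated c := hM.isSeparated
  have sqM := IsPullback.of_hasPullback c (specToSubring k A₁)
  have : Flat (Spec.map (CommRingCat.ofHom (algebraMap A₁ k))) := flat_specToSubring A₁
  let πM := hM.baseChange (isPullback_lineBaseChange (φ := algebraMap A₁ k) sq) sqM
  have hπM : IsSymPower m _ _ πM :=
    hM.isSymPower_baseChange (isPullback_lineBaseChange (φ := algebraMap A₁ k) sq) sqM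
  refine isArithmeticallySpecial_of_isSymPower (A := A) hπM sqM ?_
  change Dense (nearIntegralSet A c _ _)
  have hZ : IsClosed (closure (nearIntegralSet A c (pullback.fst c (specToSubring k A₁))
    (pullback.snd c (specToSubring k A₁)))) := isClosed_closure
  have key : πM ⁻¹' closure (nearIntegralSet A c (pullback.fst c (specToSubring k A₁))
    (pullback.snd c (specToSubring k A₁))) = Set.univ := by
    refine eq_univ_of_tuplePoint_linePoint_mem f (hZ.preimage πM.continuous) (fun _ => True)
      (fun _ _ => True) (fun s _ => ⟨⊤, Set.univ_nonempty, fun _ _ _ => ⟨trivial, fun _ _ => ⟨trivial,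
        trivial⟩⟩⟩) fun ξ hξ _ _ => ?_
    -- The identity matrix takes the integers themselves as coordinates.
    refine tuplePoint_linePoint_mem f (hZ.preimage πM.continuous) ξ hξ 1 (by simp) fun n => ?_
    refine subset_closure ⟨power.lift (𝟙 _) _ (fun i => linePoint_comp f (hξ i)) ≫ πM, ?_, ?_, rfl⟩
    · rw [Category.assoc, hπM.comp, power.lift_toBase]
    · let q (i : Fin m) : Spec (.of A₁) ⟶ pullback (𝟙 (Spec (.of A₁))) (projectiveSpace.toSpec 1 A₁) :=
        linePoint (𝟙 _) (𝟙 _) (constMap (𝟙 _) ⊤ (n i : A₁))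
      have hq i : q i ≫ pullback.fst (𝟙 (Spec (.of A₁))) (projectiveSpace.toSpec 1 A₁) ≫ 𝟙 _ = 𝟙 _ := by
        rw [← Category.assoc, linePoint_fst, Category.comp_id]
      have e : power.lift (𝟙 _) (fun i => linePoint f (ξ i) (constMap (𝟙 _) ⊤
            ((1 : Matrix (Fin m) (Fin m) k).mulVec (fun j => (n j : k)) i)))
            (fun i => linePoint_comp f (hξ i)) ≫
          power.map m (lineBaseChange (φ := algebraMap A₁ k) sq) _
            (isPullback_lineBaseChange (φ := algebraMap A₁ k) sq).w =
          specToSubring k A₁ ≫ power.lift (𝟙 _) q hq := by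
        refine power.hom_ext (fun i => ?_) ?_
        · rw [Category.assoc, power.map_proj, power.lift_proj_assoc, Category.assoc, power.lift_proj]
          refine (linePoint_lineBaseChange (φ := algebraMap A₁ k) sq _ _).trans ?_
          unfold q
          rw [comp_linePoint, Category.comp_id, ← Category.assoc, hξ, Category.id_comp]
          congr 1
          refine Eq.trans ?_ (appTop_constMap_id (algebraMap A₁ k) (n i : A₁)).symm
          rw [Matrix.one_mulVec, map_intCast (algebraMap A₁ k)]
        · rw [Category.assoc, power.map_toBase, power.lift_toBase_assoc, Category.assoc,
            power.lift_toBase, Category.id_comp, Category.comp_id]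
          rfl
      have := NearIntegral.of_spec A (power.lift (𝟙 _) q hq ≫ π) (by
        rw [Category.assoc, hM.comp, power.lift_toBase, hbase])
      have e' : (power.lift (𝟙 _) (fun i => linePoint f (ξ i) (constMap (𝟙 _) ⊤
            ((1 : Matrix (Fin m) (Fin m) k).mulVec (fun j => (n j : k)) i)))
            (fun i => linePoint_comp f (hξ i)) ≫ πM) ≫ pullback.fst c (specToSubring k A₁) =
          specToSubring k A₁ ≫ power.lift (𝟙 _) q hq ≫ π := by
        rw [Category.assoc, hM.baseChange_fst (isPullback_lineBaseChange (φ := algebraMap A₁ k) sq) sqM,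
          ← Category.assoc, e, Category.assoc]
      rw [e']
      exact this
  rw [dense_iff_closure_eq, Set.eq_univ_iff_forall]
  intro y
  obtain ⟨x, rfl⟩ := hπM.surjective.surj y
  exact (Set.eq_univ_iff_forall.mp key x : _)
end

/-! ### Enlarging the base ring and comparing models. -/

section
variable {A B : Type u} [CommRing A] [IsDomain A] [CommRing B] [IsDomain B] (φ : A →+* B)
  (hφ : Function.Injective φ)

/-- The homomorphism of fraction fields induced by an injection of domains. -/
def fractionMap : FractionRing A →+* FractionRing B :=
  IsLocalization.map (FractionRing B) φ
    (nonZeroDivisors_le_comap_nonZeroDivisors_of_injective φ hφ)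

lemma fractionMap_comp : (fractionMap φ hφ).comp (algebraMap A (FractionRing A)) =
    (algebraMap B (FractionRing B)).comp φ :=
  IsLocalization.map_comp _

/-- If p contracts to zero, the fraction field of `A` maps to the localization of `B` at p and the
generic point suffices. Otherwise the contraction has height one and the given extension is pulled
back along the map of local rings. -/
lemma exists_spec_localization_of_nearIntegralPoints {Y : Scheme.{u}} {g : Y ⟶ Spec (.of A)}
    {P : Spec (.of (FractionRing A)) ⟶ Y} (hP : P ∈ nearIntegralPoints A g) (p : Ideal B) [p.IsPrime]
    (hp : (p.comap φ).height ≤ 1) : ∃ Q : Spec (.of (Localization.AtPrime p)) ⟶ Y,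
      Q ≫ g = Spec.map (CommRingCat.ofHom (algebraMap B (Localization.AtPrime p))) ≫
        Spec.map (CommRingCat.ofHom φ) ∧
      specFractionToLocal B p ≫ Q = Spec.map (CommRingCat.ofHom (fractionMap φ hφ)) ≫ P := by
  rcases lt_or_eq_of_le hp with hp | hp
  · have hbot : p.comap φ = ⊥ := by
      have := Ideal.height_eq_zero_iff.mp (Order.lt_one_iff.mp hp)
      rwa [IsDomain.minimalPrimes_eq_singleton_bot] at this
    have hu (y : nonZeroDivisors A) :
        IsUnit (((algebraMap B (Localization.AtPrime p)).comp φ) y) := by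
      refine IsLocalization.map_units (Localization.AtPrime p) (⟨φ y, fun h => ?_⟩ : p.primeCompl)
      have h' : (y : A) ∈ p.comap φ := h
      rw [hbot] at h'
      exact nonZeroDivisors.ne_zero y.2 h'
    let κ : FractionRing A →+* Localization.AtPrime p := IsLocalization.lift hu
    have hκ : κ.comp (algebraMap A (FractionRing A)) = (algebraMap B (Localization.AtPrime p)).comp φ :=
      IsLocalization.lift_comp hu
    refine ⟨Spec.map (CommRingCat.ofHom κ) ≫ P, ?_, ?_⟩
    · rw [Category.assoc, hP.1, ← Spec.map_comp, ← Spec.map_comp, ← CommRingCat.ofHom_comp,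
        ← CommRingCat.ofHom_comp, hκ]
    · rw [← Category.assoc]
      congr 1
      rw [specFractionToLocal, ← Spec.map_comp, ← CommRingCat.ofHom_comp]
      congr 2
      apply IsLocalization.ringHom_ext (nonZeroDivisors A)
      rw [fractionMap_comp, RingHom.comp_assoc, hκ, ← RingHom.comp_assoc, IsLocalization.lift_comp]
  · obtain ⟨Q, hQ, hQP⟩ := hP.2 (p.comap φ) hp
    have hl : (Localization.localRingHom (p.comap φ) p φ rfl).comp
        (algebraMap A (Localization.AtPrime (p.comap φ))) =
        (algebraMap B (Localization.AtPrime p)).comp φ :=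
      RingHom.ext fun x => Localization.localRingHom_to_map _ _ _ rfl x
    refine ⟨Spec.map (CommRingCat.ofHom (Localization.localRingHom (p.comap φ) p φ rfl)) ≫ Q, ?_, ?_⟩
    · rw [Category.assoc, hQ, ← Spec.map_comp, ← Spec.map_comp, ← CommRingCat.ofHom_comp,
        ← CommRingCat.ofHom_comp, hl]
    · rw [← hQP, ← Category.assoc, ← Category.assoc]
      congr 1
      rw [specFractionToLocal, specFractionToLocal, ← Spec.map_comp, ← CommRingCat.ofHom_comp,
        ← Spec.map_comp, ← CommRingCat.ofHom_comp]
      congr 2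
      apply IsLocalization.ringHom_ext (p.comap φ).primeCompl
      rw [RingHom.comp_assoc, hl, ← RingHom.comp_assoc, IsLocalization.lift_comp, RingHom.comp_assoc,
        IsLocalization.lift_comp, fractionMap_comp]
end

section
variable {k : Type u} [Field k] {A₀ : Subalgebra ℤ k}

lemma FGExtension.base_injective (A : FGExtension A₀) : Function.Injective A.base :=
  Subalgebra.inclusion_injective A.2.1

lemma lift_comp_fractionMap {A B K : Type u} [CommRing A] [IsDomain A] [CommRing B] [IsDomain B]
    [Field K] {φ : A →+* B} (hφ : Function.Injective φ) {a : A →+* K} {b : B →+* K}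
    (ha : Function.Injective a) (hb : Function.Injective b) (h : b.comp φ = a) :
    (IsFractionRing.lift (K := FractionRing B) hb).comp (fractionMap φ hφ) =
      IsFractionRing.lift (K := FractionRing A) ha := by
  apply IsLocalization.ringHom_ext (nonZeroDivisors A)
  rw [RingHom.comp_assoc, fractionMap_comp, ← RingHom.comp_assoc]
  ext x
  refine (IsFractionRing.lift_algebraMap hb _).trans
    (Eq.trans ?_ (IsFractionRing.lift_algebraMap ha x).symm)
  exact congr($h x)

lemma specToFraction_fractionMap (A : FGExtension A₀) : specToFraction k A.1 ≫
    Spec.map (CommRingCat.ofHom (fractionMap A.base A.base_injective)) = specToFraction k A₀ := by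
  rw [specToFraction, specToFraction, ← Spec.map_comp, ← CommRingCat.ofHom_comp]
  exact congr_arg (fun z => Spec.map (CommRingCat.ofHom z)) (lift_comp_fractionMap A.base_injective
    (a := algebraMap A₀ k) (b := algebraMap A.1 k) Subtype.val_injective Subtype.val_injective rfl)

lemma affineFinite_of_isImmersion_of_iso {σ A : Type u} [CommRing A] [SetLike σ A]
    [AddSubgroupClass σ A] (𝒜 : ℕ → σ) [GradedRing 𝒜] {X Y : Scheme.{u}} (j : X ⟶ Y)
    [IsImmersion j] (e : Y ≅ Proj 𝒜) : AffineFinite X :=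
  affineFinite_of_isImmersion 𝒜 (j ≫ e.hom)

lemma affineFinite_of_isImmersion_projectiveSpace {X Y : Scheme.{u}} {n : ℕ} {R : Type u}
    [CommRing R] (j : X ⟶ Y) [IsImmersion j] (e : Y ≅ projectiveSpace n R) : AffineFinite X :=
  affineFinite_of_isImmersion_of_iso (MvPolynomial.homogeneousSubmodule (Fin (n + 1)) R) j e

/-- An extension of an extension. -/
abbrev FGExtension.trans (E : FGExtension A₀) (A : FGExtension E.1) : FGExtension A₀ :=
  ⟨A.1, E.2.1.trans A.2.1, A.2.2⟩

/-- A near-integral point remains near-integral over an extension whose primes of height one lie over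
primes of height at most one. -/
lemma exists_nearIntegral_baseChange (B : FGExtension A₀)
    {Y Yk : Scheme.{u}} {g : Y ⟶ Spec (.of A₀)}
    (hB : ∀ (p : Ideal B.1) [p.IsPrime], p.height = 1 → (p.comap B.base).height ≤ 1)
    {P : Spec (.of (FractionRing A₀)) ⟶ Y} (hP : P ∈ nearIntegralPoints A₀ g)
    {p : Yk ⟶ Y} {pk : Yk ⟶ Spec (.of k)} (sq : IsPullback p pk g (specToSubring k A₀))
    (r : Spec (.of k) ⟶ Yk) (hr : r ≫ p = specToFraction k A₀ ≫ P) (hr' : r ≫ pk = 𝟙 _) :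
    ∃ P' ∈ nearIntegralPoints B.1 (B.snd g), specToFraction k B.1 ≫ P' = r ≫ B.lift sq := by
  have sqB := B.isPullback g
  have hw : (Spec.map (CommRingCat.ofHom (fractionMap B.base B.base_injective)) ≫ P) ≫ g =
      Spec.map (CommRingCat.ofHom (algebraMap B.1 (FractionRing B.1))) ≫
        Spec.map (CommRingCat.ofHom B.base) := by
    rw [Category.assoc, hP.1, ← Spec.map_comp, ← Spec.map_comp, ← CommRingCat.ofHom_comp,
      ← CommRingCat.ofHom_comp, fractionMap_comp]
  refine ⟨sqB.lift _ _ hw, ⟨sqB.lift_snd _ _ _, fun q hqp hq => ?_⟩, sqB.hom_ext ?_ ?_⟩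
  · obtain ⟨Q, hQ, hQP⟩ := exists_spec_localization_of_nearIntegralPoints B.base
      B.base_injective hP q (hB q hq)
    refine ⟨sqB.lift Q _ hQ, sqB.lift_snd _ _ _, sqB.hom_ext ?_ ?_⟩
    · rw [Category.assoc, sqB.lift_fst, sqB.lift_fst, hQP]
    · rw [Category.assoc, sqB.lift_snd, sqB.lift_snd, specFractionToLocal_comp]
  · rw [Category.assoc, sqB.lift_fst, Category.assoc, FGExtension.lift_fst, hr, ← Category.assoc,
      specToFraction_fractionMap]
  · rw [Category.assoc, sqB.lift_snd, Category.assoc, FGExtension.lift_snd, ← Category.assoc, hr',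
      Category.id_comp, specToFraction_comp]

lemma NearIntegral.of_mem_nearIntegralPoints (E : FGExtension A₀) (A : FGExtension E.1)
    {Y N : Scheme.{u}} {g : Y ⟶ Spec (.of A.1)} {c : N ⟶ Spec (.of E.1)} (Ψ : Y ⟶ N)
    (hΨ : Ψ ≫ c = g ≫ Spec.map (CommRingCat.ofHom A.base))
    {P : Spec (.of (FractionRing A.1)) ⟶ Y} (hP : P ∈ nearIntegralPoints A.1 g) :
    NearIntegral A c (specToFraction k A.1 ≫ P ≫ Ψ) := by
  refine ⟨P ≫ Ψ, rfl, ?_, fun q _ hq => ?_⟩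
  · rw [Category.assoc, hΨ, ← Category.assoc, hP.1]
  · obtain ⟨Q, hQ, hQP⟩ := hP.2 q hq
    refine ⟨Q ≫ Ψ, ?_, ?_⟩
    · rw [Category.assoc, hΨ, ← Category.assoc, hQ]
    · rw [← Category.assoc, hQP]

/-- Base change first to E and then to A receives a map from the direct base change to a larger ring
B. It is needed because the spread-out morphism starts on the two-step base change and the
near-integral points live on the direct one. -/
lemma exists_baseChange_hom (E : FGExtension A₀) (A : FGExtension E.1) (B : FGExtension A₀)
    (β : A.1 →+* B.1) (hβ : (β.comp A.base).comp E.base = B.base)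
    (hβ' : (algebraMap B.1 k).comp β = algebraMap A.1 k)
    {Y Yk : Scheme.{u}} {g : Y ⟶ Spec (.of A₀)} {p : Yk ⟶ Y} {pk : Yk ⟶ Spec (.of k)}
    (sq : IsPullback p pk g (specToSubring k A₀)) :
    ∃ l : B.baseChange g ⟶ A.baseChange (E.snd g),
      l ≫ A.fst (E.snd g) ≫ E.snd g = B.snd g ≫ Spec.map (CommRingCat.ofHom (β.comp A.base)) ∧
      B.lift sq ≫ l = A.lift (E.isPullback_lift sq) := by
  have sqE := E.isPullback g
  have sqA := A.isPullback (E.snd g)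
  have h₁ : B.fst g ≫ g = (B.snd g ≫ Spec.map (CommRingCat.ofHom (β.comp A.base))) ≫
      Spec.map (CommRingCat.ofHom E.base) := by
    rw [(B.isPullback g).w, Category.assoc, ← Spec.map_comp, ← CommRingCat.ofHom_comp, hβ]
  have h₂ : sqE.lift _ _ h₁ ≫ E.snd g = (B.snd g ≫ Spec.map (CommRingCat.ofHom β)) ≫
      Spec.map (CommRingCat.ofHom A.base) := by
    rw [sqE.lift_snd, Category.assoc, ← Spec.map_comp, ← CommRingCat.ofHom_comp]
  have h₃ : specToSubring k B.1 ≫ Spec.map (CommRingCat.ofHom β) = specToSubring k A.1 := by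
    rw [specToSubring, specToSubring, ← Spec.map_comp, ← CommRingCat.ofHom_comp, hβ']
  refine ⟨sqA.lift _ _ h₂, ?_, sqA.hom_ext (sqE.hom_ext ?_ ?_) ?_⟩
  · rw [← Category.assoc, sqA.lift_fst, sqE.lift_snd]
  · rw [Category.assoc, Category.assoc, ← Category.assoc (sqA.lift _ _ h₂), sqA.lift_fst,
      sqE.lift_fst, FGExtension.lift_fst, FGExtension.lift_fst, FGExtension.lift_fst]
  · rw [Category.assoc, Category.assoc, ← Category.assoc (sqA.lift _ _ h₂), sqA.lift_fst,
      sqE.lift_snd, FGExtension.lift_fst, FGExtension.lift_snd, ← Category.assoc,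
      FGExtension.lift_snd, Category.assoc, CommRingCat.ofHom_comp, Spec.map_comp,
      ← Category.assoc (specToSubring k B.1), h₃, FGExtension.specToSubring_base]
  · rw [Category.assoc, sqA.lift_snd, ← Category.assoc, FGExtension.lift_snd, FGExtension.lift_snd,
      Category.assoc, h₃]

/-- The immersion into projective space descends after adjoining finitely many elements; the model
is again immersed in a projective space, so its finite sets of points lie in affine opens and its
symmetric powers exist. -/
lemma exists_model_of_isQuasiProjective {X : Scheme.{u}} {f : X ⟶ Spec (.of k)} [QuasiCompact f]
    (hqp : IsQuasiProjective f) (hA₀ : A₀.FG) :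
    ∃ (E : FGExtension A₀) (𝒳 : Scheme.{u}) (F : 𝒳 ⟶ Spec (.of E.1)) (g : X ⟶ 𝒳),
      LocallyOfFiniteType F ∧ QuasiCompact F ∧ IsSeparated F ∧ AffineFinite 𝒳 ∧
      IsPullback g f F (specToSubring k E.1) := by
  obtain ⟨n, i, hi, rfl⟩ := hqp
  have : CompactSpace X := (quasiCompact_iff_compactSpace (f := i ≫ projectiveSpace.toSpec n k)).mp
    inferInstance
  have sq₀ : IsPullback (projectiveSpace.map n (algebraMap A₀ k)) (projectiveSpace.toSpec n k)
    (projectiveSpace.toSpec n A₀) (specToSubring k A₀) := projectiveSpace.isPullback_map n _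
  obtain ⟨T, hT, hdesc⟩ := exists_finite_descent_isImmersion (algebraMap A₀ k) sq₀ i
  let E : FGExtension A₀ := ⟨A₀ ⊔ Algebra.adjoin ℤ T, le_sup_left,
    hA₀.sup ⟨hT.toFinset, by rw [hT.coe_toFinset]⟩⟩
  have : IsAffineHom (E.fst (projectiveSpace.toSpec n A₀)) :=
    MorphismProperty.of_isPullback (E.isPullback _).flip inferInstance
  have sq₁ := E.isPullback_lift sq₀
  obtain ⟨𝒳, j, g, hj, sq⟩ := hdesc (algebraMap E.1 k) (fun x hx => ⟨⟨x, (le_sup_right :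
    Algebra.adjoin ℤ T ≤ E.1) (Algebra.subset_adjoin hx)⟩, rfl⟩) _ _ (E.fst _) sq₁
    (E.lift_fst sq₀) inferInstance
  have hp : IsProper (E.snd (projectiveSpace.toSpec n A₀)) :=
    MorphismProperty.of_isPullback (E.isPullback _) inferInstance
  have : IsNoetherianRing E.1 := isNoetherianRing_of_fg E.2.2
  have : IsLocallyNoetherian (E.baseChange (projectiveSpace.toSpec n A₀)) :=
    LocallyOfFiniteType.isLocallyNoetherian (E.snd (projectiveSpace.toSpec n A₀))
  have : CompactSpace (E.baseChange (projectiveSpace.toSpec n A₀)) :=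
    (quasiCompact_iff_compactSpace (f := E.snd (projectiveSpace.toSpec n A₀))).mp inferInstance
  have : IsNoetherian (E.baseChange (projectiveSpace.toSpec n A₀)) := {}
  have : NoetherianSpace 𝒳 := j.isEmbedding.isInducing.noetherianSpace
  have : QuasiCompact j := quasiCompact_of_noetherianSpace_source j
  refine ⟨E, 𝒳, j ≫ E.snd _, g, inferInstance, inferInstance, inferInstance, ?_, sq.paste_vert sq₁⟩
  let e := (E.isPullback (projectiveSpace.toSpec n A₀)).isoIsPullback _ _
    (projectiveSpace.isPullback_map n E.base)
  exact affineFinite_of_isImmersion_projectiveSpace j e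

end

/-! ### The case where X is not a point. -/

section
variable {k : Type u} [Field k] [IsAlgClosed k] [CharZero k]

theorem isArithmeticallySpecial_symPower_line_of_not_isIso {X : Scheme.{u}} {f : X ⟶ Spec (.of k)}
    (hX : IsVariety f) (hqp : IsQuasiProjective f) (hf : ¬ IsIso f) {m : ℕ} (hm : 0 < m)
    (h : IsArithmeticallySpecial k (symPower m f) (symPower.toBase m f)) : IsArithmeticallySpecial k
      (symPower m (pullback.fst f (projectiveSpace.toSpec 1 k) ≫ f))
      (symPower.toBase m (pullback.fst f (projectiveSpace.toSpec 1 k) ≫ f)) := by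
  obtain ⟨_, _, _, _⟩ := hX
  obtain ⟨A₀, hA₀, 𝒴, g₀, _, _, _, e, he, hdense⟩ := h
  obtain ⟨E, 𝒳, F, g, _, _, _, h𝒳, sq⟩ := exists_model_of_isQuasiProjective hqp hA₀
  have : IsNoetherianRing E.1 := isNoetherianRing_of_fg E.2.2
  obtain ⟨N, c, π, hN⟩ := exists_isSymPower hm F h𝒳
  have sqN := IsPullback.of_hasPullback c (specToSubring k E.1)
  have hπN := hN.isSymPower_baseChange sq sqN
  obtain ⟨M, c', π', hM⟩ := exists_isSymPower hm
    (pullback.fst F (projectiveSpace.toSpec 1 E.1) ≫ F)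
    (AffineFinite.pullback _ _ h𝒳 (affineFinite_projectiveSpace 1 E.1))
  have sqM := IsPullback.of_hasPullback c' (specToSubring k E.1)
  have : Flat (Spec.map (CommRingCat.ofHom (algebraMap E.1 k))) := flat_specToSubring E.1
  have hπM := hM.isSymPower_baseChange (isPullback_lineBaseChange (φ := algebraMap E.1 k) sq) sqM
  obtain ⟨e', he'⟩ := hπN.exists_iso
  -- Over k the given model and the symmetric power of 𝒳 are both Sym^m(X).
  let θ : pullback g₀ (specToSubring k A₀) ⟶ pullback c (specToSubring k E.1) := ⟨e.hom ≫ e'.inv⟩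
  have hθ : θ ≫ pullback.snd _ _ = pullback.snd _ _ := by
    apply Scheme.Hom.ext'
    refine Eq.trans ?_ he
    refine (Category.assoc _ _ _).trans (congr_arg (e.hom ≫ ·) ?_)
    exact (Iso.inv_comp_eq e').mpr he'.symm
  have sq₀ := IsPullback.of_hasPullback g₀ (specToSubring k A₀)
  have sq₁ := E.isPullback_lift sq₀
  have : LocallyOfFiniteType c := hN.locallyOfFiniteType
  have : QuasiCompact (E.snd g₀) := MorphismProperty.of_isPullback (E.isPullback g₀) inferInstance
  have : IsSeparated (E.snd g₀) := MorphismProperty.of_isPullback (E.isPullback g₀) inferInstance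
  have : LocallyOfFinitePresentation c :=
    LocallyOfFinitePresentation.iff_locallyOfFiniteType.mpr inferInstance
  have ha : (θ ≫ pullback.fst _ _) ≫ c = E.lift sq₀ ≫ E.snd g₀ := by
    rw [Category.assoc, pullback.condition, ← Category.assoc, hθ, E.lift_snd]
  obtain ⟨A₂, ψ, hψ, hψ'⟩ := exists_spread_out sq₁ E.2.2 c _ ha
  -- Heights are compared with the original `A₀`, over which the given points are near-integral, and
  -- not with E or `A₂`.
  obtain ⟨A', hA₂, hA', hp⟩ := exists_subalgebra_height_comap_le A₀ A₂.1 (E.2.1.trans A₂.2.1) hA₀ A₂.2.2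
  let A : FGExtension E.1 := ⟨A', A₂.2.1.trans hA₂, hA'⟩
  have hle : A₂ ≤ A := hA₂
  obtain ⟨l, hl, hl'⟩ := exists_baseChange_hom E A₂ (E.trans A) (FGExtension.inclusion hle) rfl rfl sq₀
  have hΨ : (l ≫ ψ) ≫ c = (E.trans A).snd g₀ ≫ Spec.map (CommRingCat.ofHom A.base) := by
    rw [Category.assoc, hψ]
    exact hl
  -- The dense near-integral points of 𝒴 are base changed to the larger ring and then pushed along
  -- the spread-out morphism to N.
  have hD : Dense (nearIntegralSet A c (pullback.fst c (specToSubring k E.1))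
      (pullback.snd c (specToSubring k E.1))) := by
    have hsurj : Function.Surjective e'.inv.base :=
      (TopCat.epi_iff_surjective _).mp (inferInstanceAs (Epi
        ((LocallyRingedSpace.forgetToTop.mapIso e').inv)))
    refine (hsurj.denseRange.dense_image e'.inv.base.hom.continuous hdense).mono ?_
    rintro _ ⟨_, ⟨P, hP, r, hr, hr', t, rfl⟩, rfl⟩
    refine ⟨r ≫ θ, by rw [Category.assoc, hθ, hr'], ?_, ?_⟩
    · obtain ⟨P', hP', hPr⟩ := exists_nearIntegral_baseChange (E.trans A)
        (fun p _ h1 => (hp p h1).2) hP sq₀ r hr hr'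
      have := NearIntegral.of_mem_nearIntegralPoints E A (l ≫ ψ) hΨ hP'
      rw [Category.assoc, ← hψ', ← hl']
      refine cast ?_ this
      congr 1
      exact (Category.assoc _ _ _).symm.trans ((congr_arg (· ≫ l ≫ ψ) hPr).trans
        (by simp only [Category.assoc]))
    · rw [Subsingleton.elim t (IsLocalRing.closedPoint k)]
      rfl
  have hdenseM := dense_nearIntegralSet_of_not_isIso hm hf (fun p _ h1 => (hp p h1).1) sq hN sqN hM
    sqM hD
  have : LocallyOfFiniteType c' := hM.locallyOfFiniteType
  have : QuasiCompact c' := hM.quasiCompact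
  have : IsSeparated c' := hM.isSeparated
  exact isArithmeticallySpecial_of_isSymPower (A := A) hπM sqM hdenseM
end

end SymArith

end

theorem mainTheorem11 {k : Type*} [Field k] [IsAlgClosed k] [CharZero k]
    {X : Scheme} (f : X ⟶ Spec (.of k))
    (hX : SymArith.IsVariety f) (hqp : SymArith.IsQuasiProjective f)
    (m : ℕ) (hm : 1 ≤ m)
    (h : SymArith.IsArithmeticallySpecial k (SymArith.symPower m f)
      (SymArith.symPower.toBase m f)) :
    SymArith.IsArithmeticallySpecial k
      (SymArith.symPower m
        (pullback.fst f (SymArith.projectiveSpace.toSpec 1 k) ≫ f))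
      (SymArith.symPower.toBase m
        (pullback.fst f (SymArith.projectiveSpace.toSpec 1 k) ≫ f)) := by
  by_cases hf : IsIso f
  · have := hX.integral
    exact SymArith.isArithmeticallySpecial_symPower_line_of_isIso f hm
  · exact SymArith.isArithmeticallySpecial_symPower_line_of_not_isIso hX hqp hf hm h
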